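/- **Setting.** Let $\mathcal S$ be a countable state space, $\mathcal A$ a finite action set and $\mathcal Z=\mathcal S\times\mathcal A\times\mathcal A$. A *kernel mixture two-player zero-sum Markov game* with horizon $H\ge 1$ consists of known rewards $r_h:\mathcal Z\to[-1,1]$ and transition probabilities $\mathbb P_h(s'\mid z)=\langle\phi(s'\mid z),\theta_h^*\rangle_{\mathcal H}$, $h\in[H]$, where $\mathcal H$ is a real Hilbert space (e.g. an RKHS), $\phi:\mathcal S\times\mathcal Z\to\mathcal H$ is a feature map and $\theta_h^*\in\mathcal H$; for each $V:\mathcal S\to[-1,1]$ and $z\in\mathcal Z$ the sum $\phi_V(z)=\sum_{s'}V(s')\phi(s'\mid z)$ converges and $\|\phi_V(z)\|_{\mathcal H}\le1$. Put $k_{V_1,V_2}(z_1,z_2)=\sum_{s_1,s_2}V_1(s_1)V_2(s_2)\langle\phi(s_1\mid z_1),\phi(s_2\mid z_2)\rangle_{\mathcal H}$ and $$\Gamma_K(T,\lambda)=\sup_{V_1,\dots,V_T:\mathcal S\to[-H,H],\ z_1,\dots,z_T\in\mathcal Z}\ \tfrac12\log\det\Big(I+\tfrac1\lambda\big[k_{V_p,V_q}(z_p,z_q)\big]_{p,q\le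 T}\Big).$$ For (randomized, Markov) policies $\pi,\nu$ of the maximizing and the minimizing player let $V_h^{\pi,\nu}(x)$ be the expected total reward from step $h$ on when $x_h=x$, and let $V_h^{*,\nu}=\sup_\pi V_h^{\pi,\nu}$ and $V_h^{\pi,*}=\inf_\nu V_h^{\pi,\nu}$ (best responses). **Algorithm KernelCCE-VTR** (parameters $\lambda,\beta>0$). In episode $t=1,\dots,T$ set $\overline V_{H+1}^t=\underline V_{H+1}^t=0$ and for $h=H,\dots,1$ let $\overline\theta_h^t$ be the minimizer over $\theta\in\mathcal H$ of $\sum_{\tau<t}\big[\overline V_{h+1}^\tau(x_{h+1}^\tau)-\langle\phi_{\overline V_{h+1}^\tau}(z_h^\tau),\theta\rangle\big]^2+\lambda\|\theta\|^2$, let $$\overline{\mathcal C}_h^t=\Big\{\theta:\ \big(\lambda\|\theta-\overline\theta_h^t\|^2+\textstyle\sum_{\tau<t}\langle\phi_{\overline V_{h+1}^\tau}(z_h^\tau),\theta-\overline\theta_h^t\rangle^2\big)^{1/2}\le\beta\Big\},\qquad \overline Q_h^t=\Pi_{[-H,H]}\Big[r_h+\max_{\theta\in\overline{\mathcal C}_h^t}\langle\phi_{\overline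 V_{h+1}^t},\theta\rangle\Big],$$ and define $\underline\theta_h^t,\underline{\mathcal C}_h^t,\underline Q_h^t$ in the same way from the $\underline V$'s, with $\min$ in place of $\max$. For every state $x$ a subroutine returns a coarse correlated equilibrium $\sigma_h^t(x)$ of $(\overline Q_h^t(x,\cdot,\cdot),\underline Q_h^t(x,\cdot,\cdot))$, i.e. a distribution $\sigma$ on $\mathcal A\times\mathcal A$ with $\mathbb E_{\sigma}\overline Q_h^t(x,a,b)\ge\mathbb E_{\sigma}\overline Q_h^t(x,a',b)$ for all $a'$ and $\mathbb E_{\sigma}\underline Q_h^t(x,a,b)\le\mathbb E_{\sigma}\underline Q_h^t(x,a,b')$ for all $b'$. Put $\overline V_h^t(x)=\mathbb E_{\sigma_h^t(x)}\overline Q_h^t(x,a,b)$ and $\underline V_h^t(x)=\mathbb E_{\sigma_h^t(x)}\underline Q_h^t(x,a,b)$. Then an arbitrary initial state $x_1^t$ (possibly depending on the past) is received, and for $h=1,\dots,H$ the players draw $(a_h^t,b_h^t)\sim\sigma_h^t(x_h^t)$ and observe $x_{h+1}^t\sim\mathbb P_h(\cdot\mid z_h^t)$, $z_h^t=(x_h^t,a_h^t,b_h^t)$.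 Let $\pi_h^t(x)$ and $\nu_h^t(x)$ be the first and the second marginal of $\sigma_h^t(x)$, and $$\mathrm{Regret}(T)=\sum_{t=1}^T\Big(V_1^{*,\nu^t}(x_1^t)-V_1^{\pi^t,*}(x_1^t)\Big).$$ **Theorem (RKHS function approximation).** There is a universal constant $C>0$ such that for every kernel mixture two-player zero-sum Markov game with $\|\theta_h^*\|_{\mathcal H}\le B$ for all $h\in[H]$, every $T\ge1$, every $\delta>0$, $\lambda=1+1/T$, and every $\beta>0$ with $$\left(\beta/H\right)^2\ \ge\ 2\Gamma_K(T,\lambda)+2+4\log(H/\delta)+2\lambda\,(B/H)^2,$$ KernelCCE-VTR satisfies, with probability at least $1-\delta$, $$\mathrm{Regret}(T)\ \le\ C\Big(\beta H\sqrt{T\cdot\Gamma_K(T,\lambda)}+1\Big).$$ Moreover, for every $B$ there is a constant $C_B$, depending on $B$ only, such that in the same setting with $\delta\in(0,1)$ and $\beta$ chosen with equality in the above condition, with probability at least $1-\delta$, $$\mathrm{Regret}(T)\ \le\ C_B\,\Gamma_K(T,\lambda)\,H^2\sqrt T\,\sqrt{1+\log(H/\delta)},$$ that is, $\mathrm{Regret}(T)=\tilde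 O(\Gamma_K(T,\lambda)H^2\sqrt T)$. -/

import Mathlib

open MeasureTheory ProbabilityTheory
open scoped InnerProductSpace ENNReal

/-! ### Kernel mixture two-player zero-sum Markov games

Steps are numbered `0, …, H - 1` and episodes `0, …, T - 1` (instead of from `1`).  A triple
`z = (x, a, b)` consists of a state, the action of the first player (who maximizes) and the action
of the second player (who minimizes). -/

section Model

variable {S A 𝓗 : Type*} [NormedAddCommGroup 𝓗] [InnerProductSpace ℝ 𝓗]

/-- The integrated feature `φ_V(z) = ∑_{s'} V(s') φ(s' | z)`. -/
noncomputable def phiV (φ : S → S × A × A → 𝓗) (V : S → ℝ) (z : S × A × A) : 𝓗 :=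
  ∑' s, V s • φ s z

/-- The weighted kernel function
`k_{V₁,V₂}(z₁, z₂) = ∑_{s₁, s₂} V₁(s₁) V₂(s₂) ⟨φ(s₁ | z₁), φ(s₂ | z₂)⟩`. -/
noncomputable def weightedKernel (φ : S → S × A × A → 𝓗) (V₁ V₂ : S → ℝ)
    (z₁ z₂ : S × A × A) : ℝ :=
  ∑' s₁, ∑' s₂, V₁ s₁ * V₂ s₂ * ⟪φ s₁ z₁, φ s₂ z₂⟫_ℝ

/-- The effective dimension `Γ_K(T, λ)`: the supremum of `½ log det (I + K / λ)` over all
`V₁, …, V_T : S → [-H, H]` and all `z₁, …, z_T`, where `K` is the matrix with entries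
`k_{V_p, V_q}(z_p, z_q)`. -/
noncomputable def effDim (φ : S → S × A × A → 𝓗) (H T : ℕ) (lam : ℝ) : ℝ :=
  ⨆ p : (Fin T → {V : S → ℝ // ∀ s, V s ∈ Set.Icc (-(H : ℝ)) H}) × (Fin T → S × A × A),
    (1 / 2) * Real.log (Matrix.det
      (1 + lam⁻¹ • Matrix.of fun i j : Fin T =>
        weightedKernel φ (p.1 i).1 (p.1 j).1 (p.2 i) (p.2 j)))

/-- A kernel mixture two-player zero-sum Markov game with horizon `H`: rewards in `[-1, 1]`,
transition probabilities `P_h(s' | z) = ⟨φ(s' | z), θ_h⟩` for a feature map `φ` into a Hilbert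
space and parameters `θ_h`, where `φ_V(z)` is well defined and `‖φ_V(z)‖ ≤ 1` for all
`V : S → [-1, 1]`.  The Hilbert space is arbitrary; every reproducing kernel Hilbert space is an
instance. -/
structure KernelMixtureGame (S A 𝓗 : Type*) [NormedAddCommGroup 𝓗] [InnerProductSpace ℝ 𝓗]
    (H : ℕ) where
  reward : Fin H → S × A × A → ℝ
  reward_mem : ∀ h z, reward h z ∈ Set.Icc (-1 : ℝ) 1
  trans : Fin H → S × A × A → PMF S
  φ : S → S × A × A → 𝓗
  θ : Fin H → 𝓗
  trans_eq : ∀ h z s, (trans h z s).toReal = ⟪φ s z, θ h⟫_ℝ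
  summable_phiV : ∀ (V : S → ℝ) (z : S × A × A), (∀ s, V s ∈ Set.Icc (-1 : ℝ) 1) →
    Summable fun s => V s • φ s z
  norm_phiV_le : ∀ (V : S → ℝ) (z : S × A × A), (∀ s, V s ∈ Set.Icc (-1 : ℝ) 1) →
    ‖phiV φ V z‖ ≤ 1

end Model

/-! ### Policies, values, best responses -/

section Values

variable {S A 𝓗 : Type*} [NormedAddCommGroup 𝓗] [InnerProductSpace ℝ 𝓗] {H : ℕ}

/-- A (Markov, randomized) policy of one player. -/
abbrev Policy (S A : Type*) (H : ℕ) := Fin H → S → PMF A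

namespace KernelMixtureGame

/-- The law of the total reward collected from step `h` on when the state at step `h` is `x` and
the players independently follow `π` and `ν`. -/
noncomputable def returnLaw (G : KernelMixtureGame S A 𝓗 H) (π ν : Policy S A H)
    (h : ℕ) (x : S) : PMF ℝ :=
  if hh : h < H then
    (π ⟨h, hh⟩ x).bind fun a => (ν ⟨h, hh⟩ x).bind fun b =>
      (G.trans ⟨h, hh⟩ (x, a, b)).bind fun s =>
        (returnLaw G π ν (h + 1) s).map fun v => G.reward ⟨h, hh⟩ (x, a, b) + v
  else PMF.pure 0
termination_by H - h

/-- The value `V_h^{π,ν}(x)`: the expected total reward from step `h` on. -/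
noncomputable def value (G : KernelMixtureGame S A 𝓗 H) (π ν : Policy S A H)
    (h : ℕ) (x : S) : ℝ :=
  ∫ v, v ∂(G.returnLaw π ν h x).toMeasure

/-- `V_h^{*,ν}(x)`: the value when the first player best-responds to `ν`. -/
noncomputable def valueBestMax (G : KernelMixtureGame S A 𝓗 H) (ν : Policy S A H)
    (h : ℕ) (x : S) : ℝ :=
  ⨆ π : Policy S A H, G.value π ν h x

/-- `V_h^{π,*}(x)`: the value when the second player best-responds to `π`. -/
noncomputable def valueBestMin (G : KernelMixtureGame S A 𝓗 H) (π : Policy S A H)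
    (h : ℕ) (x : S) : ℝ :=
  ⨅ ν : Policy S A H, G.value π ν h x

end KernelMixtureGame

end Values

/-! ### Coarse correlated equilibria -/

section CCE

variable {S A : Type*} [Fintype A]

/-- The expectation of `Q(a, b)` for `(a, b) ∼ σ`. -/
noncomputable def jointExp (σ : PMF (A × A)) (Q : A × A → ℝ) : ℝ :=
  ∑ p : A × A, (σ p).toReal * Q p

/-- `σ` is a coarse correlated equilibrium of the payoff pair `(Q₁, Q₂)`. -/
def IsCCE (Q₁ Q₂ : A × A → ℝ) (σ : PMF (A × A)) : Prop :=
  (∀ a' : A, ∑ b : A, (σ.map Prod.snd b).toReal * Q₁ (a', b) ≤ jointExp σ Q₁) ∧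
  (∀ b' : A, jointExp σ Q₂ ≤ ∑ a : A, (σ.map Prod.fst a).toReal * Q₂ (a, b'))

/-- `findCCE` is a correct implementation of the subroutine `FIND_CCE(Q₁, Q₂, x)`. -/
def IsCCEFinder (findCCE : (S × A × A → ℝ) → (S × A × A → ℝ) → S → PMF (A × A)) : Prop :=
  ∀ Q₁ Q₂ x, IsCCE (fun p => Q₁ (x, p)) (fun p => Q₂ (x, p)) (findCCE Q₁ Q₂ x)

end CCE

/-! ### Kernel ridge regression -/

section Ridge

variable {𝓗 : Type*} [NormedAddCommGroup 𝓗] [InnerProductSpace ℝ 𝓗] {n : ℕ}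

/-- The regularized least squares objective with features `f` and targets `y`. -/
noncomputable def ridgeLoss (lam : ℝ) (f : Fin n → 𝓗) (y : Fin n → ℝ) (θ : 𝓗) : ℝ :=
  ∑ i, (y i - ⟪f i, θ⟫_ℝ) ^ 2 + lam * ‖θ‖ ^ 2

/-- For `λ > 0` the regularized least squares problem has exactly one minimizer. -/
theorem existsUnique_ridge {lam : ℝ} (hlam : 0 < lam) (f : Fin n → 𝓗) (y : Fin n → ℝ) :
    ∃! θ, ∀ θ', ridgeLoss lam f y θ ≤ ridgeLoss lam f y θ' := by
  let L : (Fin n → ℝ) →ₗ[ℝ] (Fin n → ℝ) :=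
    { toFun := fun c i => ⟪f i, ∑ j, c j • f j⟫_ℝ + lam * c i
      map_add' := by
        intro c d
        ext i
        simp only [Pi.add_apply, add_smul, Finset.sum_add_distrib, inner_add_right]
        ring
      map_smul' := by
        intro r c
        ext i
        simp only [Pi.smul_apply, smul_eq_mul, mul_smul, ← Finset.smul_sum, inner_smul_right,
          RingHom.id_apply]
        ring }
  have hinj : Function.Injective L := by
    rw [injective_iff_map_eq_zero]
    intro c hc
    have h1 : ∀ i, ⟪f i, ∑ j, c j • f j⟫_ℝ + lam * c i = 0 := fun i => congrFun hc i
    have h2 : ‖∑ j, c j • f j‖ ^ 2 + lam * ∑ i, c i ^ 2 = 0 := by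
      rw [← real_inner_self_eq_norm_sq, sum_inner, Finset.mul_sum, ← Finset.sum_add_distrib]
      refine Finset.sum_eq_zero fun i _ => ?_
      rw [real_inner_smul_left]
      linear_combination c i * h1 i
    have h3 : 0 ≤ ∑ i, c i ^ 2 := Finset.sum_nonneg fun i _ => sq_nonneg _
    have h4 : ∑ i, c i ^ 2 = 0 := by
      have h5 := sq_nonneg ‖∑ j, c j • f j‖
      nlinarith [mul_nonneg hlam.le h3]
    ext i
    have h6 := (Finset.sum_eq_zero_iff_of_nonneg (fun i _ => sq_nonneg (c i))).1 h4 i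
      (Finset.mem_univ i)
    simpa using h6
  obtain ⟨c, hc⟩ := LinearMap.injective_iff_surjective.1 hinj y
  have hc' : ∀ i, y i = ⟪f i, ∑ j, c j • f j⟫_ℝ + lam * c i := fun i => (congrFun hc i).symm
  have key : ∀ d, ridgeLoss lam f y ((∑ j, c j • f j) + d)
      = ridgeLoss lam f y (∑ j, c j • f j) + (∑ i, ⟪f i, d⟫_ℝ ^ 2 + lam * ‖d‖ ^ 2) := by
    intro d
    unfold ridgeLoss
    have e1 : ∀ i, (y i - ⟪f i, (∑ j, c j • f j) + d⟫_ℝ) ^ 2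
        = (y i - ⟪f i, ∑ j, c j • f j⟫_ℝ) ^ 2 + ⟪f i, d⟫_ℝ ^ 2
          - 2 * lam * (c i * ⟪f i, d⟫_ℝ) := by
      intro i
      rw [inner_add_right, hc' i]
      ring
    have e2 : ⟪∑ j, c j • f j, d⟫_ℝ = ∑ i, c i * ⟪f i, d⟫_ℝ := by
      rw [sum_inner]
      exact Finset.sum_congr rfl fun i _ => real_inner_smul_left _ _ _
    rw [norm_add_sq_real, e2, Finset.sum_congr rfl fun i _ => e1 i, Finset.sum_sub_distrib,
      Finset.sum_add_distrib, ← Finset.mul_sum]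
    ring
  have hnn : ∀ d : 𝓗, 0 ≤ ∑ i, ⟪f i, d⟫_ℝ ^ 2 := fun d =>
    Finset.sum_nonneg fun i _ => sq_nonneg _
  refine ⟨∑ j, c j • f j, fun θ' => ?_, fun θ hθ => ?_⟩
  · have h := key (θ' - ∑ j, c j • f j)
    rw [add_sub_cancel] at h
    have h1 := hnn (θ' - ∑ j, c j • f j)
    have h2 : 0 ≤ lam * ‖θ' - ∑ j, c j • f j‖ ^ 2 := by positivity
    linarith
  · have h := key (θ - ∑ j, c j • f j)
    rw [add_sub_cancel] at h
    have h1 := hnn (θ - ∑ j, c j • f j)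
    have h3 := hθ (∑ j, c j • f j)
    have h2 : 0 ≤ lam * ‖θ - ∑ j, c j • f j‖ ^ 2 := by positivity
    have h4 : lam * ‖θ - ∑ j, c j • f j‖ ^ 2 = 0 := by linarith
    have h5 : ‖θ - ∑ j, c j • f j‖ ^ 2 = 0 := (mul_eq_zero.1 h4).resolve_left hlam.ne'
    exact sub_eq_zero.1 (norm_eq_zero.1 (pow_eq_zero_iff two_ne_zero |>.1 h5))

/-- The minimizer of the regularized least squares objective. -/
noncomputable def ridgeEstimator (lam : ℝ) (f : Fin n → 𝓗) (y : Fin n → ℝ) : 𝓗 :=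
  Classical.epsilon fun θ => ∀ θ', ridgeLoss lam f y θ ≤ ridgeLoss lam f y θ'

/-- The confidence region of radius `β` around the ridge regression estimator. -/
def confRegion (lam β : ℝ) (f : Fin n → 𝓗) (y : Fin n → ℝ) : Set 𝓗 :=
  {θ | √(lam * ‖θ - ridgeEstimator lam f y‖ ^ 2
        + ∑ i, ⟪f i, θ - ridgeEstimator lam f y⟫_ℝ ^ 2) ≤ β}

end Ridge

/-! ### The algorithm KernelCCE-VTR -/

section Algorithm

/-- Observed data: `x t h` is the state at step `h ≤ H` of episode `t` (so `x t (h + 1)` is the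
state observed after step `h`), and `a t h`, `b t h` are the actions of the two players at step
`h < H`. -/
structure Data (S A : Type*) where
  x : ℕ → ℕ → S
  a : ℕ → ℕ → A
  b : ℕ → ℕ → A

/-- The triple `z_h^t`. -/
def Data.z {S A : Type*} (D : Data S A) (t h : ℕ) : S × A × A := (D.x t h, D.a t h, D.b t h)

/-- The known quantities that the algorithm works with: rewards, features, the CCE subroutine, the
regularization parameter and the bonus parameter. -/
structure AlgInput (S A 𝓗 : Type*) (H : ℕ) where
  reward : Fin H → S × A × A → ℝ
  φ : S → S × A × A → 𝓗
  findCCE : (S × A × A → ℝ) → (S × A × A → ℝ) → S → PMF (A × A)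
  lam : ℝ
  β : ℝ

/-- The projection of a real number onto `[-H, H]`. -/
noncomputable def clip (H : ℕ) (v : ℝ) : ℝ := max (-(H : ℝ)) (min (H : ℝ) v)

variable {S A 𝓗 : Type*} [NormedAddCommGroup 𝓗] [InnerProductSpace ℝ 𝓗] {H : ℕ}

namespace AlgInput

/-- The confidence region for `θ_h` used in episode `t`: ridge regression on the previous episodes
`τ < t`, with features `φ_{V^τ}(z_h^τ)` and targets `V^τ(x_{h+1}^τ)`, where `Vpast τ = V^τ`. -/
def region (I : AlgInput S A 𝓗 H) (D : Data S A) (t h : ℕ) (Vpast : Fin t → S → ℝ) : Set 𝓗 :=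
  confRegion I.lam I.β (fun τ : Fin t => phiV I.φ (Vpast τ) (D.z τ h))
    (fun τ : Fin t => Vpast τ (D.x τ (h + 1)))

/-- The optimistic action-value function at step `h` of episode `t`, from the upper value functions
of step `h + 1` in the previous episodes (`Vpast`) and in this episode (`Vnext`). -/
noncomputable def optimisticQ (I : AlgInput S A 𝓗 H) (D : Data S A) (t : ℕ) (h : Fin H)
    (Vpast : Fin t → S → ℝ) (Vnext : S → ℝ) (z : S × A × A) : ℝ :=
  clip H (I.reward h z + sSup ((fun θ => ⟪phiV I.φ Vnext z, θ⟫_ℝ) '' I.region D t h Vpast))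

/-- The pessimistic action-value function, from the lower value functions of step `h + 1`. -/
noncomputable def pessimisticQ (I : AlgInput S A 𝓗 H) (D : Data S A) (t : ℕ) (h : Fin H)
    (Vpast : Fin t → S → ℝ) (Vnext : S → ℝ) (z : S × A × A) : ℝ :=
  clip H (I.reward h z + sInf ((fun θ => ⟪phiV I.φ Vnext z, θ⟫_ℝ) '' I.region D t h Vpast))

variable [Fintype A]

/-- The pair of upper and lower value functions at step `h` of episode `t`; both are `0` at `H`.
They depend on the data of the episodes before `t` only. -/
noncomputable def values (I : AlgInput S A 𝓗 H) (D : Data S A) (t h : ℕ) :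
    (S → ℝ) × (S → ℝ) :=
  if hh : h < H then
    let Qu := I.optimisticQ D t ⟨h, hh⟩ (fun τ : Fin t => (I.values D τ (h + 1)).1)
      (I.values D t (h + 1)).1
    let Ql := I.pessimisticQ D t ⟨h, hh⟩ (fun τ : Fin t => (I.values D τ (h + 1)).2)
      (I.values D t (h + 1)).2
    (fun s => jointExp (I.findCCE Qu Ql s) fun p => Qu (s, p),
      fun s => jointExp (I.findCCE Qu Ql s) fun p => Ql (s, p))
  else (0, 0)
termination_by (t, H - h)
decreasing_by
  all_goals first
    | exact Prod.Lex.left _ _ τ.2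
    | exact Prod.Lex.right _ (by omega)

/-- The optimistic estimate of the action-value function at step `h` of episode `t`. -/
noncomputable def upperQ (I : AlgInput S A 𝓗 H) (D : Data S A) (t : ℕ) (h : Fin H) :
    S × A × A → ℝ :=
  I.optimisticQ D t h (fun τ : Fin t => (I.values D τ (h + 1)).1) (I.values D t (h + 1)).1

/-- The pessimistic estimate of the action-value function at step `h` of episode `t`. -/
noncomputable def lowerQ (I : AlgInput S A 𝓗 H) (D : Data S A) (t : ℕ) (h : Fin H) :
    S × A × A → ℝ :=
  I.pessimisticQ D t h (fun τ : Fin t => (I.values D τ (h + 1)).2) (I.values D t (h + 1)).2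

/-- The joint action distribution `σ_h^t(x)` used by the algorithm. -/
noncomputable def cce (I : AlgInput S A 𝓗 H) (D : Data S A) (t : ℕ) (h : Fin H) (x : S) :
    PMF (A × A) :=
  I.findCCE (I.upperQ D t h) (I.lowerQ D t h) x

/-- The policy `π^t` of the first player: the first marginal of `σ^t`. -/
noncomputable def policyMax (I : AlgInput S A 𝓗 H) (D : Data S A) (t : ℕ) : Policy S A H :=
  fun h x => (I.cce D t h x).map Prod.fst

/-- The policy `ν^t` of the second player: the second marginal of `σ^t`. -/
noncomputable def policyMin (I : AlgInput S A 𝓗 H) (D : Data S A) (t : ℕ) : Policy S A H :=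
  fun h x => (I.cce D t h x).map Prod.snd

end AlgInput

/-- KernelCCE-VTR run on the game `G`. -/
def KernelMixtureGame.algInput (G : KernelMixtureGame S A 𝓗 H)
    (findCCE : (S × A × A → ℝ) → (S × A × A → ℝ) → S → PMF (A × A)) (lam β : ℝ) :
    AlgInput S A 𝓗 H where
  reward := G.reward
  φ := G.φ
  findCCE := findCCE
  lam := lam
  β := β

variable [Fintype A]

/-- The regret `∑_t (V_1^{*,ν^t}(x_1^t) - V_1^{π^t,*}(x_1^t))` over `T` episodes. -/
noncomputable def regret (G : KernelMixtureGame S A 𝓗 H) (I : AlgInput S A 𝓗 H) (D : Data S A)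
    (T : ℕ) : ℝ :=
  ∑ t ∈ Finset.range T,
    (G.valueBestMax (I.policyMin D t) 0 (D.x t 0) - G.valueBestMin (I.policyMax D t) 0 (D.x t 0))

end Algorithm

/-! ### The interaction of the algorithm with the game -/

section Interaction

variable {S A 𝓗 Ω : Type*} [MeasurableSpace S] [MeasurableSpace A]

/-- The information available just before the actions at step `h` of episode `t` are drawn: all
states and actions of the earlier episodes and of the earlier steps, and the current state. -/
@[reducible] def historyBefore (H : ℕ) (D : Ω → Data S A) (t h : ℕ) : MeasurableSpace Ω :=
  (⨆ (τ : ℕ) (k : ℕ) (_ : (τ < t ∧ k ≤ H) ∨ (τ = t ∧ k ≤ h)),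
      MeasurableSpace.comap (fun ω => (D ω).x τ k) inferInstance) ⊔
  (⨆ (τ : ℕ) (k : ℕ) (_ : (τ < t ∧ k < H) ∨ (τ = t ∧ k < h)),
      MeasurableSpace.comap (fun ω => ((D ω).a τ k, (D ω).b τ k)) inferInstance)

/-- The same information together with the actions at step `h` of episode `t`. -/
@[reducible] def historyAfter (H : ℕ) (D : Ω → Data S A) (t h : ℕ) : MeasurableSpace Ω :=
  historyBefore H D t h ⊔
    MeasurableSpace.comap (fun ω => ((D ω).a t h, (D ω).b t h)) inferInstance

variable [Fintype A] [NormedAddCommGroup 𝓗] [InnerProductSpace ℝ 𝓗] {H : ℕ}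
  [MeasurableSpace Ω]

/-- The random data `D` are generated by playing `T` episodes of the game `G` with the algorithm:
given the past and the current state, the pair of actions is drawn from `σ_h^t(x_h^t)`; given also
the actions, the next state is drawn from `P_h(· | z_h^t)`.  Nothing is assumed about how the
initial states `x_1^t` are chosen; they may depend on the past. -/
structure IsRun (G : KernelMixtureGame S A 𝓗 H) (I : AlgInput S A 𝓗 H) (T : ℕ)
    (μ : Measure Ω) (D : Ω → Data S A) : Prop where
  measurable_x : ∀ t h, Measurable fun ω => (D ω).x t h
  measurable_a : ∀ t h, Measurable fun ω => (D ω).a t h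
  measurable_b : ∀ t h, Measurable fun ω => (D ω).b t h
  action_law : ∀ t < T, ∀ (h : Fin H) (i j : A),
    μ[Set.indicator {ω | (D ω).a t h = i ∧ (D ω).b t h = j} (fun _ => (1 : ℝ)) |
        historyBefore H D t h]
      =ᵐ[μ] fun ω => (I.cce (D ω) t h ((D ω).x t h) (i, j)).toReal
  trans_law : ∀ t < T, ∀ (h : Fin H) (s : S),
    μ[Set.indicator {ω | (D ω).x t (h + 1) = s} (fun _ => (1 : ℝ)) | historyAfter H D t h]
      =ᵐ[μ] fun ω => (G.trans h ((D ω).z t h) s).toReal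

end Interaction

/-!
Write `Λ = λ + ∑ f ⊗ f` for the regularized Gram operator of the regression features `f` and
`w = ⟨f, Λ⁻¹ f⟩` for the squared width of a new feature. The determinant of the regularized kernel
matrix is the product of the factors `1 + w` (`det_one_add_gram`), so that the effective dimension
`Γ` controls both the confidence radius and, by the elliptical potential argument
(`sum_min_one_sqrt_width_le`), the total width of the confidence regions.

The confidence regions contain the true parameters by the method of mixtures. The noise of a
regression takes values in an interval of length `2 H`, so after division by `H` it is
`1`-subgaussian, and the self-normalized exponential process `mixProcess` is a supermartingale; only
a one-dimensional Gaussian integral enters (`lintegral_exp_quadratic_le`). Starting the noise sum at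
a multiple of `-θ` instead of at `0` incorporates the regularization bias into the process and
yields `‖θ - θ̂‖²_Λ ≤ H² (2 Γ + 2 log c) + λ B²`, without cross terms, while the process is at
most `c`. By Ville's inequality (`measure_exists_ge_le`) the level `c = 4 H / δ` is not reached by
any of the `2 H` regressions, simultaneously for all episodes, with probability `1 - δ / 2`.

On this event the upper values dominate the values of all responses to `ν^t`, the lower values are
dominated by those of all responses to `π^t`, and truncation never works in the wrong direction.
Hence the regret is at most the sum of the gaps of the two value functions along the trajectories,
which is a martingale plus the total width of the regions (`regret_le`); the martingale is bounded
by the Azuma-Hoeffding method (`measure_sumNoise_gt_le`).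

It remains to absorb the martingale term into `β H √(T Γ)`. Since a transition law has mass `1`, the
feature of the constant function `H` has norm at least `H / B`, whence
`2 Γ ≥ log (1 + T H² / (λ B²))`. If the fraction is at least `1`, then `Γ` is bounded below and the
choice of `β` suffices; otherwise `β² ≥ 2 λ B²` makes the right-hand side larger than the trivial
bound `2 H T` on the regret (`measure_regret_le_universal`).

Conditional expectations enter only through `lintegral_eq_lintegral_condLaw`: all data are discrete,
so that a function of finitely many of them is measurable for the `σ`-algebra they generate
(`measurable_comp_data`).
-/

/-! ### Regularized Gram operators, their inverses and determinants -/

section Operator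

variable {𝓗 : Type*} [NormedAddCommGroup 𝓗] [InnerProductSpace ℝ 𝓗]

/-- The regularized Gram operator `Λ_n = λ + ∑_{i < n} f_i ⊗ f_i`. -/
noncomputable def regOp (lam : ℝ) (f : ℕ → 𝓗) (n : ℕ) (v : 𝓗) : 𝓗 :=
  lam • v + ∑ i ∈ Finset.range n, ⟪f i, v⟫_ℝ • f i

/-- The inverse of `regOp lam f n`, built by the Sherman-Morrison rank-one updates. -/
noncomputable def regInv (lam : ℝ) (f : ℕ → 𝓗) : ℕ → 𝓗 →ₗ[ℝ] 𝓗
  | 0 => lam⁻¹ • LinearMap.id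
  | n + 1 => regInv lam f n - (1 + ⟪f n, regInv lam f n (f n)⟫_ℝ)⁻¹ •
      ((innerₛₗ ℝ (f n)).comp (regInv lam f n)).smulRight (regInv lam f n (f n))

/-- The squared width `w_n = ⟨f_n, Λ_n⁻¹ f_n⟩` of the `n`-th feature given the earlier ones. -/
noncomputable def width (lam : ℝ) (f : ℕ → 𝓗) (n : ℕ) : ℝ := ⟪f n, regInv lam f n (f n)⟫_ℝ

variable {lam : ℝ} {f : ℕ → 𝓗} {n : ℕ}

theorem regInv_zero_apply (v : 𝓗) : regInv lam f 0 v = lam⁻¹ • v := rfl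

theorem regInv_succ_apply (v : 𝓗) : regInv lam f (n + 1) v = regInv lam f n v -
    ((1 + width lam f n)⁻¹ * ⟪f n, regInv lam f n v⟫_ℝ) • regInv lam f n (f n) := by
  simp [regInv, width, mul_smul]

theorem inner_regInv_left (u v : 𝓗) :
    ⟪regInv lam f n u, v⟫_ℝ = ⟪u, regInv lam f n v⟫_ℝ := by
  induction n generalizing u v with
  | zero => simp [regInv_zero_apply, inner_smul_left, inner_smul_right]
  | succ n ih =>
    rw [regInv_succ_apply, regInv_succ_apply, inner_sub_left, inner_sub_right,
      real_inner_smul_left, real_inner_smul_right, ih u v, ih (f n) v, ← ih u (f n),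
      ← ih (f n) u, real_inner_comm (f n) (regInv lam f n u),
      ← ih (f n) v, ← ih (f n) u]
    ring

theorem inner_regOp_self (v : 𝓗) : ⟪v, regOp lam f n v⟫_ℝ =
    lam * ‖v‖ ^ 2 + ∑ i ∈ Finset.range n, ⟪f i, v⟫_ℝ ^ 2 := by
  rw [regOp, inner_add_right, inner_sum, real_inner_smul_right, real_inner_self_eq_norm_sq]
  congr 1
  refine Finset.sum_congr rfl fun i _ => ?_
  rw [real_inner_smul_right, real_inner_comm]
  ring

theorem inner_regOp_left (u v : 𝓗) :
    ⟪regOp lam f n u, v⟫_ℝ = ⟪u, regOp lam f n v⟫_ℝ := by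
  simp only [regOp, inner_add_left, inner_add_right, sum_inner, inner_sum, real_inner_smul_left,
    real_inner_smul_right]
  congr 1
  refine Finset.sum_congr rfl fun i _ => ?_
  rw [real_inner_comm u (f i)]
  ring

theorem regOp_sub_smul (u v : 𝓗) (c : ℝ) :
    regOp lam f n (u - c • v) = regOp lam f n u - c • regOp lam f n v := by
  simp only [regOp, inner_sub_right, real_inner_smul_right, sub_smul, Finset.sum_sub_distrib,
    smul_sub, smul_add, Finset.smul_sum, mul_smul]
  rw [smul_comm lam c v]
  abel

theorem regOp_regInv (hlam : 0 < lam) (v : 𝓗) : regOp lam f n (regInv lam f n v) = v := by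
  induction n generalizing v with
  | zero => simp [regOp, regInv_zero_apply, hlam.ne']
  | succ n ih =>
    have hw : 0 ≤ width lam f n := by
      have h := inner_regOp_self (lam := lam) (f := f) (n := n) (regInv lam f n (f n))
      rw [ih, real_inner_comm] at h
      rw [width, h]
      have : 0 ≤ ∑ i ∈ Finset.range n, ⟪f i, regInv lam f n (f n)⟫_ℝ ^ 2 :=
        Finset.sum_nonneg fun _ _ => sq_nonneg _
      positivity
    have hs : ∀ u, regOp lam f (n + 1) u = regOp lam f n u + ⟪f n, u⟫_ℝ • f n := fun u => by
      rw [regOp, Finset.sum_range_succ, ← add_assoc, regOp]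
    rw [hs, regInv_succ_apply, regOp_sub_smul, ih, ih, inner_sub_right, real_inner_smul_right,
      ← width, sub_add, ← sub_smul, sub_eq_self]
    convert zero_smul ℝ (f n)
    have : (1 : ℝ) + width lam f n ≠ 0 := by positivity
    field_simp
    ring

theorem regInv_regOp (hlam : 0 < lam) (v : 𝓗) : regInv lam f n (regOp lam f n v) = v := by
  refine ext_inner_left ℝ fun u => ?_
  rw [← inner_regInv_left, ← inner_regOp_left, regOp_regInv hlam]

theorem inner_regInv_self (hlam : 0 < lam) (v : 𝓗) : ⟪v, regInv lam f n v⟫_ℝ =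
    lam * ‖regInv lam f n v‖ ^ 2 + ∑ i ∈ Finset.range n, ⟪f i, regInv lam f n v⟫_ℝ ^ 2 := by
  rw [← inner_regOp_self, regOp_regInv hlam, real_inner_comm]

theorem inner_regInv_self_nonneg (hlam : 0 < lam) (v : 𝓗) : 0 ≤ ⟪v, regInv lam f n v⟫_ℝ := by
  rw [inner_regInv_self hlam]
  have : 0 ≤ ∑ i ∈ Finset.range n, ⟪f i, regInv lam f n v⟫_ℝ ^ 2 :=
    Finset.sum_nonneg fun _ _ => sq_nonneg _
  positivity

theorem width_nonneg (hlam : 0 < lam) : 0 ≤ width lam f n := inner_regInv_self_nonneg hlam _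

theorem inner_regInv_self_le (hlam : 0 < lam) (v : 𝓗) :
    ⟪v, regInv lam f n v⟫_ℝ ≤ lam⁻¹ * ‖v‖ ^ 2 := by
  induction n with
  | zero => rw [regInv_zero_apply, real_inner_smul_right, real_inner_self_eq_norm_sq]
  | succ n ih =>
    refine le_trans ?_ ih
    rw [regInv_succ_apply, inner_sub_right, real_inner_smul_right,
      ← inner_regInv_left (f n) v, real_inner_comm (regInv lam f n (f n)) v]
    have h1 := width_nonneg (f := f) (n := n) hlam
    have h2 : 0 ≤ (1 + width lam f n)⁻¹ * ⟪regInv lam f n (f n), v⟫_ℝ *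
        ⟪regInv lam f n (f n), v⟫_ℝ := by
      rw [mul_assoc]
      exact mul_nonneg (by positivity) (mul_self_nonneg _)
    linarith

/-- The Cauchy-Schwarz inequality for the dual pair of norms given by `Λ_n` and `Λ_n⁻¹`. -/
theorem inner_sq_le_mul (hlam : 0 < lam) (g v : 𝓗) :
    ⟪g, v⟫_ℝ ^ 2 ≤
      ⟪g, regInv lam f n g⟫_ℝ * (lam * ‖v‖ ^ 2 + ∑ i ∈ Finset.range n, ⟪f i, v⟫_ℝ ^ 2) := by
  have hquad : ∀ s : ℝ, 0 ≤ ⟪g, regInv lam f n g⟫_ℝ * (s * s) + (-2 * ⟪g, v⟫_ℝ) * s +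
      (lam * ‖v‖ ^ 2 + ∑ i ∈ Finset.range n, ⟪f i, v⟫_ℝ ^ 2) := by
    intro s
    have h := inner_regOp_self (lam := lam) (f := f) (n := n) (v - s • regInv lam f n g)
    have h0 : 0 ≤ lam * ‖v - s • regInv lam f n g‖ ^ 2 +
        ∑ i ∈ Finset.range n, ⟪f i, v - s • regInv lam f n g⟫_ℝ ^ 2 := by
      have : 0 ≤ ∑ i ∈ Finset.range n, ⟪f i, v - s • regInv lam f n g⟫_ℝ ^ 2 :=
        Finset.sum_nonneg fun _ _ => sq_nonneg _
      positivity
    rw [← h, regOp_sub_smul, regOp_regInv hlam, inner_sub_left, inner_sub_right, inner_sub_right,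
      inner_regOp_self, real_inner_smul_right, real_inner_smul_left, real_inner_smul_left,
      real_inner_smul_right, ← inner_regOp_left, regOp_regInv hlam, real_inner_comm g v,
      real_inner_comm g (regInv lam f n g)] at h0
    linarith
  have := discrim_le_zero hquad
  rw [discrim] at this
  nlinarith

/-- The determinant of the regularized Gram matrix is the product of the factors `1 + w_i`. -/
theorem det_one_add_gram (hlam : 0 < lam) (n : ℕ) :
    Matrix.det (1 + lam⁻¹ • Matrix.of fun i j : Fin n => ⟪f i, f j⟫_ℝ) =
      ∏ i ∈ Finset.range n, (1 + width lam f i) := by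
  induction n with
  | zero => simp
  | succ n ih =>
    set M : Matrix (Fin (n + 1)) (Fin (n + 1)) ℝ :=
      1 + lam⁻¹ • Matrix.of fun i j : Fin (n + 1) => ⟪f i, f j⟫_ℝ with hM
    -- Adding multiples of the other columns clears the last column above the diagonal; the
    -- multipliers are read off from `Λ_n (Λ_n⁻¹ f_n) = f_n`.
    let c : Fin (n + 1) → ℝ := Fin.snoc (fun i : Fin n => -⟪f i, regInv lam f n (f n)⟫_ℝ) 1
    have hres : lam⁻¹ • (f n - ∑ j ∈ Finset.range n, ⟪f j, regInv lam f n (f n)⟫_ℝ • f j) =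
        regInv lam f n (f n) := by
      have h := regOp_regInv (f := f) (n := n) hlam (f n)
      rw [regOp] at h
      rw [← eq_sub_iff_add_eq] at h
      rw [← h, smul_smul, inv_mul_cancel₀ hlam.ne', one_smul]
    have hcol : (fun k => ∑ i, c i • M k i) =
        Fin.snoc (α := fun _ => ℝ) (fun _ : Fin n => (0 : ℝ)) (1 + width lam f n) := by
      have hinner : ∀ k : Fin (n + 1), ∑ i : Fin n, c i.castSucc * (lam⁻¹ * ⟪f k, f i⟫_ℝ) +
          lam⁻¹ * ⟪f k, f n⟫_ℝ = ⟪f k, regInv lam f n (f n)⟫_ℝ := by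
        intro k
        conv_rhs => rw [← hres]
        rw [real_inner_smul_right, inner_sub_right, inner_sum,
          ← Fin.sum_univ_eq_sum_range (fun j => ⟪f k, ⟪f j, regInv lam f n (f n)⟫_ℝ • f j⟫_ℝ),
          mul_sub, Finset.mul_sum, sub_eq_neg_add, ← Finset.sum_neg_distrib]
        congr 1
        refine Finset.sum_congr rfl fun i _ => ?_
        simp only [c, Fin.snoc_castSucc, real_inner_smul_right]
        ring
      funext k
      rw [Fin.sum_univ_castSucc]
      refine Fin.lastCases ?_ (fun k => ?_) k
      · have h := hinner (Fin.last n)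
        simp only [Fin.val_last] at h
        have e : ∀ i : Fin n, c i.castSucc • M (Fin.last n) i.castSucc =
            c i.castSucc * (lam⁻¹ * ⟪f n, f i⟫_ℝ) := fun i => by
          simp [hM, (Fin.castSucc_lt_last i).ne']
        have e2 : c (Fin.last n) • M (Fin.last n) (Fin.last n) = 1 + lam⁻¹ * ⟪f n, f n⟫_ℝ := by
          simp [hM, c]
        rw [Finset.sum_congr rfl fun i _ => e i, e2, Fin.snoc_last, width, ← h]
        ring
      · have h := hinner k.castSucc
        simp only [Fin.val_castSucc] at h
        have e : ∀ i : Fin n, c i.castSucc • M k.castSucc i.castSucc =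
            c i.castSucc * (if i = k then 1 else 0) +
              c i.castSucc * (lam⁻¹ * ⟪f k, f i⟫_ℝ) := fun i => by
          simp [hM, Matrix.one_apply, mul_add, eq_comm]
        have e2 : c (Fin.last n) • M k.castSucc (Fin.last n) = lam⁻¹ * ⟪f k, f n⟫_ℝ := by
          simp [hM, c, (Fin.castSucc_lt_last k).ne]
        rw [Finset.sum_congr rfl fun i _ => e i, e2, Finset.sum_add_distrib, add_assoc, h,
          Fin.snoc_castSucc]
        simp [c]
    have hdet := Matrix.det_updateCol_sum M (Fin.last n) c
    rw [hcol, show c (Fin.last n) = 1 by simp [c], one_smul] at hdet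
    rw [← hdet, Matrix.det_succ_column _ (Fin.last n), Fin.sum_univ_castSucc,
      Finset.sum_eq_zero, zero_add, Finset.prod_range_succ, ← ih]
    · have hsub : (M.updateCol (Fin.last n)
          (Fin.snoc (α := fun _ => ℝ) (fun _ : Fin n => (0 : ℝ)) (1 + width lam f n))).submatrix
            (Fin.last n).succAbove (Fin.last n).succAbove =
          1 + lam⁻¹ • Matrix.of fun i j : Fin n => ⟪f i, f j⟫_ℝ := by
        ext i j
        simp [hM, Matrix.one_apply, (Fin.castSucc_lt_last j).ne]
      rw [hsub, Matrix.updateCol_self, Fin.snoc_last, Fin.val_last, ← two_mul, pow_mul]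
      simp
      ring
    · intro i _
      simp

theorem log_det_one_add_gram (hlam : 0 < lam) (n : ℕ) :
    Real.log (Matrix.det (1 + lam⁻¹ • Matrix.of fun i j : Fin n => ⟪f i, f j⟫_ℝ)) =
      ∑ i ∈ Finset.range n, Real.log (1 + width lam f i) := by
  rw [det_one_add_gram hlam, Real.log_prod]
  intro i _
  have := width_nonneg (f := f) (n := i) hlam
  positivity

/-- The elliptical potential lemma, in the form obtained from the Cauchy-Schwarz inequality. -/
theorem sum_min_one_sqrt_width_le (hlam : 0 < lam) (n : ℕ) :
    ∑ i ∈ Finset.range n, min 1 √(width lam f i) ≤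
      √(n * (2 * ∑ i ∈ Finset.range n, Real.log (1 + width lam f i))) := by
  refine Real.le_sqrt_of_sq_le ?_
  have h1 := sq_sum_le_card_mul_sum_sq (s := Finset.range n)
    (f := fun i => min (1 : ℝ) √(width lam f i))
  rw [Finset.card_range] at h1
  refine h1.trans ?_
  refine mul_le_mul_of_nonneg_left ?_ (n.cast_nonneg : (0 : ℝ) ≤ n)
  rw [Finset.mul_sum]
  refine Finset.sum_le_sum fun i _ => ?_
  have hw := width_nonneg (f := f) (n := i) hlam
  have hlog := Real.one_sub_inv_le_log_of_pos (show 0 < 1 + width lam f i by positivity)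
  rcases le_total (width lam f i) 1 with h | h
  · rw [min_eq_right (Real.sqrt_le_one.2 h), Real.sq_sqrt hw]
    have : (1 + width lam f i) * (1 + width lam f i)⁻¹ = 1 := mul_inv_cancel₀ (by positivity)
    nlinarith [inv_nonneg.2 (show 0 ≤ 1 + width lam f i by positivity)]
  · rw [min_eq_left (Real.one_le_sqrt.2 h)]
    have : (1 + width lam f i)⁻¹ ≤ 2⁻¹ := inv_anti₀ (by norm_num) (by linarith)
    norm_num at this ⊢
    linarith

/-- The ridge regression estimator solves the normal equations. -/
theorem ridgeEstimator_eq (hlam : 0 < lam) (y : ℕ → ℝ) :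
    ridgeEstimator lam (fun i : Fin n => f i) (fun i : Fin n => y i) =
      regInv lam f n (∑ i ∈ Finset.range n, y i • f i) := by
  set θ := regInv lam f n (∑ i ∈ Finset.range n, y i • f i) with hθ
  have hnormal : regOp lam f n θ = ∑ i ∈ Finset.range n, y i • f i := regOp_regInv hlam _
  have key : ∀ d, ridgeLoss lam (fun i : Fin n => f i) (fun i : Fin n => y i) θ ≤
      ridgeLoss lam (fun i : Fin n => f i) (fun i : Fin n => y i) (θ + d) := by
    intro d
    have h1 : lam * ⟪θ, d⟫_ℝ = ∑ i ∈ Finset.range n, (y i - ⟪f i, θ⟫_ℝ) * ⟪f i, d⟫_ℝ := by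
      have := congrArg (fun v => ⟪v, d⟫_ℝ) hnormal
      simp only [regOp, inner_add_left, sum_inner, real_inner_smul_left] at this
      simp only [sub_mul, Finset.sum_sub_distrib]
      linarith
    unfold ridgeLoss
    rw [Fin.sum_univ_eq_sum_range (fun i => (y i - ⟪f i, θ⟫_ℝ) ^ 2),
      Fin.sum_univ_eq_sum_range (fun i => (y i - ⟪f i, θ + d⟫_ℝ) ^ 2), norm_add_sq_real]
    have h2 : ∑ i ∈ Finset.range n, (y i - ⟪f i, θ + d⟫_ℝ) ^ 2 =
        ∑ i ∈ Finset.range n, (y i - ⟪f i, θ⟫_ℝ) ^ 2 - 2 * (lam * ⟪θ, d⟫_ℝ) +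
          ∑ i ∈ Finset.range n, ⟪f i, d⟫_ℝ ^ 2 := by
      rw [h1, Finset.mul_sum, ← Finset.sum_sub_distrib, ← Finset.sum_add_distrib]
      refine Finset.sum_congr rfl fun i _ => ?_
      rw [inner_add_right]
      ring
    have h3 : 0 ≤ ∑ i ∈ Finset.range n, ⟪f i, d⟫_ℝ ^ 2 := Finset.sum_nonneg fun _ _ => sq_nonneg _
    have h4 : 0 ≤ lam * ‖d‖ ^ 2 := by positivity
    rw [h2]
    linarith
  have hex := existsUnique_ridge hlam (fun i : Fin n => f i) (fun i : Fin n => y i)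
  refine hex.unique (Classical.epsilon_spec hex.exists) fun θ' => ?_
  have := key (θ' - θ)
  rwa [add_sub_cancel] at this

end Operator

/-! ### Exponential moments of bounded centred variables -/

section Moments

variable {ι : Type*} [MeasurableSpace ι]

/-- Hoeffding's lemma as a bound on a Lebesgue integral. -/
theorem lintegral_exp_mul_le_of_mem_Icc (p : Measure ι) [IsProbabilityMeasure p] {X : ι → ℝ}
    (hX : Measurable X) {a b : ℝ} (hab : ∀ i, X i ∈ Set.Icc a b) (hmean : ∫ i, X i ∂p = 0)
    (s : ℝ) :
    ∫⁻ i, ENNReal.ofReal (Real.exp (s * X i)) ∂p ≤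
      ENNReal.ofReal (Real.exp (((b - a) / 2) ^ 2 * s ^ 2 / 2)) := by
  have hsub := hasSubgaussianMGF_of_mem_Icc_of_integral_eq_zero (μ := p) hX.aemeasurable
    (Filter.Eventually.of_forall hab) hmean
  rw [← ofReal_integral_eq_lintegral_ofReal (hsub.integrable_exp_mul s)
    (Filter.Eventually.of_forall fun i => (Real.exp_pos _).le)]
  refine ENNReal.ofReal_le_ofReal ?_
  have h := hsub.mgf_le s
  rw [mgf] at h
  refine h.trans (le_of_eq ?_)
  congr 3
  simp [Real.norm_eq_abs, div_pow]

/-- Averaging the exponential martingale increments `exp (η x - η² / 2)` over a Gaussian `η` of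
mean `m` and variance `w` gives the exponential of a quadratic function of `x`. -/
theorem lintegral_gaussianPDF_mul_exp {m w : ℝ} (hw : 0 < w) (x : ℝ) :
    ∫⁻ η, gaussianPDF m w.toNNReal η * ENNReal.ofReal (Real.exp (η * x - η ^ 2 / 2)) =
      ENNReal.ofReal ((√(1 + w))⁻¹ *
        Real.exp ((2 * m * x + w * x ^ 2 - m ^ 2) / (2 * (1 + w)))) := by
  set w' : ℝ := w / (1 + w) with hw'
  have hw'0 : 0 < w' := by positivity
  set K := (√(1 + w))⁻¹ * Real.exp ((2 * m * x + w * x ^ 2 - m ^ 2) / (2 * (1 + w))) with hK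
  have key : ∀ η, gaussianPDF m w.toNNReal η * ENNReal.ofReal (Real.exp (η * x - η ^ 2 / 2)) =
      ENNReal.ofReal K * gaussianPDF ((m + w * x) / (1 + w)) w'.toNNReal η := by
    intro η
    rw [gaussianPDF, gaussianPDF, ← ENNReal.ofReal_mul (gaussianPDFReal_nonneg _ _ _),
      ← ENNReal.ofReal_mul (by positivity), gaussianPDFReal, gaussianPDFReal,
      Real.coe_toNNReal _ hw.le, Real.coe_toNNReal _ hw'0.le, hK]
    congr 1
    have e1 : √(2 * Real.pi * w) = √(1 + w) * √(2 * Real.pi * w') := by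
      rw [← Real.sqrt_mul (by positivity), hw']
      congr 1
      field_simp
    have e2 : Real.exp (-(η - m) ^ 2 / (2 * w)) * Real.exp (η * x - η ^ 2 / 2) =
        Real.exp ((2 * m * x + w * x ^ 2 - m ^ 2) / (2 * (1 + w))) *
          Real.exp (-(η - (m + w * x) / (1 + w)) ^ 2 / (2 * w')) := by
      rw [← Real.exp_add, ← Real.exp_add]
      congr 1
      rw [hw']
      field_simp
      ring
    rw [e1, mul_inv, mul_assoc, e2]
    ring
  simp_rw [key]
  rw [lintegral_const_mul _ (measurable_gaussianPDF _ _),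
    lintegral_gaussianPDF_eq_one _ (by simpa using hw'0), mul_one]

/-- The one-step bound of the method of mixtures: a `1`-subgaussian variable multiplies the
self-normalized exponential process by a factor of mean at most `1`. -/
theorem lintegral_exp_quadratic_le (p : Measure ι) [IsProbabilityMeasure p] {X : ι → ℝ}
    (hX : Measurable X)
    (hsub : ∀ s : ℝ, ∫⁻ i, ENNReal.ofReal (Real.exp (s * X i)) ∂p ≤
      ENNReal.ofReal (Real.exp (s ^ 2 / 2))) {w : ℝ} (hw : 0 ≤ w) (m : ℝ) :
    ∫⁻ i, ENNReal.ofReal ((√(1 + w))⁻¹ *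
      Real.exp ((2 * m * X i + w * X i ^ 2 - m ^ 2) / (2 * (1 + w)))) ∂p ≤ 1 := by
  have hone : ∀ η : ℝ, ∫⁻ i, ENNReal.ofReal (Real.exp (η * X i - η ^ 2 / 2)) ∂p ≤ 1 := by
    intro η
    calc ∫⁻ i, ENNReal.ofReal (Real.exp (η * X i - η ^ 2 / 2)) ∂p
        = ∫⁻ i, ENNReal.ofReal (Real.exp (-(η ^ 2 / 2))) *
            ENNReal.ofReal (Real.exp (η * X i)) ∂p := by
          refine lintegral_congr fun i => ?_
          rw [← ENNReal.ofReal_mul (Real.exp_pos _).le, ← Real.exp_add]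
          congr 2
          ring
      _ ≤ ENNReal.ofReal (Real.exp (-(η ^ 2 / 2))) * ENNReal.ofReal (Real.exp (η ^ 2 / 2)) := by
          rw [lintegral_const_mul _ (by fun_prop)]
          gcongr
          exact hsub η
      _ = 1 := by
          rw [← ENNReal.ofReal_mul (Real.exp_pos _).le, ← Real.exp_add]
          simp
  rcases hw.eq_or_lt with rfl | hw
  · refine le_of_eq_of_le (lintegral_congr fun i => ?_) (hone m)
    congr 1
    simp only [add_zero, Real.sqrt_one, inv_one, one_mul, zero_mul, mul_one]
    congr 1
    ring
  · simp_rw [← lintegral_gaussianPDF_mul_exp hw]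
    rw [lintegral_lintegral_swap]
    · calc ∫⁻ η, ∫⁻ i, gaussianPDF m w.toNNReal η *
            ENNReal.ofReal (Real.exp (η * X i - η ^ 2 / 2)) ∂p
          ≤ ∫⁻ η, gaussianPDF m w.toNNReal η := by
            refine lintegral_mono fun η => ?_
            rw [lintegral_const_mul _ (by fun_prop)]
            exact mul_le_of_le_one_right zero_le (hone η)
        _ = 1 := lintegral_gaussianPDF_eq_one _ (by simpa using hw)
    · refine Measurable.aemeasurable ?_
      refine Measurable.mul ((measurable_gaussianPDF _ _).comp measurable_snd) ?_
      fun_prop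

end Moments

/-! ### The self-normalized exponential process -/

section Mixture

variable {𝓗 : Type*} [NormedAddCommGroup 𝓗] [InnerProductSpace ℝ 𝓗]

/-- The noise sum `S_n = u + ∑_{i < n} ε_i f_i` started at `u`. -/
noncomputable def noiseSum (u : 𝓗) (f : ℕ → 𝓗) (ε : ℕ → ℝ) (n : ℕ) : 𝓗 :=
  u + ∑ i ∈ Finset.range n, ε i • f i

/-- The self-normalized exponential process
`exp (½ ‖S_n‖²_{Λ_n⁻¹} - ½ ‖u‖² / λ) / √(∏_{i < n} (1 + w_i))`. It is the Gaussian mixture of the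
exponential martingales `exp (⟨η, S_n - u⟩ - ½ ‖η‖²_{Λ_n - λ})` over a prior for `η` with covariance
`λ⁻¹` that is centred at `u / λ`. -/
noncomputable def mixProcess (lam : ℝ) (u : 𝓗) (f : ℕ → 𝓗) (ε : ℕ → ℝ) (n : ℕ) : ℝ :=
  (√(∏ i ∈ Finset.range n, (1 + width lam f i)))⁻¹ *
    Real.exp ((⟪noiseSum u f ε n, regInv lam f n (noiseSum u f ε n)⟫_ℝ - lam⁻¹ * ‖u‖ ^ 2) / 2)

variable {lam : ℝ} {f : ℕ → 𝓗} {u : 𝓗} {ε : ℕ → ℝ}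

theorem mixProcess_zero : mixProcess lam u f ε 0 = 1 := by
  simp [mixProcess, noiseSum, regInv_zero_apply, real_inner_smul_right]

theorem mixProcess_nonneg (n : ℕ) : 0 ≤ mixProcess lam u f ε n := by
  unfold mixProcess; positivity

theorem mixProcess_succ (hlam : 0 < lam) (n : ℕ) : mixProcess lam u f ε (n + 1) =
    mixProcess lam u f ε n * ((√(1 + width lam f n))⁻¹ *
      Real.exp ((2 * ⟪f n, regInv lam f n (noiseSum u f ε n)⟫_ℝ * ε n + width lam f n * ε n ^ 2 -
        ⟪f n, regInv lam f n (noiseSum u f ε n)⟫_ℝ ^ 2) / (2 * (1 + width lam f n)))) := by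
  have hw := width_nonneg (f := f) (n := n) hlam
  have hS : noiseSum u f ε (n + 1) = noiseSum u f ε n + ε n • f n := by
    rw [noiseSum, Finset.sum_range_succ, ← add_assoc, noiseSum]
  set S := noiseSum u f ε n with hSdef
  set m := ⟪f n, regInv lam f n S⟫_ℝ with hm
  have hm' : ⟪S, regInv lam f n (f n)⟫_ℝ = m := by rw [← inner_regInv_left, real_inner_comm]
  have hq : ⟪S + ε n • f n, regInv lam f (n + 1) (S + ε n • f n)⟫_ℝ =
      ⟪S, regInv lam f n S⟫_ℝ + (2 * m * ε n + width lam f n * ε n ^ 2 - m ^ 2) /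
        (1 + width lam f n) := by
    rw [regInv_succ_apply, map_add, map_smul]
    have hwd : ⟪f n, regInv lam f n (f n)⟫_ℝ = width lam f n := rfl
    simp only [inner_add_left, inner_sub_right, inner_add_right, real_inner_smul_left,
      real_inner_smul_right, hm', ← hm, hwd]
    field_simp
    ring
  have hexp : ∀ q k : ℝ, Real.exp ((q + k / (1 + width lam f n) - lam⁻¹ * ‖u‖ ^ 2) / 2) =
      Real.exp ((q - lam⁻¹ * ‖u‖ ^ 2) / 2) * Real.exp (k / (2 * (1 + width lam f n))) := by
    intro q k
    rw [← Real.exp_add]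
    congr 1
    field_simp
    ring
  rw [mixProcess, mixProcess, hS, hq, Finset.prod_range_succ, ← hSdef,
    Real.sqrt_mul' _ (by positivity), mul_inv, hexp]
  ring

/-- The self-normalized bound that holds as long as the exponential process stays below `c`. -/
theorem inner_regInv_noiseSum_le (hlam : 0 < lam) {c : ℝ} {n : ℕ}
    (h : mixProcess lam u f ε n ≤ c) :
    ⟪noiseSum u f ε n, regInv lam f n (noiseSum u f ε n)⟫_ℝ ≤
      lam⁻¹ * ‖u‖ ^ 2 + 2 * Real.log c +
        ∑ i ∈ Finset.range n, Real.log (1 + width lam f i) := by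
  have hpos : ∀ i, 0 < 1 + width lam f i := fun i => by
    have := width_nonneg (f := f) (n := i) hlam
    positivity
  have hP : 0 < ∏ i ∈ Finset.range n, (1 + width lam f i) := Finset.prod_pos fun i _ => hpos i
  have h1 := Real.log_le_log (by unfold mixProcess; positivity) h
  rw [mixProcess, Real.log_mul (by positivity) (by positivity), Real.log_inv, Real.log_sqrt hP.le,
    Real.log_exp, Real.log_prod fun i _ => (hpos i).ne'] at h1
  linarith

end Mixture

/-! ### Conditional laws on countable spaces and a maximal inequality -/

section ConditionalLaw

variable {Ω ι : Type*} {m m0 : MeasurableSpace Ω} {μ : Measure Ω} [IsProbabilityMeasure μ]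

theorem lintegral_indicator_eq_of_condExp (hm : m ≤ m0) {E : Set Ω} (hE : MeasurableSet E)
    {p : Ω → ℝ≥0∞} (hp1 : ∀ ω, p ω ≤ 1)
    (hlaw : μ[E.indicator (fun _ => (1 : ℝ)) | m] =ᵐ[μ] fun ω => (p ω).toReal)
    {g : Ω → ℝ≥0∞} (hg : Measurable[m] g) :
    ∫⁻ ω, E.indicator g ω ∂μ = ∫⁻ ω, p ω * g ω ∂μ := by
  have hpm : AEMeasurable p μ := by
    have h1 : AEMeasurable (fun ω => (p ω).toReal) μ :=
      (stronglyMeasurable_condExp.mono hm).measurable.aemeasurable.congr hlaw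
    have h2 := h1.ennreal_ofReal
    refine h2.congr (Filter.Eventually.of_forall fun ω => ?_)
    exact ENNReal.ofReal_toReal ((hp1 ω).trans_lt ENNReal.one_lt_top).ne
  have htrim : (μ.restrict E).trim hm = (μ.withDensity p).trim hm := by
    refine @Measure.ext _ m _ _ fun s hs => ?_
    have hint : Integrable (E.indicator fun _ => (1 : ℝ)) μ :=
      (integrable_const (1 : ℝ)).indicator hE
    have h1 := setIntegral_condExp hm hint hs
    have hs0 := hm s hs
    rw [trim_measurableSet_eq hm hs, trim_measurableSet_eq hm hs, Measure.restrict_apply hs0,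
      withDensity_apply _ hs0]
    rw [setIntegral_congr_ae hs0 (hlaw.mono fun ω h _ => h), setIntegral_indicator hE,
      setIntegral_const, smul_eq_mul, mul_one] at h1
    rw [integral_toReal hpm.restrict (Filter.Eventually.of_forall fun ω =>
      (hp1 ω).trans_lt ENNReal.one_lt_top), Measure.real] at h1
    refine ((ENNReal.toReal_eq_toReal_iff' ?_ (measure_ne_top _ _)).1 h1).symm
    refine ((lintegral_mono hp1).trans_lt ?_).ne
    simp only [lintegral_const, one_mul]
    exact measure_lt_top _ _
  rw [lintegral_indicator hE, ← lintegral_trim hm hg, htrim, lintegral_trim hm hg,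
    lintegral_withDensity_eq_lintegral_mul₀ hpm (hg.mono hm le_rfl).aemeasurable]
  rfl

/-- Integrating out a variable `X` with countably many values and known conditional law `κ`. -/
theorem lintegral_eq_lintegral_condLaw [Countable ι] [MeasurableSpace ι]
    [MeasurableSingletonClass ι] (hm : m ≤ m0) {X : Ω → ι} (hX : Measurable X) {κ : Ω → PMF ι}
    (hlaw : ∀ i, μ[(X ⁻¹' {i}).indicator (fun _ => (1 : ℝ)) | m] =ᵐ[μ]
      fun ω => (κ ω i).toReal)
    {g : Ω → ι → ℝ≥0∞} (hg : ∀ i, Measurable[m] fun ω => g ω i) :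
    ∫⁻ ω, g ω (X ω) ∂μ = ∫⁻ ω, ∫⁻ i, g ω i ∂(κ ω).toMeasure ∂μ := by
  have hE : ∀ i, MeasurableSet (X ⁻¹' {i}) := fun i => hX (measurableSet_singleton i)
  have h1 : ∀ ω, g ω (X ω) = ∑' i, (X ⁻¹' {i}).indicator (fun ω => g ω i) ω := by
    intro ω
    rw [tsum_eq_single (X ω)]
    · simp
    · intro i hi
      rw [Set.indicator_of_notMem]
      exact fun h => hi h.symm
  have h2 : ∀ i, AEMeasurable (fun ω => κ ω i * g ω i) μ := by
    intro i
    have h3 : AEMeasurable (fun ω => (κ ω i).toReal) μ :=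
      (stronglyMeasurable_condExp.mono hm).measurable.aemeasurable.congr (hlaw i)
    refine AEMeasurable.mul ?_ ((hg i).mono hm le_rfl).aemeasurable
    refine h3.ennreal_ofReal.congr (Filter.Eventually.of_forall fun ω => ?_)
    exact ENNReal.ofReal_toReal ((κ ω).apply_ne_top i)
  simp_rw [h1]
  rw [lintegral_tsum fun i =>
    (((hg i).mono hm le_rfl).indicator (hE i)).aemeasurable]
  simp_rw [fun i => lintegral_indicator_eq_of_condExp hm (hE i)
    (fun ω => (κ ω).coe_le_one i) (hlaw i) (hg i)]
  rw [← lintegral_tsum h2]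
  refine lintegral_congr fun ω => ?_
  rw [lintegral_countable']
  refine tsum_congr fun i => ?_
  rw [PMF.toMeasure_apply_singleton _ _ (measurableSet_singleton i), mul_comm]

theorem lintegral_le_of_condLaw [Countable ι] [MeasurableSpace ι]
    [MeasurableSingletonClass ι] (hm : m ≤ m0) {X : Ω → ι} (hX : Measurable X) {κ : Ω → PMF ι}
    (hlaw : ∀ i, μ[(X ⁻¹' {i}).indicator (fun _ => (1 : ℝ)) | m] =ᵐ[μ]
      fun ω => (κ ω i).toReal)
    {g : Ω → ι → ℝ≥0∞} (hg : ∀ i, Measurable[m] fun ω => g ω i) {W : Ω → ℝ≥0∞}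
    (hW : ∀ ω, ∫⁻ i, g ω i ∂(κ ω).toMeasure ≤ W ω) :
    ∫⁻ ω, g ω (X ω) ∂μ ≤ ∫⁻ ω, W ω ∂μ := by
  rw [lintegral_eq_lintegral_condLaw hm hX hlaw hg]
  exact lintegral_mono hW

end ConditionalLaw

section Ville

variable {Ω : Type*} [MeasurableSpace Ω] {μ : Measure Ω}

/-- **Ville's maximal inequality** for a nonnegative process of finite horizon. The supermartingale
property is used on the events that the process has stayed below the level so far. -/
theorem measure_exists_ge_le {M : ℕ → Ω → ℝ≥0∞} (hM : ∀ t, Measurable (M t)) {T : ℕ} {c : ℝ≥0∞}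
    (hc0 : c ≠ 0) (hc : c ≠ ∞) (h0 : ∫⁻ ω, M 0 ω ∂μ ≤ 1)
    (hstep : ∀ t < T, ∫⁻ ω in {ω | ∀ k ≤ t, M k ω < c}, M (t + 1) ω ∂μ ≤
      ∫⁻ ω in {ω | ∀ k ≤ t, M k ω < c}, M t ω ∂μ) :
    μ {ω | ∃ k ≤ T, c ≤ M k ω} ≤ c⁻¹ := by
  have hmeas : ∀ t, MeasurableSet {ω | ∃ k ≤ t, c ≤ M k ω} := by
    intro t
    have : {ω | ∃ k ≤ t, c ≤ M k ω} = ⋃ k ∈ Finset.range (t + 1), {ω | c ≤ M k ω} := by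
      ext ω; simp
    rw [this]
    exact Finset.measurableSet_biUnion _ fun k _ => measurableSet_le measurable_const (hM k)
  have hcompl : ∀ t, {ω | ∀ k ≤ t, M k ω < c} = {ω | ∃ k ≤ t, c ≤ M k ω}ᶜ := by
    intro t; ext ω; simp
  have hsplit : ∀ t (B : Set Ω), MeasurableSet B → (∀ ω ∈ B, c ≤ M t ω) →
      ∀ A : Set Ω, B ⊆ A →
      c * μ B + ∫⁻ ω in A \ B, M t ω ∂μ ≤ ∫⁻ ω in A, M t ω ∂μ := by
    intro t B hB hcB A hBA
    have hBA' := lintegral_inter_add_sdiff (μ := μ) (M t) A hB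
    rw [Set.inter_eq_right.2 hBA] at hBA'
    rw [← hBA']
    gcongr
    rw [← setLIntegral_const]
    exact setLIntegral_mono (hM t) hcB
  have hind : ∀ t ≤ T, c * μ {ω | ∃ k ≤ t, c ≤ M k ω} +
      ∫⁻ ω in {ω | ∀ k ≤ t, M k ω < c}, M t ω ∂μ ≤ 1 := by
    intro t
    induction t with
    | zero =>
      intro _
      refine le_trans ?_ h0
      have := hsplit 0 {ω | ∃ k ≤ 0, c ≤ M k ω} (hmeas 0) (by simp) Set.univ (Set.subset_univ _)
      rwa [← Set.compl_eq_univ_sdiff, ← hcompl, setLIntegral_univ] at this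
    | succ t ih =>
      intro ht
      have ih' := ih (by omega)
      have hst := hstep t (by omega)
      set N : Set Ω := {ω | ∀ k ≤ t, M k ω < c} with hN
      have hNm : MeasurableSet N := by rw [hN, hcompl]; exact (hmeas t).compl
      set B : Set Ω := N ∩ {ω | c ≤ M (t + 1) ω} with hB
      have hBm : MeasurableSet B := hNm.inter (measurableSet_le measurable_const (hM _))
      have h1 := hsplit (t + 1) B hBm (fun ω h => h.2) N Set.inter_subset_left
      have h2 : N \ B = {ω | ∀ k ≤ t + 1, M k ω < c} := by
        ext ω
        simp only [hB, hN, Set.mem_sdiff, Set.mem_inter_iff, Set.mem_ofPred_eq, not_and, not_le]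
        constructor
        · rintro ⟨h3, h4⟩ k hk
          rcases Nat.le_succ_iff.1 hk with hk | rfl
          · exact h3 k hk
          · exact h4 h3
        · exact fun h => ⟨fun k hk => h k (by omega), fun _ => h _ le_rfl⟩
      have h3 : {ω | ∃ k ≤ t + 1, c ≤ M k ω} ⊆ {ω | ∃ k ≤ t, c ≤ M k ω} ∪ B := by
        rintro ω ⟨k, hk, hck⟩
        by_cases h : ∃ k ≤ t, c ≤ M k ω
        · exact Or.inl h
        · refine Or.inr ⟨by simpa [hN] using h, ?_⟩
          rcases Nat.le_succ_iff.1 hk with hk | rfl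
          · exact absurd ⟨k, hk, hck⟩ h
          · exact hck
      rw [h2] at h1
      calc c * μ {ω | ∃ k ≤ t + 1, c ≤ M k ω} +
            ∫⁻ ω in {ω | ∀ k ≤ t + 1, M k ω < c}, M (t + 1) ω ∂μ
          ≤ c * (μ {ω | ∃ k ≤ t, c ≤ M k ω} + μ B) +
            ∫⁻ ω in {ω | ∀ k ≤ t + 1, M k ω < c}, M (t + 1) ω ∂μ := by
            gcongr
            exact (measure_mono h3).trans (measure_union_le _ _)
        _ = c * μ {ω | ∃ k ≤ t, c ≤ M k ω} + (c * μ B +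
            ∫⁻ ω in {ω | ∀ k ≤ t + 1, M k ω < c}, M (t + 1) ω ∂μ) := by ring
        _ ≤ c * μ {ω | ∃ k ≤ t, c ≤ M k ω} + ∫⁻ ω in N, M t ω ∂μ := by
            gcongr
            exact h1.trans hst
        _ ≤ 1 := ih'
  have h := le_self_add.trans (hind T le_rfl)
  rw [mul_comm] at h
  rw [← one_div]
  exact (ENNReal.le_div_iff_mul_le (Or.inl hc0) (Or.inl hc)).2 h

end Ville

/-! ### Values of policies, the Bellman equation and integrated features -/

section BindIntegral

variable {α : Type*}

theorem toMeasure_bind_eq_sum {β : Type*} [MeasurableSpace β] (p : PMF α) (q : α → PMF β) :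
    (p.bind q).toMeasure = Measure.sum fun a => p a • (q a).toMeasure := by
  refine Measure.ext fun s hs => ?_
  rw [PMF.toMeasure_bind_apply _ _ _ hs, Measure.sum_apply _ hs]
  rfl

theorem ae_toMeasure_bind (p : PMF α) {q : α → PMF ℝ} {E : Set ℝ} (hE : MeasurableSet E)
    (h : ∀ a, ∀ᵐ v ∂(q a).toMeasure, v ∈ E) : ∀ᵐ v ∂(p.bind q).toMeasure, v ∈ E := by
  rw [toMeasure_bind_eq_sum]
  refine (Measure.ae_sum_iff' (p := fun v => v ∈ E) hE).2 ?_
  exact fun a => Measure.ae_smul_measure (h a) _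

theorem ae_toMeasure_map_add {p : PMF ℝ} {r a b : ℝ}
    (h : ∀ᵐ v ∂p.toMeasure, r + v ∈ Set.Icc a b) :
    ∀ᵐ v ∂(p.map fun v => r + v).toMeasure, v ∈ Set.Icc a b := by
  rw [← PMF.toMeasure_map _ _ (measurable_const_add r)]
  exact (ae_map_iff (p := fun v => v ∈ Set.Icc a b) (measurable_const_add r).aemeasurable
    measurableSet_Icc).2 h

theorem integrable_id_of_ae_mem_Icc {p : PMF ℝ} {a b : ℝ}
    (h : ∀ᵐ v ∂p.toMeasure, v ∈ Set.Icc a b) : Integrable (fun v : ℝ => v) p.toMeasure :=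
  Integrable.of_mem_Icc a b measurable_id.aemeasurable h

theorem integral_id_mem_Icc {p : PMF ℝ} {a b : ℝ}
    (h : ∀ᵐ v ∂p.toMeasure, v ∈ Set.Icc a b) : ∫ v, v ∂p.toMeasure ∈ Set.Icc a b := by
  have hi := integrable_id_of_ae_mem_Icc h
  constructor
  · have := integral_mono_ae (integrable_const a) hi (h.mono fun v hv => hv.1)
    simpa using this
  · have := integral_mono_ae hi (integrable_const b) (h.mono fun v hv => hv.2)
    simpa using this

theorem integral_id_bind (p : PMF α) {q : α → PMF ℝ} {a b : ℝ}
    (h : ∀ i, ∀ᵐ v ∂(q i).toMeasure, v ∈ Set.Icc a b) :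
    ∫ v, v ∂(p.bind q).toMeasure = ∑' i, (p i).toReal * ∫ v, v ∂(q i).toMeasure := by
  have hi := integrable_id_of_ae_mem_Icc (ae_toMeasure_bind p measurableSet_Icc h)
  rw [toMeasure_bind_eq_sum] at hi ⊢
  rw [integral_sum_measure hi]
  simp only [integral_smul_measure, smul_eq_mul]

theorem integrable_of_mem_Icc [MeasurableSpace α] [Countable α] [MeasurableSingletonClass α]
    (p : PMF α) {V : α → ℝ} {a b : ℝ} (hV : ∀ s, V s ∈ Set.Icc a b) :
    Integrable V p.toMeasure :=
  Integrable.of_mem_Icc a b (measurable_of_countable V).aemeasurable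
    (Filter.Eventually.of_forall hV)

end BindIntegral

namespace KernelMixtureGame

variable {S A 𝓗 : Type*} [NormedAddCommGroup 𝓗] [InnerProductSpace ℝ 𝓗] {H : ℕ}
  (G : KernelMixtureGame S A 𝓗 H)

theorem ae_returnLaw_mem_Icc (π ν : Policy S A H) (h : ℕ) (hh : h ≤ H) (x : S) :
    ∀ᵐ v ∂(G.returnLaw π ν h x).toMeasure, v ∈ Set.Icc (-((H : ℝ) - h)) ((H : ℝ) - h) := by
  obtain ⟨n, hn⟩ := Nat.exists_eq_add_of_le hh
  induction n generalizing h x with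
  | zero =>
    have : ¬ h < H := by omega
    rw [returnLaw, dif_neg this, PMF.toMeasure_pure, ae_dirac_eq]
    simp [hn]
  | succ n ih =>
    have hlt : h < H := by omega
    rw [returnLaw, dif_pos hlt]
    refine ae_toMeasure_bind _ measurableSet_Icc fun a => ?_
    refine ae_toMeasure_bind _ measurableSet_Icc fun b => ?_
    refine ae_toMeasure_bind _ measurableSet_Icc fun s => ?_
    refine ae_toMeasure_map_add ((ih (h + 1) (by omega) s (by omega)).mono fun v hv => ?_)
    have hr := G.reward_mem ⟨h, hlt⟩ (x, a, b)
    push_cast at hv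
    constructor <;> linarith [hv.1, hv.2, hr.1, hr.2]

theorem value_mem_Icc (π ν : Policy S A H) (h : ℕ) (hh : h ≤ H) (x : S) :
    G.value π ν h x ∈ Set.Icc (-((H : ℝ) - h)) ((H : ℝ) - h) :=
  integral_id_mem_Icc (G.ae_returnLaw_mem_Icc π ν h hh x)

theorem value_mem_Icc_horizon (π ν : Policy S A H) {h : ℕ} (hh : h ≤ H) (s : S) :
    G.value π ν h s ∈ Set.Icc (-(H : ℝ)) H := by
  have h1 := G.value_mem_Icc π ν h hh s
  have h3 : (0 : ℝ) ≤ h := Nat.cast_nonneg _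
  constructor <;> linarith [h1.1, h1.2]

theorem value_of_le (π ν : Policy S A H) {h : ℕ} (hh : H ≤ h) (x : S) : G.value π ν h x = 0 := by
  rw [value, returnLaw, dif_neg (by omega), PMF.toMeasure_pure, integral_dirac]

theorem hasSum_phiV {V : S → ℝ} {M : ℝ} (hM : 0 < M) (hV : ∀ s, V s ∈ Set.Icc (-M) M)
    (z : S × A × A) : HasSum (fun s => V s • G.φ s z) (phiV G.φ V z) ∧ ‖phiV G.φ V z‖ ≤ M := by
  have hV' : ∀ s, M⁻¹ * V s ∈ Set.Icc (-1 : ℝ) 1 := by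
    intro s
    have := hV s
    rw [← div_eq_inv_mul]
    constructor
    · rw [le_div_iff₀ hM]; linarith [this.1]
    · rw [div_le_one hM]; exact this.2
  have h1 := (G.summable_phiV (fun s => M⁻¹ * V s) z hV').hasSum
  have h2 := h1.const_smul M
  have e : (fun s => M • (M⁻¹ * V s) • G.φ s z) = fun s => V s • G.φ s z := by
    funext s
    rw [smul_smul, ← mul_assoc, mul_inv_cancel₀ hM.ne', one_mul]
  rw [e] at h2
  have e2 : phiV G.φ V z = M • phiV G.φ (fun s => M⁻¹ * V s) z := h2.tsum_eq
  refine ⟨by rw [e2]; exact h2, ?_⟩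
  rw [e2, norm_smul, Real.norm_of_nonneg hM.le]
  exact mul_le_of_le_one_right hM.le (G.norm_phiV_le _ z hV')

theorem weightedKernel_eq_inner {V W : S → ℝ} {M : ℝ} (hM : 0 < M)
    (hV : ∀ s, V s ∈ Set.Icc (-M) M) (hW : ∀ s, W s ∈ Set.Icc (-M) M) (z z' : S × A × A) :
    weightedKernel G.φ V W z z' = ⟪phiV G.φ V z, phiV G.φ W z'⟫_ℝ := by
  have h1 : ∀ s₁, ∑' s₂, V s₁ * W s₂ * ⟪G.φ s₁ z, G.φ s₂ z'⟫_ℝ =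
      ⟪V s₁ • G.φ s₁ z, phiV G.φ W z'⟫_ℝ := by
    intro s₁
    refine (((innerSL ℝ (V s₁ • G.φ s₁ z)).hasSum (G.hasSum_phiV hM hW z').1).congr_fun
      ?_).tsum_eq
    intro s₂
    simp
    ring
  rw [weightedKernel]
  simp_rw [h1]
  have h2 := (innerSL ℝ (phiV G.φ W z')).hasSum (G.hasSum_phiV hM hV z).1
  rw [real_inner_comm]
  refine (h2.congr_fun ?_).tsum_eq
  intro s
  exact real_inner_comm _ _

variable [MeasurableSpace S]

/-- The expectation `(P_h V)(z)` of `V` at the state that follows `z`. -/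
noncomputable def next (h : Fin H) (V : S → ℝ) (z : S × A × A) : ℝ :=
  ∫ s, V s ∂(G.trans h z).toMeasure

variable [Countable S] [MeasurableSingletonClass S]

theorem next_eq_tsum (h : Fin H) {V : S → ℝ} {a b : ℝ} (hV : ∀ s, V s ∈ Set.Icc a b)
    (z : S × A × A) : G.next h V z = ∑' s, (G.trans h z s).toReal * V s :=
  PMF.integral_eq_tsum _ _ (integrable_of_mem_Icc _ hV)

theorem next_mono (h : Fin H) {V W : S → ℝ} {a b : ℝ} (hV : ∀ s, V s ∈ Set.Icc a b)
    (hW : ∀ s, W s ∈ Set.Icc a b) (hVW : ∀ s, V s ≤ W s) (z : S × A × A) :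
    G.next h V z ≤ G.next h W z :=
  integral_mono (integrable_of_mem_Icc _ hV) (integrable_of_mem_Icc _ hW) hVW

theorem next_mem_Icc (h : Fin H) {V : S → ℝ} {a b : ℝ} (hV : ∀ s, V s ∈ Set.Icc a b)
    (z : S × A × A) : G.next h V z ∈ Set.Icc a b := by
  have hi := integrable_of_mem_Icc (G.trans h z) hV
  constructor
  · simpa [next] using integral_mono (integrable_const a) hi fun s => (hV s).1
  · simpa [next] using integral_mono hi (integrable_const b) fun s => (hV s).2

theorem next_sub (h : Fin H) {V W : S → ℝ} {a b : ℝ} (hV : ∀ s, V s ∈ Set.Icc a b)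
    (hW : ∀ s, W s ∈ Set.Icc a b) (z : S × A × A) :
    G.next h (fun s => V s - W s) z = G.next h V z - G.next h W z :=
  integral_sub (integrable_of_mem_Icc _ hV) (integrable_of_mem_Icc _ hW)

theorem reward_add_next_value_mem_Icc (π ν : Policy S A H) (h : Fin H) (z : S × A × A) :
    G.reward h z + G.next h (G.value π ν (h + 1)) z ∈ Set.Icc (-(H : ℝ)) H := by
  have h1 := G.next_mem_Icc h (fun s => G.value_mem_Icc π ν (h + 1) h.2 s) z
  have h2 := G.reward_mem h z
  have h3 : (0 : ℝ) ≤ (h : ℕ) := Nat.cast_nonneg _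
  push_cast at h1
  constructor <;> linarith [h1.1, h1.2, h2.1, h2.2]

/-- The Bellman equation for a pair of policies. -/
theorem value_eq [Fintype A] (π ν : Policy S A H) (h : Fin H) (x : S) :
    G.value π ν h x = ∑ a, (π h x a).toReal * ∑ b, (ν h x b).toReal *
      (G.reward h (x, a, b) + G.next h (G.value π ν (h + 1)) (x, a, b)) := by
  obtain ⟨h, hh⟩ := h
  have hs : ∀ a b s, ∀ᵐ v ∂((G.returnLaw π ν (h + 1) s).map
      fun v => G.reward ⟨h, hh⟩ (x, a, b) + v).toMeasure, v ∈ Set.Icc (-(H : ℝ)) H := by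
    intro a b s
    refine ae_toMeasure_map_add ((G.ae_returnLaw_mem_Icc π ν (h + 1) hh s).mono fun v hv => ?_)
    have hr := G.reward_mem ⟨h, hh⟩ (x, a, b)
    have h0 : (0 : ℝ) ≤ h := Nat.cast_nonneg h
    push_cast at hv
    constructor <;> linarith [hv.1, hv.2, hr.1, hr.2]
  have hb : ∀ a b, ∀ᵐ v ∂((G.trans ⟨h, hh⟩ (x, a, b)).bind fun s =>
        (G.returnLaw π ν (h + 1) s).map fun v => G.reward ⟨h, hh⟩ (x, a, b) + v).toMeasure,
      v ∈ Set.Icc (-(H : ℝ)) H := fun a b => ae_toMeasure_bind _ measurableSet_Icc (hs a b)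
  rw [value, returnLaw, dif_pos hh,
    integral_id_bind _ fun a => ae_toMeasure_bind _ measurableSet_Icc (hb a), tsum_fintype]
  refine Finset.sum_congr rfl fun a _ => ?_
  rw [integral_id_bind _ (hb a), tsum_fintype]
  congr 1
  refine Finset.sum_congr rfl fun b _ => ?_
  rw [integral_id_bind _ (hs a b)]
  congr 1
  have hval : ∀ s, G.value π ν (h + 1) s ∈
      Set.Icc (-((H : ℝ) - (h + 1 : ℕ))) ((H : ℝ) - (h + 1 : ℕ)) :=
    fun s => G.value_mem_Icc π ν (h + 1) hh s
  have hint := integrable_of_mem_Icc (G.trans ⟨h, hh⟩ (x, a, b)) hval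
  have e1 : ∀ s, ∫ v, v ∂((G.returnLaw π ν (h + 1) s).map
      fun v => G.reward ⟨h, hh⟩ (x, a, b) + v).toMeasure =
      G.reward ⟨h, hh⟩ (x, a, b) + G.value π ν (h + 1) s := by
    intro s
    rw [← PMF.toMeasure_map _ _ (measurable_const_add _), integral_map (by fun_prop) (by fun_prop),
      integral_add (integrable_const _)
        (integrable_id_of_ae_mem_Icc (G.ae_returnLaw_mem_Icc π ν (h + 1) hh s))]
    simp [value]
  simp_rw [e1]
  have h2 := PMF.integral_eq_tsum (G.trans ⟨h, hh⟩ (x, a, b))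
    (fun s => G.reward ⟨h, hh⟩ (x, a, b) + G.value π ν (h + 1) s) ((integrable_const _).add hint)
  simp only [smul_eq_mul] at h2
  rw [← h2, integral_add (integrable_const _) hint]
  simp [next]

theorem inner_phiV {V : S → ℝ} {M : ℝ} (hM : 0 < M) (hV : ∀ s, V s ∈ Set.Icc (-M) M)
    (h : Fin H) (z : S × A × A) : ⟪phiV G.φ V z, G.θ h⟫_ℝ = G.next h V z := by
  have h2 := (innerSL ℝ (G.θ h)).hasSum (G.hasSum_phiV hM hV z).1
  rw [real_inner_comm, G.next_eq_tsum h hV]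
  refine ((h2.congr_fun ?_).tsum_eq).symm
  intro s
  simp [G.trans_eq, real_inner_comm, mul_comm]

end KernelMixtureGame

/-! ### The effective dimension -/

namespace KernelMixtureGame

variable {S A 𝓗 : Type*} [NormedAddCommGroup 𝓗] [InnerProductSpace ℝ 𝓗] {H : ℕ}
  (G : KernelMixtureGame S A 𝓗 H)

theorem log_det_weightedKernel (hH : 0 < H) {lam : ℝ} (hlam : 0 < lam) (T : ℕ)
    (V : Fin T → S → ℝ) (hV : ∀ i s, V i s ∈ Set.Icc (-(H : ℝ)) H) (z : Fin T → S × A × A)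
    (f : ℕ → 𝓗) (hf : ∀ i : Fin T, f i = phiV G.φ (V i) (z i)) :
    Real.log (Matrix.det (1 + lam⁻¹ • Matrix.of fun i j : Fin T =>
      weightedKernel G.φ (V i) (V j) (z i) (z j))) =
      ∑ i ∈ Finset.range T, Real.log (1 + width lam f i) := by
  rw [← log_det_one_add_gram hlam]
  congr 5
  funext i j
  rw [G.weightedKernel_eq_inner (Nat.cast_pos.2 hH) (hV i) (hV j), hf, hf]

theorem bddAbove_effDim (hH : 0 < H) {lam : ℝ} (hlam : 0 < lam) (T : ℕ) :
    BddAbove (Set.range fun p : (Fin T → {V : S → ℝ // ∀ s, V s ∈ Set.Icc (-(H : ℝ)) H}) ×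
      (Fin T → S × A × A) => (1 / 2) * Real.log (Matrix.det
        (1 + lam⁻¹ • Matrix.of fun i j : Fin T =>
          weightedKernel G.φ (p.1 i).1 (p.1 j).1 (p.2 i) (p.2 j)))) := by
  refine ⟨(1 / 2) * ∑ i ∈ Finset.range T, Real.log (1 + lam⁻¹ * (H : ℝ) ^ 2), ?_⟩
  rintro _ ⟨p, rfl⟩
  set f : ℕ → 𝓗 := fun i => if hi : i < T then phiV G.φ (p.1 ⟨i, hi⟩).1 (p.2 ⟨i, hi⟩) else 0
    with hf
  have hle : ∀ i, ‖f i‖ ≤ H := by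
    intro i
    by_cases hi : i < T
    · simp only [hf, dif_pos hi]
      exact (G.hasSum_phiV (Nat.cast_pos.2 hH) (p.1 ⟨i, hi⟩).2 _).2
    · simp [hf, dif_neg hi]
  simp only
  rw [G.log_det_weightedKernel hH hlam T (fun i => (p.1 i).1) (fun i => (p.1 i).2) p.2 f
    fun i => by simp [hf]]
  gcongr with i
  · have := width_nonneg (f := f) (n := i) hlam
    positivity
  · refine (inner_regInv_self_le hlam _).trans ?_
    have := hle i
    gcongr

/-- The effective dimension dominates the log-determinants of the features that occur in a run. -/
theorem sum_log_one_add_width_le (hH : 0 < H) {lam : ℝ} (hlam : 0 < lam) (T : ℕ)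
    {V : ℕ → S → ℝ} (hV : ∀ i s, V i s ∈ Set.Icc (-(H : ℝ)) H) (z : ℕ → S × A × A) :
    ∑ i ∈ Finset.range T, Real.log (1 + width lam (fun i => phiV G.φ (V i) (z i)) i) ≤
      2 * effDim G.φ H T lam := by
  have h := le_ciSup (G.bddAbove_effDim hH hlam T)
    (⟨fun i => ⟨V i, hV i⟩, fun i => z i⟩ : (Fin T → _) × (Fin T → S × A × A))
  simp only at h
  rw [G.log_det_weightedKernel hH hlam T (fun i => V i) (fun i => hV i) (fun i => z i)
    (fun i => phiV G.φ (V i) (z i)) fun i => rfl] at h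
  rw [effDim]
  linarith

theorem effDim_nonneg [Nonempty S] [Nonempty A] (hH : 0 < H) {lam : ℝ} (hlam : 0 < lam) (T : ℕ) :
    0 ≤ effDim G.φ H T lam := by
  obtain ⟨s⟩ := ‹Nonempty S›
  obtain ⟨a⟩ := ‹Nonempty A›
  have h := G.sum_log_one_add_width_le hH hlam T (V := fun _ _ => 0) (by simp)
    (fun _ => (s, a, a))
  set f : ℕ → 𝓗 := fun _ => phiV G.φ (fun _ => 0) (s, a, a)
  have h0 : 0 ≤ ∑ i ∈ Finset.range T, Real.log (1 + width lam f i) :=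
    Finset.sum_nonneg fun i _ =>
      Real.log_nonneg (le_add_of_nonneg_right (width_nonneg (f := f) (n := i) hlam))
  linarith

variable [MeasurableSpace S] [Countable S] [MeasurableSingletonClass S]

/-- The total mass `1` of a transition law forces the feature of the constant function `H` to have
norm at least `H / B`. -/
theorem le_mul_norm_phiV_const [Nonempty S] [Nonempty A] (hH : 0 < H) {B : ℝ}
    (hB : ∀ h, ‖G.θ h‖ ≤ B) (z : S × A × A) :
    (H : ℝ) ≤ ‖phiV G.φ (fun _ => (H : ℝ)) z‖ * B := by
  have hH' : (0 : ℝ) < H := Nat.cast_pos.2 hH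
  have h1 := G.inner_phiV (V := fun _ => (H : ℝ)) hH' (fun _ => ⟨by linarith, le_rfl⟩) ⟨0, hH⟩ z
  have h2 : G.next ⟨0, hH⟩ (fun _ => (H : ℝ)) z = H := by simp [next]
  exact (h1.trans h2).symm.le.trans
    ((real_inner_le_norm _ _).trans (mul_le_mul_of_nonneg_left (hB _) (norm_nonneg _)))

theorem one_le_of_norm_theta_le [Nonempty S] [Nonempty A] (hH : 0 < H) {B : ℝ}
    (hB : ∀ h, ‖G.θ h‖ ≤ B) : 1 ≤ B := by
  obtain ⟨s⟩ := ‹Nonempty S›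
  obtain ⟨a⟩ := ‹Nonempty A›
  have hH' : (0 : ℝ) < H := Nat.cast_pos.2 hH
  have h1 := G.le_mul_norm_phiV_const hH hB (s, a, a)
  have h2 := (G.hasSum_phiV (V := fun _ => (H : ℝ)) hH' (fun _ => ⟨by linarith, le_rfl⟩)
    (s, a, a)).2
  have hB0 : 0 ≤ B := (norm_nonneg _).trans (hB ⟨0, hH⟩)
  have h3 : (H : ℝ) * 1 ≤ H * B := by
    rw [mul_one]; exact h1.trans (mul_le_mul_of_nonneg_right h2 hB0)
  exact le_of_mul_le_mul_left h3 hH'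

/-- Repeating the constant function `H` gives a rank-one kernel matrix, hence a lower bound on the
effective dimension. -/
theorem log_one_add_le_effDim [Nonempty S] [Nonempty A] (hH : 0 < H) {B lam : ℝ}
    (hB : ∀ h, ‖G.θ h‖ ≤ B) (hlam : 0 < lam) (T : ℕ) :
    Real.log (1 + T * (H : ℝ) ^ 2 / (lam * B ^ 2)) ≤ 2 * effDim G.φ H T lam := by
  have hB1 := G.one_le_of_norm_theta_le hH hB
  obtain ⟨s⟩ := ‹Nonempty S›
  obtain ⟨a⟩ := ‹Nonempty A›
  have hH' : (0 : ℝ) < H := Nat.cast_pos.2 hH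
  have h1 := G.le_mul_norm_phiV_const hH hB (s, a, a)
  have hV : ∀ (_ : ℕ) (_ : S), (H : ℝ) ∈ Set.Icc (-(H : ℝ)) H :=
    fun _ _ => ⟨by linarith, le_rfl⟩
  have h := G.sum_log_one_add_width_le hH hlam T (V := fun _ _ => (H : ℝ)) hV
    (fun _ => (s, a, a))
  set v := phiV G.φ (fun _ => (H : ℝ)) (s, a, a) with hv
  rw [← log_det_one_add_gram hlam] at h
  have hdet : Matrix.det (1 + lam⁻¹ • Matrix.of fun _ _ : Fin T => ⟪v, v⟫_ℝ) =
      1 + T * (lam⁻¹ * ‖v‖ ^ 2) := by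
    have e : (lam⁻¹ • Matrix.of fun _ _ : Fin T => ⟪v, v⟫_ℝ) =
        Matrix.replicateCol Unit (fun _ : Fin T => (1 : ℝ)) *
          Matrix.replicateRow Unit (fun _ : Fin T => lam⁻¹ * ‖v‖ ^ 2) := by
      ext i j
      simp [Matrix.mul_apply]
    rw [e, Matrix.det_one_add_replicateCol_mul_replicateRow]
    simp [dotProduct]
  rw [hdet] at h
  refine le_trans (Real.log_le_log (by positivity) ?_) h
  have hBpos : 0 < B := by linarith
  have h2 : (H : ℝ) / B ≤ ‖v‖ := by rwa [div_le_iff₀ hBpos]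
  have h3 : ((H : ℝ) / B) ^ 2 ≤ ‖v‖ ^ 2 := by gcongr
  have e : (T : ℝ) * (H : ℝ) ^ 2 / (lam * B ^ 2) = T * (lam⁻¹ * (H / B) ^ 2) := by
    field_simp
  rw [e]
  gcongr

end KernelMixtureGame

/-! ### The value estimates of the algorithm -/

section Estimates

variable {S A 𝓗 : Type*} [NormedAddCommGroup 𝓗] [InnerProductSpace ℝ 𝓗] {H : ℕ}

theorem clip_mem_Icc (H : ℕ) (v : ℝ) : clip H v ∈ Set.Icc (-(H : ℝ)) H :=
  ⟨le_max_left _ _, max_le (by linarith [(Nat.cast_nonneg H : (0 : ℝ) ≤ H)]) (min_le_left _ _)⟩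

theorem sum_toReal_eq_one {α : Type*} [Fintype α] (p : PMF α) : ∑ a, (p a).toReal = 1 := by
  rw [← ENNReal.toReal_sum fun a _ => p.apply_ne_top a, ← tsum_fintype (L := .unconditional α),
    p.tsum_coe]
  rfl

theorem jointExp_mem_Icc [Fintype A] (σ : PMF (A × A)) {Q : A × A → ℝ} {a b : ℝ}
    (hQ : ∀ p, Q p ∈ Set.Icc a b) : jointExp σ Q ∈ Set.Icc a b := by
  have h1 := sum_toReal_eq_one σ
  constructor
  · calc a = ∑ p, (σ p).toReal * a := by rw [← Finset.sum_mul, h1, one_mul]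
      _ ≤ _ := Finset.sum_le_sum fun p _ =>
        mul_le_mul_of_nonneg_left (hQ p).1 ENNReal.toReal_nonneg
  · calc _ ≤ ∑ p, (σ p).toReal * b := Finset.sum_le_sum fun p _ =>
        mul_le_mul_of_nonneg_left (hQ p).2 ENNReal.toReal_nonneg
      _ = b := by rw [← Finset.sum_mul, h1, one_mul]

namespace AlgInput

variable [Fintype A] (I : AlgInput S A 𝓗 H) (D : Data S A)

theorem upperQ_mem_Icc (t : ℕ) (h : Fin H) (z : S × A × A) :
    I.upperQ D t h z ∈ Set.Icc (-(H : ℝ)) H := clip_mem_Icc _ _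

theorem lowerQ_mem_Icc (t : ℕ) (h : Fin H) (z : S × A × A) :
    I.lowerQ D t h z ∈ Set.Icc (-(H : ℝ)) H := clip_mem_Icc _ _

theorem values_eq (t : ℕ) (h : Fin H) : I.values D t h =
    (fun s => jointExp (I.cce D t h s) fun p => I.upperQ D t h (s, p),
      fun s => jointExp (I.cce D t h s) fun p => I.lowerQ D t h (s, p)) := by
  rw [values, dif_pos h.2]
  rfl

theorem values_of_le (t : ℕ) {h : ℕ} (hh : H ≤ h) : I.values D t h = (0, 0) := by
  rw [values, dif_neg (by omega)]

theorem values_fst_mem_Icc (t h : ℕ) (s : S) :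
    (I.values D t h).1 s ∈ Set.Icc (-(H : ℝ)) H := by
  by_cases hh : h < H
  · rw [show h = ((⟨h, hh⟩ : Fin H) : ℕ) from rfl, values_eq]
    exact jointExp_mem_Icc _ fun p => I.upperQ_mem_Icc D t _ _
  · rw [values_of_le _ _ _ (by omega)]; simp

theorem values_snd_mem_Icc (t h : ℕ) (s : S) :
    (I.values D t h).2 s ∈ Set.Icc (-(H : ℝ)) H := by
  by_cases hh : h < H
  · rw [show h = ((⟨h, hh⟩ : Fin H) : ℕ) from rfl, values_eq]
    exact jointExp_mem_Icc _ fun p => I.lowerQ_mem_Icc D t _ _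
  · rw [values_of_le _ _ _ (by omega)]; simp

end AlgInput

end Estimates

/-! ### Dependence on the observed data and measurability -/

section History

variable {S A : Type*}

/-- Two data sets agree on everything observed before the actions at step `h` of episode `t`. -/
def Data.EqBefore (H : ℕ) (D D' : Data S A) (t h : ℕ) : Prop :=
  (∀ τ k, (τ < t ∧ k ≤ H) ∨ (τ = t ∧ k ≤ h) → D.x τ k = D'.x τ k) ∧
  (∀ τ k, (τ < t ∧ k < H) ∨ (τ = t ∧ k < h) → D.a τ k = D'.a τ k ∧ D.b τ k = D'.b τ k)

/-- Two data sets agree also on the actions at step `h` of episode `t`. -/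
def Data.EqAfter (H : ℕ) (D D' : Data S A) (t h : ℕ) : Prop :=
  Data.EqBefore H D D' t h ∧ D.a t h = D'.a t h ∧ D.b t h = D'.b t h

namespace Data.EqBefore

variable {H t h : ℕ} {D D' : Data S A}

theorem mono_step (hD : Data.EqBefore H D D' t h) {k : ℕ} (hk : k ≤ h) :
    Data.EqBefore H D D' t k :=
  ⟨fun τ j hj => hD.1 τ j (by omega), fun τ j hj => hD.2 τ j (by omega)⟩

theorem mono_episode (hD : Data.EqBefore H D D' t h) {τ k : ℕ} (hτ : τ < t) (hk : k ≤ H) :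
    Data.EqBefore H D D' τ k :=
  ⟨fun τ j hj => hD.1 τ j (by omega), fun τ j hj => hD.2 τ j (by omega)⟩

theorem x_eq (hD : Data.EqBefore H D D' t h) : D.x t h = D'.x t h := hD.1 t h (by omega)

theorem z_eq (hD : Data.EqBefore H D D' t h) {τ k : ℕ} (hτ : τ < t) (hk : k < H) :
    D.z τ k = D'.z τ k := by
  rw [Data.z, Data.z, hD.1 τ k (by omega), (hD.2 τ k (by omega)).1, (hD.2 τ k (by omega)).2]

theorem z_eq_step (hD : Data.EqBefore H D D' t h) {k : ℕ} (hk : k < h) :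
    D.z t k = D'.z t k := by
  rw [Data.z, Data.z, hD.1 t k (by omega), (hD.2 t k (by omega)).1, (hD.2 t k (by omega)).2]

end Data.EqBefore

theorem Data.EqAfter.z_eq {H t h : ℕ} {D D' : Data S A} (hD : Data.EqAfter H D D' t h) :
    D.z t h = D'.z t h := by
  rw [Data.z, Data.z, hD.1.x_eq, hD.2.1, hD.2.2]

section Generators

variable {Ω : Type*} {H : ℕ} [MeasurableSpace S] [MeasurableSpace A]
variable {D : Ω → Data S A}

theorem measurable_x_historyBefore {t h τ k : ℕ} (hk : (τ < t ∧ k ≤ H) ∨ (τ = t ∧ k ≤ h)) :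
    Measurable[historyBefore H D t h] fun ω => (D ω).x τ k := by
  refine Measurable.mono (comap_measurable _) ?_ le_rfl
  exact le_sup_of_le_left (le_iSup_of_le τ (le_iSup_of_le k (le_iSup_of_le hk le_rfl)))

theorem measurable_ab_historyBefore {t h τ k : ℕ} (hk : (τ < t ∧ k < H) ∨ (τ = t ∧ k < h)) :
    Measurable[historyBefore H D t h] fun ω => ((D ω).a τ k, (D ω).b τ k) := by
  refine Measurable.mono (comap_measurable _) ?_ le_rfl
  exact le_sup_of_le_right (le_iSup_of_le τ (le_iSup_of_le k (le_iSup_of_le hk le_rfl)))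

end Generators

variable {𝓗 : Type*} [NormedAddCommGroup 𝓗] [InnerProductSpace ℝ 𝓗] {H : ℕ} [Fintype A]
  (I : AlgInput S A 𝓗 H) {D D' : Data S A}

theorem AlgInput.values_congr (t : ℕ) (hD : Data.EqBefore H D D' t 0) (h : ℕ) :
    I.values D t h = I.values D' t h := by
  induction t using Nat.strong_induction_on generalizing h with
  | _ t iht =>
    obtain ⟨n, hn⟩ : ∃ n, n = H - h := ⟨_, rfl⟩
    induction n generalizing h with
    | zero => rw [I.values_of_le _ _ (by omega), I.values_of_le _ _ (by omega)]
    | succ n ihn =>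
      have hh : h < H := by omega
      have hpast : ∀ τ : Fin t, I.values D τ (h + 1) = I.values D' τ (h + 1) := fun τ =>
        iht τ τ.2 (hD.mono_episode τ.2 (Nat.zero_le _)) _
      have hnext := ihn (h + 1) (by omega)
      have hz : ∀ τ : Fin t, D.z τ h = D'.z τ h := fun τ => hD.z_eq τ.2 hh
      have hx : ∀ τ : Fin t, D.x τ (h + 1) = D'.x τ (h + 1) := fun τ =>
        hD.1 _ _ (Or.inl ⟨τ.2, hh⟩)
      have hu : I.upperQ D t ⟨h, hh⟩ = I.upperQ D' t ⟨h, hh⟩ := by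
        unfold upperQ optimisticQ region
        simp only [hpast, hnext, hz, hx]
      have hl : I.lowerQ D t ⟨h, hh⟩ = I.lowerQ D' t ⟨h, hh⟩ := by
        unfold lowerQ pessimisticQ region
        simp only [hpast, hnext, hz, hx]
      refine (I.values_eq D t ⟨h, hh⟩).trans (Eq.trans ?_ (I.values_eq D' t ⟨h, hh⟩).symm)
      simp only [cce, hu, hl]

theorem AlgInput.upperQ_congr {t : ℕ} (hD : Data.EqBefore H D D' t 0) (h : Fin H) :
    I.upperQ D t h = I.upperQ D' t h := by
  have hpast : ∀ τ : Fin t, I.values D τ (h + 1) = I.values D' τ (h + 1) := fun τ =>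
    I.values_congr τ (hD.mono_episode τ.2 (Nat.zero_le _)) _
  have hz : ∀ τ : Fin t, D.z τ h = D'.z τ h := fun τ => hD.z_eq τ.2 h.2
  have hx : ∀ τ : Fin t, D.x τ (h + 1) = D'.x τ (h + 1) := fun τ =>
    hD.1 _ _ (Or.inl ⟨τ.2, h.2⟩)
  unfold upperQ optimisticQ region
  simp only [hpast, I.values_congr t hD, hz, hx]

theorem AlgInput.lowerQ_congr {t : ℕ} (hD : Data.EqBefore H D D' t 0) (h : Fin H) :
    I.lowerQ D t h = I.lowerQ D' t h := by
  have hpast : ∀ τ : Fin t, I.values D τ (h + 1) = I.values D' τ (h + 1) := fun τ =>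
    I.values_congr τ (hD.mono_episode τ.2 (Nat.zero_le _)) _
  have hz : ∀ τ : Fin t, D.z τ h = D'.z τ h := fun τ => hD.z_eq τ.2 h.2
  have hx : ∀ τ : Fin t, D.x τ (h + 1) = D'.x τ (h + 1) := fun τ =>
    hD.1 _ _ (Or.inl ⟨τ.2, h.2⟩)
  unfold lowerQ pessimisticQ region
  simp only [hpast, I.values_congr t hD, hz, hx]

section Measurability

variable {Ω β : Type*} [MeasurableSpace S] [MeasurableSpace A] [Countable S]
  [MeasurableSingletonClass S] [MeasurableSingletonClass A] [MeasurableSpace β]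

/-- A function of finitely many coordinates of the data is measurable for every `σ`-algebra that
makes these coordinates measurable, because the coordinates take countably many values. -/
theorem measurable_comp_data [Nonempty S] [Nonempty A] {m : MeasurableSpace Ω} {D : Ω → Data S A}
    (Jx Ja : Finset (ℕ × ℕ))
    (hx : ∀ p ∈ Jx, Measurable[m] fun ω => (D ω).x p.1 p.2)
    (hab : ∀ p ∈ Ja, Measurable[m] fun ω => ((D ω).a p.1 p.2, (D ω).b p.1 p.2))
    {g : Data S A → β}
    (hg : ∀ D D' : Data S A, (∀ p ∈ Jx, D.x p.1 p.2 = D'.x p.1 p.2) →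
      (∀ p ∈ Ja, D.a p.1 p.2 = D'.a p.1 p.2 ∧ D.b p.1 p.2 = D'.b p.1 p.2) → g D = g D') :
    Measurable[m] fun ω => g (D ω) := by
  classical
  let code : Ω → (Jx → S) × (Ja → A × A) := fun ω =>
    (fun p => (D ω).x p.1.1 p.1.2, fun p => ((D ω).a p.1.1 p.1.2, (D ω).b p.1.1 p.1.2))
  let decode : (Jx → S) × (Ja → A × A) → Data S A := fun c =>
    { x := fun τ k => if hp : (τ, k) ∈ Jx then c.1 ⟨(τ, k), hp⟩ else Classical.arbitrary S
      a := fun τ k => if hp : (τ, k) ∈ Ja then (c.2 ⟨(τ, k), hp⟩).1 else Classical.arbitrary A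
      b := fun τ k => if hp : (τ, k) ∈ Ja then (c.2 ⟨(τ, k), hp⟩).2 else Classical.arbitrary A }
  have hcode : Measurable[m] code :=
    (measurable_pi_lambda _ fun p : Jx => hx p.1 p.2).prodMk
      (measurable_pi_lambda _ fun p : Ja => hab p.1 p.2)
  have heq : (fun ω => g (D ω)) = fun ω => (g ∘ decode) (code ω) := by
    funext ω
    refine hg _ _ (fun p hp => ?_) fun p hp => ?_
    · simp [decode, code, hp]
    · simp [decode, code, hp]
  rw [heq]
  exact (measurable_of_countable (g ∘ decode)).comp hcode

variable {D : Ω → Data S A}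

theorem measurable_historyBefore [Nonempty S] [Nonempty A] {t h : ℕ} {g : Data S A → β}
    (hg : ∀ D D' : Data S A, Data.EqBefore H D D' t h → g D = g D') :
    Measurable[historyBefore H D t h] fun ω => g (D ω) := by
  classical
  let J : Finset (ℕ × ℕ) := Finset.range (t + 1) ×ˢ Finset.range (H + h + 1)
  refine measurable_comp_data
    (J.filter fun p => (p.1 < t ∧ p.2 ≤ H) ∨ (p.1 = t ∧ p.2 ≤ h))
    (J.filter fun p => (p.1 < t ∧ p.2 < H) ∨ (p.1 = t ∧ p.2 < h))
    (fun p hp => measurable_x_historyBefore (Finset.mem_filter.1 hp).2)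
    (fun p hp => measurable_ab_historyBefore (Finset.mem_filter.1 hp).2)
    fun D D' h1 h2 => hg D D' ⟨fun τ k hk => h1 (τ, k) ?_, fun τ k hk => h2 (τ, k) ?_⟩
  · simp only [J, Finset.mem_filter, Finset.mem_product, Finset.mem_range]
    omega
  · simp only [J, Finset.mem_filter, Finset.mem_product, Finset.mem_range]
    omega

theorem measurable_historyAfter [Nonempty S] [Nonempty A] {t h : ℕ} {g : Data S A → β}
    (hg : ∀ D D' : Data S A, Data.EqAfter H D D' t h → g D = g D') :
    Measurable[historyAfter H D t h] fun ω => g (D ω) := by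
  classical
  let J : Finset (ℕ × ℕ) := Finset.range (t + 1) ×ˢ Finset.range (H + h + 1)
  refine measurable_comp_data
    (J.filter fun p => (p.1 < t ∧ p.2 ≤ H) ∨ (p.1 = t ∧ p.2 ≤ h))
    (J.filter fun p => (p.1 < t ∧ p.2 < H) ∨ (p.1 = t ∧ p.2 ≤ h))
    (fun p hp => (measurable_x_historyBefore (Finset.mem_filter.1 hp).2).mono le_sup_left le_rfl)
    (fun p hp => ?_)
    fun D D' h1 h2 => hg D D' ⟨⟨fun τ k hk => h1 (τ, k) ?_, fun τ k hk => h2 (τ, k) ?_⟩,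
      h2 (t, h) ?_⟩
  · obtain ⟨τ, k⟩ := p
    have hp2 := (Finset.mem_filter.1 hp).2
    by_cases hk : (τ < t ∧ k < H) ∨ (τ = t ∧ k < h)
    · exact (measurable_ab_historyBefore hk).mono le_sup_left le_rfl
    · obtain ⟨rfl, rfl⟩ : τ = t ∧ k = h := by
        simp only at hp2
        omega
      exact Measurable.mono (comap_measurable _) le_sup_right le_rfl
  · simp only [J, Finset.mem_filter, Finset.mem_product, Finset.mem_range]
    omega
  · simp only [J, Finset.mem_filter, Finset.mem_product, Finset.mem_range]
    omega
  · simp [J]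

end Measurability

end History

/-! ### Confidence regions -/

section Region

variable {𝓗 : Type*} [NormedAddCommGroup 𝓗] [InnerProductSpace ℝ 𝓗]

theorem regInv_congr {lam : ℝ} {f g : ℕ → 𝓗} {n : ℕ} (h : ∀ i < n, f i = g i) :
    regInv lam f n = regInv lam g n := by
  induction n with
  | zero => rfl
  | succ n ih =>
    rw [regInv, regInv, ih fun i hi => h i (by omega), h n (by omega)]

theorem width_congr {lam : ℝ} {f g : ℕ → 𝓗} {n : ℕ} (h : ∀ i ≤ n, f i = g i) :
    width lam f n = width lam g n := by
  rw [width, width, regInv_congr fun i hi => h i (by omega), h n le_rfl]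

theorem noiseSum_congr {u : 𝓗} {f g : ℕ → 𝓗} {ε ξ : ℕ → ℝ} {n : ℕ} (h : ∀ i < n, f i = g i)
    (hε : ∀ i < n, ε i = ξ i) : noiseSum u f ε n = noiseSum u g ξ n := by
  rw [noiseSum, noiseSum]
  congr 1
  refine Finset.sum_congr rfl fun i hi => ?_
  rw [h i (Finset.mem_range.1 hi), hε i (Finset.mem_range.1 hi)]

theorem mixProcess_congr {lam : ℝ} {u : 𝓗} {f g : ℕ → 𝓗} {ε ξ : ℕ → ℝ} {n : ℕ}
    (h : ∀ i < n, f i = g i) (hε : ∀ i < n, ε i = ξ i) :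
    mixProcess lam u f ε n = mixProcess lam u g ξ n := by
  rw [mixProcess, mixProcess, noiseSum_congr h hε, regInv_congr h]
  congr 3
  refine Finset.prod_congr rfl fun i hi => ?_
  rw [width_congr fun j hj => h j (by have := Finset.mem_range.1 hi; omega)]

/-- The true parameter lies in the confidence region while the exponential process is at most `c`.
Starting the noise sum at `-(λ / b) θ` makes the regularization bias part of the process, so that
noise and bias add up inside the square. -/
theorem mem_confRegion_of_mixProcess_le {lam b c β : ℝ} (hlam : 0 < lam) (hb : 0 < b)
    (hβ0 : 0 ≤ β) {n : ℕ} {f : ℕ → 𝓗} {ε y : ℕ → ℝ} {θ : 𝓗}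
    (hy : ∀ i, y i = b * ε i + ⟪f i, θ⟫_ℝ)
    (hproc : mixProcess lam (-(lam / b) • θ) f ε n ≤ c)
    (hβ : b ^ 2 * (2 * Real.log c + ∑ i ∈ Finset.range n, Real.log (1 + width lam f i)) +
      lam * ‖θ‖ ^ 2 ≤ β ^ 2) :
    θ ∈ confRegion lam β (fun i : Fin n => f i) (fun i : Fin n => y i) := by
  set S := noiseSum (-(lam / b) • θ) f ε n with hS
  have hsum : ∑ i ∈ Finset.range n, y i • f i = regOp lam f n θ + b • S := by
    rw [hS, noiseSum, regOp, smul_add, Finset.smul_sum, smul_smul]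
    rw [show b * -(lam / b) = -lam by field_simp, neg_smul]
    simp only [hy, add_smul, Finset.sum_add_distrib, smul_smul]
    abel
  have hdiff : θ - regInv lam f n (∑ i ∈ Finset.range n, y i • f i) =
      (-b) • regInv lam f n S := by
    rw [hsum, map_add, map_smul, regInv_regOp hlam, neg_smul]
    abel
  rw [confRegion, Set.mem_ofPred_eq, ridgeEstimator_eq hlam, hdiff]
  refine Real.sqrt_le_iff.2 ⟨hβ0, ?_⟩
  rw [Fin.sum_univ_eq_sum_range (fun i => ⟪f i, (-b) • regInv lam f n S⟫_ℝ ^ 2)]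
  have h1 : lam * ‖(-b) • regInv lam f n S‖ ^ 2 +
      ∑ i ∈ Finset.range n, ⟪f i, (-b) • regInv lam f n S⟫_ℝ ^ 2 =
      b ^ 2 * ⟪S, regInv lam f n S⟫_ℝ := by
    rw [inner_regInv_self hlam, norm_smul, norm_neg, Real.norm_of_nonneg hb.le, mul_add,
      Finset.mul_sum]
    congr 1
    · ring
    · refine Finset.sum_congr rfl fun i _ => ?_
      rw [real_inner_smul_right]
      ring
  rw [h1]
  have h2 := inner_regInv_noiseSum_le hlam hproc
  have h3 : lam⁻¹ * ‖-(lam / b) • θ‖ ^ 2 = lam * ‖θ‖ ^ 2 / b ^ 2 := by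
    rw [norm_smul, norm_neg, Real.norm_of_nonneg (by positivity)]
    field_simp
  rw [h3, ← hS] at h2
  refine le_trans (mul_le_mul_of_nonneg_left h2 (sq_nonneg b)) (le_trans (le_of_eq ?_) hβ)
  field_simp
  ring

/-- The region is an ellipsoid: every linear functional `⟨g, ·⟩` varies on it by at most twice the
radius times the dual norm of `g`. -/
theorem abs_inner_sub_le_of_mem_confRegion {lam β : ℝ} (hlam : 0 < lam) (hβ : 0 ≤ β) {n : ℕ}
    {f : ℕ → 𝓗} {y : ℕ → ℝ} (g : 𝓗) {θ θ' : 𝓗}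
    (hθ : θ ∈ confRegion lam β (fun i : Fin n => f i) (fun i : Fin n => y i))
    (hθ' : θ' ∈ confRegion lam β (fun i : Fin n => f i) (fun i : Fin n => y i)) :
    |⟪g, θ⟫_ℝ - ⟪g, θ'⟫_ℝ| ≤ 2 * β * √⟪g, regInv lam f n g⟫_ℝ := by
  set c := ridgeEstimator lam (fun i : Fin n => f i) (fun i : Fin n => y i) with hc
  have key : ∀ η ∈ confRegion lam β (fun i : Fin n => f i) (fun i : Fin n => y i),
      |⟪g, η - c⟫_ℝ| ≤ β * √⟪g, regInv lam f n g⟫_ℝ := by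
    intro η hη
    rw [confRegion, Set.mem_ofPred_eq, Real.sqrt_le_iff, ← hc,
      Fin.sum_univ_eq_sum_range (fun i => ⟪f i, η - c⟫_ℝ ^ 2)] at hη
    refine abs_le_of_sq_le_sq ?_ (by positivity)
    rw [mul_pow, Real.sq_sqrt (inner_regInv_self_nonneg hlam _), mul_comm]
    exact (inner_sq_le_mul hlam g _).trans
      (mul_le_mul_of_nonneg_left hη.2 (inner_regInv_self_nonneg hlam _))
  have h1 := key θ hθ
  have h2 := key θ' hθ'
  have e : ⟪g, θ⟫_ℝ - ⟪g, θ'⟫_ℝ = ⟪g, θ - c⟫_ℝ - ⟪g, θ' - c⟫_ℝ := by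
    simp only [inner_sub_right]; ring
  rw [e]
  refine (abs_sub _ _).trans ?_
  linarith

end Region

section Confidence

variable {S A 𝓗 Ω : Type*} [NormedAddCommGroup 𝓗] [InnerProductSpace ℝ 𝓗] {H : ℕ}
  (G : KernelMixtureGame S A 𝓗 H)

/-- The regression feature of episode `τ` at step `h` for the value functions `V`. -/
noncomputable def regFeature (h : Fin H) (V : Data S A → ℕ → S → ℝ) (D : Data S A) (τ : ℕ) : 𝓗 :=
  phiV G.φ (V D τ) (D.z τ h)

variable {G} {h : Fin H} {V : Data S A → ℕ → S → ℝ}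

theorem regFeature_congr (hcongr : ∀ D D' τ, Data.EqBefore H D D' τ 0 → V D τ = V D' τ)
    {D D' : Data S A} {t : ℕ} (hD : Data.EqBefore H D D' t 0) {τ : ℕ} (hτ : τ < t) :
    regFeature G h V D τ = regFeature G h V D' τ := by
  rw [regFeature, regFeature, hcongr D D' τ (hD.mono_episode hτ (Nat.zero_le _)), hD.z_eq hτ h.2]

variable (G) [MeasurableSpace S]

/-- The regression noise of episode `τ`, divided by `H`, if the next state is `s`. -/
noncomputable def regNoise (h : Fin H) (V : Data S A → ℕ → S → ℝ) (D : Data S A) (τ : ℕ) (s : S) :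
    ℝ :=
  (V D τ s - G.next h (V D τ) (D.z τ h)) / H

/-- The exponential process that controls the regression at step `h` for the value functions `V`. -/
noncomputable def regProcess (lam : ℝ) (h : Fin H) (V : Data S A → ℕ → S → ℝ) (D : Data S A)
    (t : ℕ) : ℝ :=
  mixProcess lam (-(lam / H) • G.θ h) (regFeature G h V D)
    (fun τ => regNoise G h V D τ (D.x τ (h + 1))) t

variable {G}

theorem regNoise_congr (hcongr : ∀ D D' τ, Data.EqBefore H D D' τ 0 → V D τ = V D' τ)
    {D D' : Data S A} {t : ℕ} (hD : Data.EqBefore H D D' t 0) {τ : ℕ} (hτ : τ < t) (s : S) :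
    regNoise G h V D τ s = regNoise G h V D' τ s := by
  rw [regNoise, regNoise, hcongr D D' τ (hD.mono_episode hτ (Nat.zero_le _)), hD.z_eq hτ h.2]

theorem regProcess_congr {lam : ℝ}
    (hcongr : ∀ D D' τ, Data.EqBefore H D D' τ 0 → V D τ = V D' τ)
    {D D' : Data S A} {t : ℕ} (hD : Data.EqBefore H D D' t 0) {k : ℕ} (hk : k ≤ t) :
    regProcess G lam h V D k = regProcess G lam h V D' k := by
  refine mixProcess_congr (fun i hi => regFeature_congr hcongr hD (by omega)) fun i hi => ?_
  rw [regNoise_congr hcongr hD (by omega), hD.1 i (h + 1) (Or.inl ⟨by omega, h.2⟩)]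

variable [Fintype A] [MeasurableSpace A] [MeasurableSpace Ω] {μ : Measure Ω} {I : AlgInput S A 𝓗 H} {T : ℕ}
  {D : Ω → Data S A}

theorem IsRun.historyBefore_le (hrun : IsRun G I T μ D) (t h : ℕ) :
    historyBefore H D t h ≤ ‹MeasurableSpace Ω› := by
  refine sup_le ?_ ?_
  · exact iSup_le fun τ => iSup_le fun k => iSup_le fun _ => (hrun.measurable_x τ k).comap_le
  · exact iSup_le fun τ => iSup_le fun k => iSup_le fun _ =>
      ((hrun.measurable_a τ k).prodMk (hrun.measurable_b τ k)).comap_le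

theorem IsRun.historyAfter_le (hrun : IsRun G I T μ D) (t h : ℕ) :
    historyAfter H D t h ≤ ‹MeasurableSpace Ω› :=
  sup_le (hrun.historyBefore_le t h)
    ((hrun.measurable_a t h).prodMk (hrun.measurable_b t h)).comap_le

variable [Countable S] [MeasurableSingletonClass S] [MeasurableSingletonClass A]
  [IsProbabilityMeasure μ] [Nonempty S] [Nonempty A]

/-- With high probability the exponential process of one regression stays below any given level
throughout all episodes. -/
theorem measure_exists_regProcess_ge_le (hrun : IsRun G I T μ D) (hH : 0 < H) {lam : ℝ}
    (hlam : 0 < lam) (h : Fin H) (hV : ∀ D τ s, V D τ s ∈ Set.Icc (-(H : ℝ)) H)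
    (hcongr : ∀ D D' τ, Data.EqBefore H D D' τ 0 → V D τ = V D' τ) {c : ℝ≥0∞} (hc0 : c ≠ 0)
    (hc : c ≠ ∞) :
    μ {ω | ∃ t ≤ T, c ≤ ENNReal.ofReal (regProcess G lam h V (D ω) t)} ≤ c⁻¹ := by
  classical
  have hH' : (0 : ℝ) < H := Nat.cast_pos.2 hH
  have hMb : ∀ t k, k ≤ t → Measurable[historyBefore H D t 0] fun ω =>
      ENNReal.ofReal (regProcess G lam h V (D ω) k) := fun t k hk =>
    measurable_historyBefore (g := fun D => ENNReal.ofReal (regProcess G lam h V D k))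
      fun D D' hD => by simp only [regProcess_congr hcongr hD hk]
  have hM : ∀ t, Measurable fun ω => ENNReal.ofReal (regProcess G lam h V (D ω) t) := fun t =>
    (hMb t t le_rfl).mono (hrun.historyBefore_le t 0) le_rfl
  refine measure_exists_ge_le hM hc0 hc ?_ fun t ht => ?_
  · simp [regProcess, mixProcess_zero]
  set N : Set Ω := {ω | ∀ k ≤ t, ENNReal.ofReal (regProcess G lam h V (D ω) k) < c} with hN
  have hNm : MeasurableSet N := by
    have : N = ⋂ k ∈ Finset.range (t + 1),
        {ω | ENNReal.ofReal (regProcess G lam h V (D ω) k) < c} := by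
      ext ω; simp [hN]
    rw [this]
    exact Finset.measurableSet_biInter _ fun k _ => measurableSet_lt (hM k) measurable_const
  -- The factor by which the process changes in episode `t`, as a function of the next state.
  let F : Data S A → S → ℝ := fun D s =>
    (√(1 + width lam (regFeature G h V D) t))⁻¹ *
      Real.exp ((2 * ⟪regFeature G h V D t, regInv lam (regFeature G h V D) t
          (noiseSum (-(lam / H) • G.θ h) (regFeature G h V D)
            (fun τ => regNoise G h V D τ (D.x τ (h + 1))) t)⟫_ℝ * regNoise G h V D t s +
        width lam (regFeature G h V D) t * regNoise G h V D t s ^ 2 -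
        ⟪regFeature G h V D t, regInv lam (regFeature G h V D) t
          (noiseSum (-(lam / H) • G.θ h) (regFeature G h V D)
            (fun τ => regNoise G h V D τ (D.x τ (h + 1))) t)⟫_ℝ ^ 2) /
        (2 * (1 + width lam (regFeature G h V D) t)))
  let g : Data S A → S → ℝ≥0∞ := fun D s =>
    if ∀ k ≤ t, ENNReal.ofReal (regProcess G lam h V D k) < c then
      ENNReal.ofReal (regProcess G lam h V D t) * ENNReal.ofReal (F D s) else 0
  have hgm : ∀ s, Measurable[historyAfter H D t h] fun ω => g (D ω) s := by
    refine fun s => measurable_historyAfter (g := fun D => g D s) fun D D' hD => ?_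
    have hD0 : Data.EqBefore H D D' t 0 := hD.1.mono_step (Nat.zero_le _)
    have hp : ∀ k ≤ t, regProcess G lam h V D k = regProcess G lam h V D' k := fun k hk =>
      regProcess_congr hcongr hD0 hk
    have hf : ∀ i < t, regFeature G h V D i = regFeature G h V D' i := fun i hi =>
      regFeature_congr hcongr hD0 hi
    have hft : regFeature G h V D t = regFeature G h V D' t := by
      rw [regFeature, regFeature, hcongr D D' t hD0, hD.z_eq]
    have hnt : regNoise G h V D t s = regNoise G h V D' t s := by
      rw [regNoise, regNoise, hcongr D D' t hD0, hD.z_eq]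
    have hw : width lam (regFeature G h V D) t = width lam (regFeature G h V D') t :=
      width_congr fun i hi => by
        rcases hi.lt_or_eq with hi | rfl
        · exact hf i hi
        · exact hft
    have hns : noiseSum (-(lam / H) • G.θ h) (regFeature G h V D)
          (fun τ => regNoise G h V D τ (D.x τ (h + 1))) t =
        noiseSum (-(lam / H) • G.θ h) (regFeature G h V D')
          (fun τ => regNoise G h V D' τ (D'.x τ (h + 1))) t :=
      noiseSum_congr hf fun i hi => by
        rw [regNoise_congr hcongr hD0 hi, hD0.1 i (h + 1) (Or.inl ⟨hi, h.2⟩)]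
    have hF : F D s = F D' s := by
      simp only [F, hw, hnt, hft, hns, regInv_congr hf]
    have hcond : (∀ k ≤ t, ENNReal.ofReal (regProcess G lam h V D k) < c) ↔
        ∀ k ≤ t, ENNReal.ofReal (regProcess G lam h V D' k) < c :=
      forall₂_congr fun k hk => by rw [hp k hk]
    simp only [g, hcond, hp t le_rfl, hF]
  have hle := lintegral_le_of_condLaw (hrun.historyAfter_le t h) (hrun.measurable_x t (h + 1))
    (κ := fun ω => G.trans h ((D ω).z t h)) (fun s => hrun.trans_law t ht h s) hgm
    (W := fun ω => N.indicator (fun ω => ENNReal.ofReal (regProcess G lam h V (D ω) t)) ω) ?_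
  · rw [← lintegral_indicator hNm, ← lintegral_indicator hNm]
    refine le_of_eq_of_le (lintegral_congr fun ω => ?_) hle
    by_cases hω : ω ∈ N
    · rw [Set.indicator_of_mem hω]
      have hω' : ∀ k ≤ t, ENNReal.ofReal (regProcess G lam h V (D ω) k) < c := hω
      simp only [g, if_pos hω']
      rw [← ENNReal.ofReal_mul (show 0 ≤ regProcess G lam h V (D ω) t from mixProcess_nonneg _)]
      congr 1
      exact mixProcess_succ hlam t
    · rw [Set.indicator_of_notMem hω]
      have hω' : ¬ ∀ k ≤ t, ENNReal.ofReal (regProcess G lam h V (D ω) k) < c := hω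
      simp only [g, if_neg hω']
  · intro ω
    by_cases hω : ω ∈ N
    · rw [Set.indicator_of_mem hω]
      have hω' : ∀ k ≤ t, ENNReal.ofReal (regProcess G lam h V (D ω) k) < c := hω
      simp only [g, if_pos hω']
      rw [lintegral_const_mul' _ _ ENNReal.ofReal_ne_top]
      refine mul_le_of_le_one_right (zero_le) ?_
      have hb := G.next_mem_Icc h (hV (D ω) t) ((D ω).z t h)
      set P := G.next h (V (D ω) t) ((D ω).z t h) with hP
      have hint := integrable_of_mem_Icc (G.trans h ((D ω).z t h)) (hV (D ω) t)
      have hmeas : Measurable fun s => regNoise G h V (D ω) t s := measurable_of_countable _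
      refine lintegral_exp_quadratic_le _ hmeas (fun r => ?_) (width_nonneg hlam) _
      -- The noise takes values in an interval of length `2`, so it is `1`-subgaussian.
      have hoeff := lintegral_exp_mul_le_of_mem_Icc (G.trans h ((D ω).z t h)).toMeasure hmeas
        (a := (-(H : ℝ) - P) / H) (b := ((H : ℝ) - P) / H) (fun s => ?_) ?_ r
      · refine hoeff.trans (le_of_eq ?_)
        congr 2
        field_simp
        ring
      · have := hV (D ω) t s
        rw [regNoise, ← hP]
        constructor
        · gcongr; exact this.1
        · gcongr; exact this.2
      · simp only [regNoise, ← hP]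
        rw [integral_div, integral_sub hint (integrable_const _)]
        simp [hP, KernelMixtureGame.next]
    · have hω' : ¬ ∀ k ≤ t, ENNReal.ofReal (regProcess G lam h V (D ω) k) < c := hω
      simp only [g, if_neg hω']
      simp

end Confidence

/-! ### The sampling noise along the trajectories -/

section Noise

theorem lintegral_exp_integral_sub_le {ι : Type*} [Countable ι] [MeasurableSpace ι]
    [MeasurableSingletonClass ι] (p : PMF ι) {Y : ι → ℝ} {b : ℝ}
    (hY : ∀ i, Y i ∈ Set.Icc (-b) b) (s : ℝ) :
    ∫⁻ i, ENNReal.ofReal (Real.exp (s * (∫ j, Y j ∂p.toMeasure - Y i))) ∂p.toMeasure ≤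
      ENNReal.ofReal (Real.exp (b ^ 2 * s ^ 2 / 2)) := by
  set m := ∫ j, Y j ∂p.toMeasure with hm
  refine (lintegral_exp_mul_le_of_mem_Icc p.toMeasure (measurable_of_countable _)
    (a := m - b) (b := m + b) (fun i => ?_) ?_ s).trans (le_of_eq ?_)
  · have := hY i
    constructor <;> linarith [this.1, this.2]
  · rw [integral_sub (integrable_const _) (integrable_of_mem_Icc p hY)]
    simp [hm]
  · congr 3
    ring

variable {S A 𝓗 Ω : Type*} [NormedAddCommGroup 𝓗] [InnerProductSpace ℝ 𝓗] {H : ℕ} [Fintype A]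

namespace AlgInput

variable (I : AlgInput S A 𝓗 H) (D : Data S A)

/-- The gap between the upper and the lower value function. -/
noncomputable def gapV (t h : ℕ) (s : S) : ℝ := (I.values D t h).1 s - (I.values D t h).2 s

/-- The gap between the optimistic and the pessimistic action-value function. -/
noncomputable def gapQ (t : ℕ) (h : Fin H) (z : S × A × A) : ℝ :=
  I.upperQ D t h z - I.lowerQ D t h z

theorem gapV_mem_Icc (t h : ℕ) (s : S) : I.gapV D t h s ∈ Set.Icc (-(2 * H : ℝ)) (2 * H) := by
  have h1 := I.values_fst_mem_Icc D t h s
  have h2 := I.values_snd_mem_Icc D t h s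
  rw [gapV]
  constructor <;> linarith [h1.1, h1.2, h2.1, h2.2]

theorem gapQ_mem_Icc (t : ℕ) (h : Fin H) (z : S × A × A) :
    I.gapQ D t h z ∈ Set.Icc (-(2 * H : ℝ)) (2 * H) := by
  have h1 := I.upperQ_mem_Icc D t h z
  have h2 := I.lowerQ_mem_Icc D t h z
  rw [gapQ]
  constructor <;> linarith [h1.1, h1.2, h2.1, h2.2]

theorem gapV_eq_jointExp (t : ℕ) (h : Fin H) (s : S) :
    I.gapV D t h s = jointExp (I.cce D t h s) fun p => I.gapQ D t h (s, p) := by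
  rw [gapV, values_eq]
  simp only [jointExp, gapQ, mul_sub, Finset.sum_sub_distrib]

theorem gapV_congr {D D' : Data S A} {t : ℕ} (hD : Data.EqBefore H D D' t 0) (h : ℕ) :
    I.gapV D t h = I.gapV D' t h := by
  funext s
  rw [gapV, gapV, I.values_congr t hD]

theorem gapQ_congr {D D' : Data S A} {t : ℕ} (hD : Data.EqBefore H D D' t 0) (h : Fin H) :
    I.gapQ D t h = I.gapQ D' t h := by
  funext z
  rw [gapQ, gapQ, I.upperQ_congr hD, I.lowerQ_congr hD]

/-- The error made by sampling the actions at step `h` of episode `t`. -/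
noncomputable def actNoise (t : ℕ) (h : Fin H) : ℝ :=
  I.gapV D t h (D.x t h) - I.gapQ D t h (D.z t h)

end AlgInput

variable [MeasurableSpace S] (G : KernelMixtureGame S A 𝓗 H) (I : AlgInput S A 𝓗 H)

/-- The error made by sampling the next state at step `h` of episode `t`. -/
noncomputable def transNoise (D : Data S A) (t : ℕ) (h : Fin H) : ℝ :=
  G.next h (I.gapV D t (h + 1)) (D.z t h) - I.gapV D t (h + 1) (D.x t (h + 1))

/-- The sampling error of step `h` of episode `t`, extended by `0` to `h ≥ H`. -/
noncomputable def stepNoise (D : Data S A) (t h : ℕ) : ℝ :=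
  if hh : h < H then I.actNoise D t ⟨h, hh⟩ + transNoise G I D t ⟨h, hh⟩ else 0

/-- The sampling error accumulated before step `h` of episode `t`. -/
noncomputable def sumNoise (D : Data S A) (t h : ℕ) : ℝ :=
  ∑ τ ∈ Finset.range t, ∑ k ∈ Finset.range H, stepNoise G I D τ k +
    ∑ k ∈ Finset.range h, stepNoise G I D t k

variable {G I}

theorem stepNoise_congr {D D' : Data S A} {t h : ℕ} (hD : Data.EqBefore H D D' t h) {τ k : ℕ}
    (hk : (τ < t ∧ k < H) ∨ (τ = t ∧ k < h)) : stepNoise G I D τ k = stepNoise G I D' τ k := by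
  by_cases hkH : k < H
  · have hD0 : Data.EqBefore H D D' τ 0 := by
      rcases hk with ⟨hτ, _⟩ | ⟨rfl, _⟩
      · exact hD.mono_episode hτ (Nat.zero_le _)
      · exact hD.mono_step (Nat.zero_le _)
    have hz : D.z τ k = D'.z τ k := by
      rcases hk with ⟨hτ, _⟩ | ⟨rfl, hkh⟩
      · exact hD.z_eq hτ hkH
      · exact hD.z_eq_step hkh
    have hx : D.x τ k = D'.x τ k := hD.1 _ _ (by omega)
    have hx' : D.x τ (k + 1) = D'.x τ (k + 1) := hD.1 _ _ (by omega)
    rw [stepNoise, stepNoise, dif_pos hkH, dif_pos hkH]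
    simp only [AlgInput.actNoise, transNoise, I.gapV_congr hD0, I.gapQ_congr hD0, hz, hx, hx']
  · rw [stepNoise, stepNoise, dif_neg hkH, dif_neg hkH]

theorem sumNoise_congr {D D' : Data S A} {t h : ℕ} (hD : Data.EqBefore H D D' t h) :
    sumNoise G I D t h = sumNoise G I D' t h := by
  rw [sumNoise, sumNoise]
  congr 1
  · refine Finset.sum_congr rfl fun τ hτ => Finset.sum_congr rfl fun k hk => ?_
    exact stepNoise_congr hD (Or.inl ⟨Finset.mem_range.1 hτ, Finset.mem_range.1 hk⟩)
  · exact Finset.sum_congr rfl fun k hk =>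
      stepNoise_congr hD (Or.inr ⟨rfl, Finset.mem_range.1 hk⟩)

variable [Countable S] [MeasurableSingletonClass S] [MeasurableSpace A]
  [MeasurableSingletonClass A] [Nonempty S] [Nonempty A] [MeasurableSpace Ω]
  {μ : Measure Ω} [IsProbabilityMeasure μ] {T : ℕ} {D : Ω → Data S A}

theorem lintegral_exp_sumNoise_succ_le (hrun : IsRun G I T μ D) {t : ℕ} (ht : t < T) (h : Fin H)
    (r : ℝ) : ∫⁻ ω, ENNReal.ofReal (Real.exp (r * sumNoise G I (D ω) t (h + 1))) ∂μ ≤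
      (∫⁻ ω, ENNReal.ofReal (Real.exp (r * sumNoise G I (D ω) t h)) ∂μ) *
        ENNReal.ofReal (Real.exp ((2 * H : ℝ) ^ 2 * r ^ 2 / 2)) ^ 2 := by
  set K := ENNReal.ofReal (Real.exp ((2 * H : ℝ) ^ 2 * r ^ 2 / 2)) with hK
  have hsplit : ∀ D : Data S A, sumNoise G I D t (h + 1) =
      sumNoise G I D t h + I.actNoise D t h + transNoise G I D t h := by
    intro D
    rw [sumNoise, Finset.sum_range_succ, stepNoise, dif_pos h.2, sumNoise]
    ring
  -- First the next state is integrated out, given the actions; then the actions.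
  have htrans : ∫⁻ ω, ENNReal.ofReal (Real.exp (r * sumNoise G I (D ω) t (h + 1))) ∂μ ≤
      ∫⁻ ω, ENNReal.ofReal (Real.exp (r * (sumNoise G I (D ω) t h + I.actNoise (D ω) t h))) *
        K ∂μ := by
    let g : Data S A → S → ℝ≥0∞ := fun D s =>
      ENNReal.ofReal (Real.exp (r * (sumNoise G I D t h + I.actNoise D t h))) *
        ENNReal.ofReal (Real.exp (r * (G.next h (I.gapV D t (h + 1)) (D.z t h) -
          I.gapV D t (h + 1) s)))
    have hgm : ∀ s, Measurable[historyAfter H D t h] fun ω => g (D ω) s := by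
      refine fun s => measurable_historyAfter (g := fun D => g D s) fun D D' hD => ?_
      have hD0 : Data.EqBefore H D D' t 0 := hD.1.mono_step (Nat.zero_le _)
      simp only [g, sumNoise_congr hD.1, AlgInput.actNoise, I.gapV_congr hD0, I.gapQ_congr hD0,
        hD.z_eq, hD.1.x_eq]
    refine le_of_eq_of_le (lintegral_congr fun ω => ?_)
      (lintegral_le_of_condLaw (hrun.historyAfter_le t h) (hrun.measurable_x t (h + 1))
        (κ := fun ω => G.trans h ((D ω).z t h)) (fun s => hrun.trans_law t ht h s) hgm
        fun ω => ?_)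
    · simp only [g]
      rw [← ENNReal.ofReal_mul (Real.exp_pos _).le, ← Real.exp_add, hsplit, ← mul_add]
      rfl
    · simp only [g]
      rw [lintegral_const_mul' _ _ ENNReal.ofReal_ne_top]
      gcongr
      exact lintegral_exp_integral_sub_le (G.trans h ((D ω).z t h))
        (fun s => I.gapV_mem_Icc (D ω) t (h + 1) s) r
  have hact : ∫⁻ ω, ENNReal.ofReal
        (Real.exp (r * (sumNoise G I (D ω) t h + I.actNoise (D ω) t h))) ∂μ ≤
      ∫⁻ ω, ENNReal.ofReal (Real.exp (r * sumNoise G I (D ω) t h)) * K ∂μ := by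
    let g : Data S A → A × A → ℝ≥0∞ := fun D p =>
      ENNReal.ofReal (Real.exp (r * sumNoise G I D t h)) *
        ENNReal.ofReal (Real.exp (r * (I.gapV D t h (D.x t h) - I.gapQ D t h (D.x t h, p))))
    have hgm : ∀ p, Measurable[historyBefore H D t h] fun ω => g (D ω) p := by
      refine fun p => measurable_historyBefore (g := fun D => g D p) fun D D' hD => ?_
      have hD0 : Data.EqBefore H D D' t 0 := hD.mono_step (Nat.zero_le _)
      simp only [g, sumNoise_congr hD, I.gapV_congr hD0, I.gapQ_congr hD0, hD.x_eq]
    have hlaw : ∀ p : A × A, μ[((fun ω => ((D ω).a t h, (D ω).b t h)) ⁻¹' {p}).indicator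
          (fun _ => (1 : ℝ)) | historyBefore H D t h] =ᵐ[μ]
        fun ω => (I.cce (D ω) t h ((D ω).x t h) p).toReal := by
      rintro ⟨i, j⟩
      have e : (fun ω => ((D ω).a t h, (D ω).b t h)) ⁻¹' {(i, j)} =
          {ω | (D ω).a t h = i ∧ (D ω).b t h = j} := by
        ext ω; simp
      rw [e]
      exact hrun.action_law t ht h i j
    refine le_of_eq_of_le (lintegral_congr fun ω => ?_)
      (lintegral_le_of_condLaw (hrun.historyBefore_le t h)
        ((hrun.measurable_a t h).prodMk (hrun.measurable_b t h))
        (κ := fun ω => I.cce (D ω) t h ((D ω).x t h)) hlaw hgm fun ω => ?_)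
    · simp only [g]
      rw [← ENNReal.ofReal_mul (Real.exp_pos _).le, ← Real.exp_add, ← mul_add]
      rfl
    · simp only [g]
      rw [lintegral_const_mul' _ _ ENNReal.ofReal_ne_top]
      gcongr
      have hb := fun p => I.gapQ_mem_Icc (D ω) t h ((D ω).x t h, p)
      have hmean : I.gapV (D ω) t h ((D ω).x t h) =
          ∫ p, I.gapQ (D ω) t h ((D ω).x t h, p)
            ∂(I.cce (D ω) t h ((D ω).x t h)).toMeasure := by
        rw [I.gapV_eq_jointExp, PMF.integral_eq_sum]
        rfl
      rw [hmean]
      exact lintegral_exp_integral_sub_le (I.cce (D ω) t h ((D ω).x t h)) hb r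
  refine htrans.trans ?_
  rw [lintegral_mul_const' _ _ ENNReal.ofReal_ne_top, pow_two K, ← mul_assoc]
  refine mul_le_mul_left ?_ K
  refine hact.trans (le_of_eq ?_)
  rw [lintegral_mul_const' _ _ ENNReal.ofReal_ne_top]

theorem lintegral_exp_sumNoise_le (hrun : IsRun G I T μ D) (r : ℝ) {t : ℕ} (ht : t ≤ T) :
    ∫⁻ ω, ENNReal.ofReal (Real.exp (r * sumNoise G I (D ω) t 0)) ∂μ ≤
      ENNReal.ofReal (Real.exp ((2 * H : ℝ) ^ 2 * r ^ 2 / 2)) ^ (2 * (H * t)) := by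
  set K := ENNReal.ofReal (Real.exp ((2 * H : ℝ) ^ 2 * r ^ 2 / 2)) with hK
  induction t with
  | zero => simp [sumNoise]
  | succ t ih =>
    have hin : ∀ h ≤ H, ∫⁻ ω, ENNReal.ofReal (Real.exp (r * sumNoise G I (D ω) t h)) ∂μ ≤
        K ^ (2 * (H * t) + 2 * h) := by
      intro h
      induction h with
      | zero => exact fun _ => ih (by omega)
      | succ h ihh =>
        intro hh
        refine (lintegral_exp_sumNoise_succ_le hrun (by omega) ⟨h, hh⟩ r).trans ?_
        rw [mul_add, mul_one, ← add_assoc, pow_add]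
        gcongr
        exact ihh (by omega)
    have e : ∀ ω, sumNoise G I (D ω) (t + 1) 0 = sumNoise G I (D ω) t H := by
      intro ω
      rw [sumNoise, sumNoise, Finset.sum_range_succ]
      simp
    simp_rw [e]
    refine (hin H le_rfl).trans (le_of_eq ?_)
    congr 1
    ring

/-- The Azuma-Hoeffding bound for the accumulated sampling error. -/
theorem measure_sumNoise_gt_le (hrun : IsRun G I T μ D) (hH : 0 < H) (hT : 0 < T) {L : ℝ}
    (hL : 0 ≤ L) :
    μ {ω | 4 * √((H : ℝ) ^ 3 * T * L) ≤ sumNoise G I (D ω) T 0} ≤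
      ENNReal.ofReal (Real.exp (-L)) := by
  have hH' : (0 : ℝ) < H := Nat.cast_pos.2 hH
  have hT' : (0 : ℝ) < T := Nat.cast_pos.2 hT
  set Q := √((H : ℝ) ^ 3 * T * L) with hQ
  have hQ2 : Q ^ 2 = (H : ℝ) ^ 3 * T * L := Real.sq_sqrt (by positivity)
  -- The minimizer of `4 H³ T r² - 4 Q r`.
  set r : ℝ := Q / (2 * (H : ℝ) ^ 3 * T) with hr
  have hr0 : 0 ≤ r := by positivity
  have h1 := lintegral_exp_sumNoise_le hrun r (le_refl T)
  have hmeas : AEMeasurable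
      (fun ω => ENNReal.ofReal (Real.exp (r * sumNoise G I (D ω) T 0))) μ :=
    ((measurable_historyBefore (t := T) (h := 0)
      (g := fun D => ENNReal.ofReal (Real.exp (r * sumNoise G I D T 0)))
      fun D D' hD => by simp only [sumNoise_congr hD]).mono
        (hrun.historyBefore_le T 0) le_rfl).aemeasurable
  have h2 := mul_meas_ge_le_lintegral₀ hmeas (ENNReal.ofReal (Real.exp (r * (4 * Q))))
  have h3 : {ω | 4 * Q ≤ sumNoise G I (D ω) T 0} ⊆
      {ω | ENNReal.ofReal (Real.exp (r * (4 * Q))) ≤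
        ENNReal.ofReal (Real.exp (r * sumNoise G I (D ω) T 0))} := fun ω hω =>
    ENNReal.ofReal_le_ofReal (Real.exp_le_exp.2 (mul_le_mul_of_nonneg_left hω hr0))
  have h4 : ENNReal.ofReal (Real.exp (r * (4 * Q))) *
      μ {ω | 4 * Q ≤ sumNoise G I (D ω) T 0} ≤
      ENNReal.ofReal (Real.exp ((2 * H : ℝ) ^ 2 * r ^ 2 / 2)) ^ (2 * (H * T)) :=
    (mul_le_mul_right (measure_mono h3) _).trans (h2.trans h1)
  rw [← ENNReal.ofReal_pow (Real.exp_pos _).le, ← Real.exp_nat_mul] at h4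
  have e1 : ENNReal.ofReal (Real.exp (-(r * (4 * Q)))) *
      ENNReal.ofReal (Real.exp (r * (4 * Q))) = 1 := by
    rw [← ENNReal.ofReal_mul (Real.exp_pos _).le, ← Real.exp_add]
    simp
  calc μ {ω | 4 * Q ≤ sumNoise G I (D ω) T 0}
      = ENNReal.ofReal (Real.exp (-(r * (4 * Q)))) * (ENNReal.ofReal (Real.exp (r * (4 * Q))) *
          μ {ω | 4 * Q ≤ sumNoise G I (D ω) T 0}) := by rw [← mul_assoc, e1, one_mul]
    _ ≤ _ := mul_le_mul_right h4 _
    _ = ENNReal.ofReal (Real.exp (-L)) := by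
      rw [← ENNReal.ofReal_mul (Real.exp_pos _).le, ← Real.exp_add]
      congr 2
      have e2 : r * Q = L / 2 := by
        rw [hr, div_mul_eq_mul_div, ← pow_two, hQ2]
        field_simp
      have e3 : (H : ℝ) ^ 3 * T * r ^ 2 = L / 4 := by
        rw [hr, div_pow, hQ2]
        field_simp
        norm_num
      push_cast
      linear_combination (-4 : ℝ) * e2 + 4 * e3

end Noise

/-! ### Optimism and the decomposition of the regret -/

section Extremes

variable {𝓗 : Type*} [NormedAddCommGroup 𝓗] [InnerProductSpace ℝ 𝓗] {lam β : ℝ} {n : ℕ}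
  {f : ℕ → 𝓗} {y : ℕ → ℝ} {θ : 𝓗}

theorem sSup_confRegion_mem_Icc (hlam : 0 < lam) (hβ : 0 ≤ β) (g : 𝓗)
    (hθ : θ ∈ confRegion lam β (fun i : Fin n => f i) (fun i : Fin n => y i)) :
    sSup ((fun η => ⟪g, η⟫_ℝ) '' confRegion lam β (fun i : Fin n => f i) (fun i : Fin n => y i)) ∈
      Set.Icc ⟪g, θ⟫_ℝ (⟪g, θ⟫_ℝ + 2 * β * √⟪g, regInv lam f n g⟫_ℝ) := by
  have hb : ∀ v ∈ (fun η => ⟪g, η⟫_ℝ) '' confRegion lam β (fun i : Fin n => f i)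
      (fun i : Fin n => y i), v ≤ ⟪g, θ⟫_ℝ + 2 * β * √⟪g, regInv lam f n g⟫_ℝ := by
    rintro _ ⟨η, hη, rfl⟩
    have := (abs_le.1 (abs_inner_sub_le_of_mem_confRegion hlam hβ g hη hθ)).2
    simp only
    linarith
  exact ⟨le_csSup ⟨_, hb⟩ ⟨θ, hθ, rfl⟩, csSup_le ⟨_, θ, hθ, rfl⟩ hb⟩

theorem sInf_confRegion_mem_Icc (hlam : 0 < lam) (hβ : 0 ≤ β) (g : 𝓗)
    (hθ : θ ∈ confRegion lam β (fun i : Fin n => f i) (fun i : Fin n => y i)) :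
    sInf ((fun η => ⟪g, η⟫_ℝ) '' confRegion lam β (fun i : Fin n => f i) (fun i : Fin n => y i)) ∈
      Set.Icc (⟪g, θ⟫_ℝ - 2 * β * √⟪g, regInv lam f n g⟫_ℝ) ⟪g, θ⟫_ℝ := by
  have hb : ∀ v ∈ (fun η => ⟪g, η⟫_ℝ) '' confRegion lam β (fun i : Fin n => f i)
      (fun i : Fin n => y i), ⟪g, θ⟫_ℝ - 2 * β * √⟪g, regInv lam f n g⟫_ℝ ≤ v := by
    rintro _ ⟨η, hη, rfl⟩
    have := (abs_le.1 (abs_inner_sub_le_of_mem_confRegion hlam hβ g hη hθ)).1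
    simp only
    linarith
  exact ⟨le_csInf ⟨_, θ, hθ, rfl⟩ hb, csInf_le ⟨_, hb⟩ ⟨θ, hθ, rfl⟩⟩

end Extremes

section Optimism

variable {S A 𝓗 : Type*} [NormedAddCommGroup 𝓗] [InnerProductSpace ℝ 𝓗] {H : ℕ} [Fintype A]

/-- The event that in episode `t` all confidence regions contain the true parameters. -/
def RegionsContain (G : KernelMixtureGame S A 𝓗 H) (I : AlgInput S A 𝓗 H) (D : Data S A)
    (t : ℕ) : Prop :=
  ∀ h : Fin H, G.θ h ∈ I.region D t h (fun τ : Fin t => (I.values D τ (h + 1)).1) ∧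
    G.θ h ∈ I.region D t h (fun τ : Fin t => (I.values D τ (h + 1)).2)

/-- The widths at step `h` of the features that belong to the upper value functions. -/
noncomputable def upperWidth (I : AlgInput S A 𝓗 H) (D : Data S A) (h t : ℕ) : ℝ :=
  width I.lam (fun i => phiV I.φ (I.values D i (h + 1)).1 (D.z i h)) t

/-- The widths at step `h` of the features that belong to the lower value functions. -/
noncomputable def lowerWidth (I : AlgInput S A 𝓗 H) (D : Data S A) (h t : ℕ) : ℝ :=
  width I.lam (fun i => phiV I.φ (I.values D i (h + 1)).2 (D.z i h)) t

variable [MeasurableSpace S] [Countable S] [MeasurableSingletonClass S]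
  {G : KernelMixtureGame S A 𝓗 H}
  {findCCE : (S × A × A → ℝ) → (S × A × A → ℝ) → S → PMF (A × A)} {lam β : ℝ} {D : Data S A}
  {t : ℕ}

theorem sSup_region_mem_Icc (hlam : 0 < lam) (hβ : 0 ≤ β)
    (hgood : RegionsContain G (G.algInput findCCE lam β) D t) (h : Fin H) (z : S × A × A) :
    sSup ((fun θ => ⟪phiV G.φ ((G.algInput findCCE lam β).values D t (h + 1)).1 z, θ⟫_ℝ) ''
      (G.algInput findCCE lam β).region D t h
        (fun τ : Fin t => ((G.algInput findCCE lam β).values D τ (h + 1)).1)) ∈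
      Set.Icc (G.next h ((G.algInput findCCE lam β).values D t (h + 1)).1 z)
        (G.next h ((G.algInput findCCE lam β).values D t (h + 1)).1 z + 2 * β *
          √⟪phiV G.φ ((G.algInput findCCE lam β).values D t (h + 1)).1 z, regInv lam
            (fun i => phiV G.φ ((G.algInput findCCE lam β).values D i (h + 1)).1 (D.z i h)) t
            (phiV G.φ ((G.algInput findCCE lam β).values D t (h + 1)).1 z)⟫_ℝ) := by
  rw [← G.inner_phiV (Nat.cast_pos.2 h.pos)
    ((G.algInput findCCE lam β).values_fst_mem_Icc D t (h + 1))]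
  exact sSup_confRegion_mem_Icc
    (f := fun i => phiV G.φ ((G.algInput findCCE lam β).values D i (h + 1)).1 (D.z i h))
    (y := fun i => ((G.algInput findCCE lam β).values D i (h + 1)).1 (D.x i (h + 1)))
    hlam hβ _ (hgood h).1

theorem sInf_region_mem_Icc (hlam : 0 < lam) (hβ : 0 ≤ β)
    (hgood : RegionsContain G (G.algInput findCCE lam β) D t) (h : Fin H) (z : S × A × A) :
    sInf ((fun θ => ⟪phiV G.φ ((G.algInput findCCE lam β).values D t (h + 1)).2 z, θ⟫_ℝ) ''
      (G.algInput findCCE lam β).region D t h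
        (fun τ : Fin t => ((G.algInput findCCE lam β).values D τ (h + 1)).2)) ∈
      Set.Icc (G.next h ((G.algInput findCCE lam β).values D t (h + 1)).2 z - 2 * β *
          √⟪phiV G.φ ((G.algInput findCCE lam β).values D t (h + 1)).2 z, regInv lam
            (fun i => phiV G.φ ((G.algInput findCCE lam β).values D i (h + 1)).2 (D.z i h)) t
            (phiV G.φ ((G.algInput findCCE lam β).values D t (h + 1)).2 z)⟫_ℝ)
        (G.next h ((G.algInput findCCE lam β).values D t (h + 1)).2 z) := by
  rw [← G.inner_phiV (Nat.cast_pos.2 h.pos)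
    ((G.algInput findCCE lam β).values_snd_mem_Icc D t (h + 1))]
  exact sInf_confRegion_mem_Icc
    (f := fun i => phiV G.φ ((G.algInput findCCE lam β).values D i (h + 1)).2 (D.z i h))
    (y := fun i => ((G.algInput findCCE lam β).values D i (h + 1)).2 (D.x i (h + 1)))
    hlam hβ _ (hgood h).2

/-- Optimism: the upper value function dominates the value of every response to `ν^t`. -/
theorem value_le_values_fst (hlam : 0 < lam) (hβ : 0 ≤ β) (hcce : IsCCEFinder findCCE)
    (hgood : RegionsContain G (G.algInput findCCE lam β) D t) (π : Policy S A H) {h : ℕ}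
    (hh : h ≤ H) (x : S) :
    G.value π ((G.algInput findCCE lam β).policyMin D t) h x ≤
      ((G.algInput findCCE lam β).values D t h).1 x := by
  set I := G.algInput findCCE lam β with hI
  obtain ⟨n, hn⟩ := Nat.exists_eq_add_of_le hh
  induction n generalizing h x with
  | zero => rw [G.value_of_le _ _ (by omega), I.values_of_le _ _ (by omega)]; rfl
  | succ n ih =>
    have hlt : h < H := by omega
    have hQ : ∀ z, G.reward ⟨h, hlt⟩ z + G.next ⟨h, hlt⟩
        (G.value π (I.policyMin D t) (h + 1)) z ≤ I.upperQ D t ⟨h, hlt⟩ z := by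
      intro z
      have h1 := (sSup_region_mem_Icc hlam hβ hgood ⟨h, hlt⟩ z).1
      have h2 := G.next_mono ⟨h, hlt⟩ (fun s => G.value_mem_Icc_horizon π (I.policyMin D t) (by omega) s)
        (I.values_fst_mem_Icc D t (h + 1)) (fun s => ih (by omega) s (by omega)) z
      refine le_max_of_le_right (le_min ?_ ?_)
      · exact (G.reward_add_next_value_mem_Icc π (I.policyMin D t) ⟨h, hlt⟩ z).2
      · exact add_le_add le_rfl (h2.trans h1)
    have hval := I.values_eq D t ⟨h, hlt⟩
    simp only at hval
    have hbell := G.value_eq π (I.policyMin D t) ⟨h, hlt⟩ x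
    simp only at hbell
    rw [hbell, hval]
    simp only
    calc _ ≤ ∑ a, (π ⟨h, hlt⟩ x a).toReal * ∑ b, (I.policyMin D t ⟨h, hlt⟩ x b).toReal *
          I.upperQ D t ⟨h, hlt⟩ (x, a, b) := by
          gcongr with a _ b _
          exact hQ _
      _ ≤ ∑ a, (π ⟨h, hlt⟩ x a).toReal * jointExp (I.cce D t ⟨h, hlt⟩ x)
          fun p => I.upperQ D t ⟨h, hlt⟩ (x, p) := by
          gcongr with a _
          exact (hcce (I.upperQ D t ⟨h, hlt⟩) (I.lowerQ D t ⟨h, hlt⟩) x).1 a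
      _ = _ := by rw [← Finset.sum_mul, sum_toReal_eq_one, one_mul]

/-- Pessimism: the lower value function is below the value of every response to `π^t`. -/
theorem values_snd_le_value (hlam : 0 < lam) (hβ : 0 ≤ β) (hcce : IsCCEFinder findCCE)
    (hgood : RegionsContain G (G.algInput findCCE lam β) D t) (ν : Policy S A H) {h : ℕ}
    (hh : h ≤ H) (x : S) :
    ((G.algInput findCCE lam β).values D t h).2 x ≤
      G.value ((G.algInput findCCE lam β).policyMax D t) ν h x := by
  set I := G.algInput findCCE lam β with hI
  obtain ⟨n, hn⟩ := Nat.exists_eq_add_of_le hh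
  induction n generalizing h x with
  | zero => rw [G.value_of_le _ _ (by omega), I.values_of_le _ _ (by omega)]; rfl
  | succ n ih =>
    have hlt : h < H := by omega
    have hQ : ∀ z, I.lowerQ D t ⟨h, hlt⟩ z ≤ G.reward ⟨h, hlt⟩ z + G.next ⟨h, hlt⟩
        (G.value (I.policyMax D t) ν (h + 1)) z := by
      intro z
      have h1 := (sInf_region_mem_Icc hlam hβ hgood ⟨h, hlt⟩ z).2
      have h2 := G.next_mono ⟨h, hlt⟩ (I.values_snd_mem_Icc D t (h + 1))
        (fun s => G.value_mem_Icc_horizon (I.policyMax D t) ν (by omega) s) (fun s => ih (by omega) s (by omega)) z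
      refine max_le ?_ (min_le_of_right_le ?_)
      · exact (G.reward_add_next_value_mem_Icc (I.policyMax D t) ν ⟨h, hlt⟩ z).1
      · exact add_le_add le_rfl (h1.trans h2)
    have hval := I.values_eq D t ⟨h, hlt⟩
    simp only at hval
    have hbell := G.value_eq (I.policyMax D t) ν ⟨h, hlt⟩ x
    simp only at hbell
    have hswap : ∀ Q : A → A → ℝ, ∑ a, (I.policyMax D t ⟨h, hlt⟩ x a).toReal *
        ∑ b, (ν ⟨h, hlt⟩ x b).toReal * Q a b = ∑ b, (ν ⟨h, hlt⟩ x b).toReal *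
          ∑ a, (I.policyMax D t ⟨h, hlt⟩ x a).toReal * Q a b := by
      intro Q
      simp only [Finset.mul_sum]
      rw [Finset.sum_comm]
      refine Finset.sum_congr rfl fun b _ => Finset.sum_congr rfl fun a _ => ?_
      ring
    rw [hbell, hval, hswap]
    simp only
    calc _ = ∑ b, (ν ⟨h, hlt⟩ x b).toReal * jointExp (I.cce D t ⟨h, hlt⟩ x)
          fun p => I.lowerQ D t ⟨h, hlt⟩ (x, p) := by
          rw [← Finset.sum_mul, sum_toReal_eq_one, one_mul]
      _ ≤ ∑ b, (ν ⟨h, hlt⟩ x b).toReal * ∑ a, (I.policyMax D t ⟨h, hlt⟩ x a).toReal *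
          I.lowerQ D t ⟨h, hlt⟩ (x, a, b) := by
          gcongr with b _
          exact (hcce (I.upperQ D t ⟨h, hlt⟩) (I.lowerQ D t ⟨h, hlt⟩) x).2 b
      _ ≤ _ := by
          gcongr with b _ a _
          exact hQ _

/-- The width of the confidence regions bounds the one-step growth of the gap. Truncation from the
wrong side is inactive because the upper value function dominates, and the lower value function is
dominated by, the value of an actual pair of policies. -/
theorem gapQ_le (hlam : 0 < lam) (hβH : (H : ℝ) ≤ β) (hcce : IsCCEFinder findCCE)
    (hgood : RegionsContain G (G.algInput findCCE lam β) D t) (h : Fin H) :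
    (G.algInput findCCE lam β).gapQ D t h (D.z t h) ≤
      G.next h ((G.algInput findCCE lam β).gapV D t (h + 1)) (D.z t h) +
        2 * β * (min 1 √(upperWidth (G.algInput findCCE lam β) D h t) +
          min 1 √(lowerWidth (G.algInput findCCE lam β) D h t)) := by
  have hβ : 0 ≤ β := (Nat.cast_nonneg H).trans hβH
  set I := G.algInput findCCE lam β with hI
  set z := D.z t h with hz
  have hu := sSup_region_mem_Icc hlam hβ hgood h z
  have hl := sInf_region_mem_Icc hlam hβ hgood h z
  have hH := (Nat.cast_nonneg H : (0 : ℝ) ≤ H)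
  have hsub : G.next h (I.gapV D t (h + 1)) z =
      G.next h (I.values D t (h + 1)).1 z - G.next h (I.values D t (h + 1)).2 z :=
    G.next_sub h (I.values_fst_mem_Icc D t (h + 1)) (I.values_snd_mem_Icc D t (h + 1)) z
  have hup : I.upperQ D t h z ≤ G.reward h z + G.next h (I.values D t (h + 1)).1 z +
      2 * β * min 1 √(upperWidth I D h t) := by
    have hX : -(H : ℝ) ≤ G.reward h z + G.next h (I.values D t (h + 1)).1 z := by
      refine (G.reward_add_next_value_mem_Icc (I.policyMax D t) (I.policyMin D t) h z).1.trans ?_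
      refine add_le_add le_rfl (G.next_mono h (fun s => G.value_mem_Icc_horizon (I.policyMax D t) (I.policyMin D t) h.2 s)
        (I.values_fst_mem_Icc D t (h + 1)) (fun s => ?_) z)
      exact value_le_values_fst hlam hβ hcce hgood _ h.2 s
    rcases min_cases 1 √(upperWidth I D h t) with ⟨he, _⟩ | ⟨he, _⟩
    · rw [he]
      have := (I.upperQ_mem_Icc D t h z).2
      linarith
    · rw [he]
      have h0 : 0 ≤ 2 * β * √(upperWidth I D h t) := by positivity
      refine max_le (by linarith) (min_le_of_right_le ?_)
      have h1 : sSup ((fun θ => ⟪phiV I.φ (I.values D t (h + 1)).1 z, θ⟫_ℝ) ''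
          I.region D t h (fun τ : Fin t => (I.values D τ (h + 1)).1)) ≤
          G.next h (I.values D t (h + 1)).1 z + 2 * β * √(upperWidth I D h t) := hu.2
      have h2 : I.reward h z = G.reward h z := rfl
      linarith
  have hlo : G.reward h z + G.next h (I.values D t (h + 1)).2 z -
      2 * β * min 1 √(lowerWidth I D h t) ≤ I.lowerQ D t h z := by
    have hX : G.reward h z + G.next h (I.values D t (h + 1)).2 z ≤ H := by
      refine le_trans ?_
        (G.reward_add_next_value_mem_Icc (I.policyMax D t) (I.policyMin D t) h z).2
      refine add_le_add le_rfl (G.next_mono h (I.values_snd_mem_Icc D t (h + 1))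
        (fun s => G.value_mem_Icc_horizon (I.policyMax D t) (I.policyMin D t) h.2 s) (fun s => ?_) z)
      exact values_snd_le_value hlam hβ hcce hgood _ h.2 s
    rcases min_cases 1 √(lowerWidth I D h t) with ⟨he, _⟩ | ⟨he, _⟩
    · rw [he]
      have := (I.lowerQ_mem_Icc D t h z).1
      linarith
    · rw [he]
      have h0 : 0 ≤ 2 * β * √(lowerWidth I D h t) := by positivity
      refine le_max_of_le_right (le_min (by linarith) ?_)
      have h1 : G.next h (I.values D t (h + 1)).2 z - 2 * β * √(lowerWidth I D h t) ≤
          sInf ((fun θ => ⟪phiV I.φ (I.values D t (h + 1)).2 z, θ⟫_ℝ) ''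
          I.region D t h (fun τ : Fin t => (I.values D τ (h + 1)).2)) := hl.1
      have h2 : I.reward h z = G.reward h z := rfl
      linarith
  rw [AlgInput.gapQ, hsub]
  linarith

theorem gapV_zero_le (hlam : 0 < lam) (hβH : (H : ℝ) ≤ β) (hcce : IsCCEFinder findCCE)
    (hgood : RegionsContain G (G.algInput findCCE lam β) D t) :
    (G.algInput findCCE lam β).gapV D t 0 (D.x t 0) ≤
      ∑ h ∈ Finset.range H, stepNoise G (G.algInput findCCE lam β) D t h +
        ∑ h ∈ Finset.range H, 2 * β * (min 1 √(upperWidth (G.algInput findCCE lam β) D h t) +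
          min 1 √(lowerWidth (G.algInput findCCE lam β) D h t)) := by
  set I := G.algInput findCCE lam β with hI
  have hk : ∀ k ≤ H, I.gapV D t 0 (D.x t 0) ≤ ∑ h ∈ Finset.range k, stepNoise G I D t h +
      ∑ h ∈ Finset.range k, 2 * β * (min 1 √(upperWidth I D h t) + min 1 √(lowerWidth I D h t)) +
        I.gapV D t k (D.x t k) := by
    intro k
    induction k with
    | zero => simp
    | succ k ih =>
      intro hkH
      have h1 := ih (by omega)
      have h2 := gapQ_le hlam hβH hcce hgood ⟨k, hkH⟩
      have h3 : stepNoise G I D t k =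
          (I.gapV D t k (D.x t k) - I.gapQ D t ⟨k, hkH⟩ (D.z t k)) +
          (G.next ⟨k, hkH⟩ (I.gapV D t (k + 1)) (D.z t k) -
            I.gapV D t (k + 1) (D.x t (k + 1))) := by
        rw [stepNoise, dif_pos (by omega)]
        rfl
      rw [Finset.sum_range_succ, Finset.sum_range_succ]
      simp only at h2
      linarith
  have hend : I.gapV D t H (D.x t H) = 0 := by
    rw [AlgInput.gapV, I.values_of_le _ _ le_rfl]
    simp
  have := hk H le_rfl
  rw [hend] at this
  linarith

/-- On the event that all confidence regions are correct, the regret is at most the sampling error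
plus the total width of the confidence regions. -/
theorem regret_le (hH : 0 < H) (hlam : 0 < lam) (hβH : (H : ℝ) ≤ β)
    (hcce : IsCCEFinder findCCE) {T : ℕ}
    (hgood : ∀ t < T, RegionsContain G (G.algInput findCCE lam β) D t) :
    regret G (G.algInput findCCE lam β) D T ≤
      sumNoise G (G.algInput findCCE lam β) D T 0 +
        8 * (β * H * √(T * effDim G.φ H T lam)) := by
  have hβ : 0 ≤ β := (Nat.cast_nonneg H).trans hβH
  set I := G.algInput findCCE lam β with hI
  have hreg : regret G I D T ≤ ∑ t ∈ Finset.range T, I.gapV D t 0 (D.x t 0) := by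
    refine Finset.sum_le_sum fun t ht => ?_
    have hg := hgood t (Finset.mem_range.1 ht)
    have : Nonempty (Policy S A H) := ⟨I.policyMin D t⟩
    exact sub_le_sub
      (ciSup_le fun π => value_le_values_fst hlam hβ hcce hg π (Nat.zero_le _) _)
      (le_ciInf fun ν => values_snd_le_value hlam hβ hcce hg ν (Nat.zero_le _) _)
  have hsum : ∑ t ∈ Finset.range T, I.gapV D t 0 (D.x t 0) ≤ sumNoise G I D T 0 +
      ∑ t ∈ Finset.range T, ∑ h ∈ Finset.range H,
        2 * β * (min 1 √(upperWidth I D h t) + min 1 √(lowerWidth I D h t)) := by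
    rw [sumNoise, Finset.range_zero, Finset.sum_empty, add_zero, ← Finset.sum_add_distrib]
    exact Finset.sum_le_sum fun t ht =>
      gapV_zero_le hlam hβH hcce (hgood t (Finset.mem_range.1 ht))
  have hpot : ∀ h, ∑ t ∈ Finset.range T,
      2 * β * (min 1 √(upperWidth I D h t) + min 1 √(lowerWidth I D h t)) ≤
        8 * (β * √(T * effDim G.φ H T lam)) := by
    intro h
    have h1 := G.sum_log_one_add_width_le hH hlam T
      (fun i => I.values_fst_mem_Icc D i (h + 1)) (fun i => D.z i h)
    have h2 := G.sum_log_one_add_width_le hH hlam T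
      (fun i => I.values_snd_mem_Icc D i (h + 1)) (fun i => D.z i h)
    have hsq : ∀ s : ℝ, s ≤ 2 * effDim G.φ H T lam →
        √(T * (2 * s)) ≤ 2 * √(T * effDim G.φ H T lam) := by
      intro s hs
      rw [show (2 : ℝ) * √(T * effDim G.φ H T lam) = √(2 ^ 2 * (T * effDim G.φ H T lam)) by
        rw [Real.sqrt_mul (by norm_num) (T * effDim G.φ H T lam), Real.sqrt_sq (by norm_num)]]
      refine Real.sqrt_le_sqrt ?_
      have : (T : ℝ) * (2 * s) ≤ T * (2 * (2 * effDim G.φ H T lam)) := by gcongr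
      linarith
    have h3 := (sum_min_one_sqrt_width_le
      (f := fun i => phiV G.φ (I.values D i (h + 1)).1 (D.z i h)) hlam T).trans (hsq _ h1)
    have h4 := (sum_min_one_sqrt_width_le
      (f := fun i => phiV G.φ (I.values D i (h + 1)).2 (D.z i h)) hlam T).trans (hsq _ h2)
    have h5 : ∑ t ∈ Finset.range T, min 1 √(upperWidth I D h t) ≤
        2 * √(T * effDim G.φ H T lam) := h3
    have h6 : ∑ t ∈ Finset.range T, min 1 √(lowerWidth I D h t) ≤
        2 * √(T * effDim G.φ H T lam) := h4
    rw [← Finset.mul_sum, Finset.sum_add_distrib]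
    have := mul_le_mul_of_nonneg_left (add_le_add h5 h6) (by positivity : 0 ≤ 2 * β)
    linarith
  refine hreg.trans (hsum.trans (add_le_add le_rfl ?_))
  rw [Finset.sum_comm]
  refine (Finset.sum_le_sum fun h _ => hpot h).trans (le_of_eq ?_)
  rw [Finset.sum_const, Finset.card_range, nsmul_eq_mul]
  ring

end Optimism

/-! ### The regret bound -/

section Final

variable {S A 𝓗 Ω : Type*} [NormedAddCommGroup 𝓗] [InnerProductSpace ℝ 𝓗] {H T : ℕ}

theorem regret_le_trivial [Fintype A] (hH : 0 < H) (G : KernelMixtureGame S A 𝓗 H)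
    (I : AlgInput S A 𝓗 H) (D : Data S A) (T : ℕ) : regret G I D T ≤ 2 * H * T := by
  have : ∀ t ∈ Finset.range T, G.valueBestMax (I.policyMin D t) 0 (D.x t 0) -
      G.valueBestMin (I.policyMax D t) 0 (D.x t 0) ≤ 2 * H := by
    intro t _
    have : Nonempty (Policy S A H) := ⟨I.policyMin D t⟩
    have h1 : G.valueBestMax (I.policyMin D t) 0 (D.x t 0) ≤ H :=
      ciSup_le fun π => (G.value_mem_Icc_horizon π _ hH.le _).2
    have h2 : -(H : ℝ) ≤ G.valueBestMin (I.policyMax D t) 0 (D.x t 0) :=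
      le_ciInf fun ν => (G.value_mem_Icc_horizon _ ν hH.le _).1
    linarith
  refine (Finset.sum_le_sum this).trans (le_of_eq ?_)
  rw [Finset.sum_const, Finset.card_range, nsmul_eq_mul]
  ring

/-- The admissible `β` covers the radius that the self-normalized bound needs at the confidence
level `δ / (4 H)`; for `H = 1` the missing constant is supplied by `1 ≤ λ B²`. -/
theorem two_log_add_le {lam β B δ Γ : ℝ} (hH : 0 < H) (hδ : 0 < δ) (hδ1 : δ < 1)
    (hlam : 1 ≤ lam) (hB : 1 ≤ B)
    (hβ : 2 * Γ + 2 + 4 * Real.log (H / δ) + 2 * lam * (B / H) ^ 2 ≤ (β / H) ^ 2) :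
    (H : ℝ) ^ 2 * (2 * Real.log (4 * H / δ) + 2 * Γ) + lam * B ^ 2 ≤ β ^ 2 := by
  have hH' : (0 : ℝ) < H := Nat.cast_pos.2 hH
  have hH1 : (1 : ℝ) ≤ H := by exact_mod_cast hH
  have hlog : Real.log (4 * H / δ) = 2 * Real.log 2 + Real.log (H / δ) := by
    rw [mul_div_assoc, Real.log_mul (by norm_num) (by positivity),
      show (4 : ℝ) = 2 ^ 2 by norm_num, Real.log_pow]
    norm_num
  have hl2 := Real.log_two_lt_d9
  have hsplit : Real.log (H / δ) = Real.log H - Real.log δ := Real.log_div hH'.ne' hδ.ne'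
  have hδlog : Real.log δ < 0 := Real.log_neg hδ hδ1
  have hkey : 4 * Real.log 2 ≤ 2 + 2 * Real.log (H / δ) + lam * (B / H) ^ 2 := by
    rcases Nat.lt_or_ge H 2 with h | h
    · obtain rfl : H = 1 := by omega
      have : 1 ≤ lam * B ^ 2 := one_le_mul_of_one_le_of_one_le hlam (one_le_pow₀ hB)
      rw [hsplit]
      simp only [Nat.cast_one, Real.log_one, div_one]
      linarith
    · have h2 : Real.log 2 ≤ Real.log H := Real.log_le_log (by norm_num) (by exact_mod_cast h)
      have h3 : 0 ≤ lam * (B / H) ^ 2 := by positivity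
      rw [hsplit]
      linarith
  have hmul : (H : ℝ) ^ 2 * (2 * Real.log (4 * H / δ) + 2 * Γ + lam * (B / H) ^ 2) ≤
      (H : ℝ) ^ 2 * (β / H) ^ 2 := by
    refine mul_le_mul_of_nonneg_left ?_ (by positivity)
    rw [hlog]
    linarith
  have e1 : (H : ℝ) ^ 2 * (β / H) ^ 2 = β ^ 2 := by field_simp
  have e2 : (H : ℝ) ^ 2 * (2 * Real.log (4 * H / δ) + 2 * Γ + lam * (B / H) ^ 2) =
      (H : ℝ) ^ 2 * (2 * Real.log (4 * H / δ) + 2 * Γ) + lam * B ^ 2 := by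
    field_simp
  rw [e1, e2] at hmul
  exact hmul

variable [MeasurableSpace S] [Countable S] [MeasurableSingletonClass S]
  {G : KernelMixtureGame S A 𝓗 H}
  {findCCE : (S × A × A → ℝ) → (S × A × A → ℝ) → S → PMF (A × A)} {lam β B δ : ℝ}

/-- As long as the exponential process of a regression is below `4 H / δ`, its confidence region
contains the true parameter. -/
theorem theta_mem_region [Nonempty S] [Nonempty A] (hH : 0 < H) (hδ : 0 < δ) (hδ1 : δ < 1)
    (hβ0 : 0 < β)
    (hB : ∀ h, ‖G.θ h‖ ≤ B) (hlam : 1 ≤ lam)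
    (hβ : 2 * effDim G.φ H T lam + 2 + 4 * Real.log (H / δ) + 2 * lam * (B / H) ^ 2 ≤
      (β / H) ^ 2) (h : Fin H) {V : Data S A → ℕ → S → ℝ}
    (hV : ∀ D τ s, V D τ s ∈ Set.Icc (-(H : ℝ)) H) {D : Data S A} {t : ℕ} (ht : t < T)
    (hproc : ENNReal.ofReal (regProcess G lam h V D t) < ENNReal.ofReal (4 * H / δ)) :
    G.θ h ∈ (G.algInput findCCE lam β).region D t h (fun τ : Fin t => V D τ) := by
  have hH' : (0 : ℝ) < H := Nat.cast_pos.2 hH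
  have hlam0 : 0 < lam := by linarith
  have hB1 := G.one_le_of_norm_theta_le hH hB
  have hle : regProcess G lam h V D t ≤ 4 * H / δ :=
    ((ENNReal.ofReal_lt_ofReal_iff (by positivity)).1 hproc).le
  refine mem_confRegion_of_mixProcess_le (f := regFeature G h V D)
    (ε := fun τ => regNoise G h V D τ (D.x τ (h + 1))) (y := fun τ => V D τ (D.x τ (h + 1)))
    hlam0 hH' hβ0.le (fun i => ?_) hle ?_
  · simp only [regNoise, regFeature]
    rw [G.inner_phiV hH' (hV D i)]
    field_simp
    ring
  · have h1 := G.sum_log_one_add_width_le hH hlam0 T (hV D) (fun i => D.z i h)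
    have h2 : ∑ i ∈ Finset.range t, Real.log (1 + width lam (regFeature G h V D) i) ≤
        ∑ i ∈ Finset.range T, Real.log (1 + width lam (regFeature G h V D) i) :=
      Finset.sum_le_sum_of_subset_of_nonneg (Finset.range_mono ht.le) fun i _ _ =>
        Real.log_nonneg (le_add_of_nonneg_right (width_nonneg hlam0))
    have h3 := two_log_add_le hH hδ hδ1 hlam hB1 hβ
    refine le_trans (add_le_add (mul_le_mul_of_nonneg_left (add_le_add le_rfl (h2.trans h1))
      (sq_nonneg _)) ?_) h3
    have := hB h
    gcongr

variable [Fintype A] [MeasurableSpace A] [MeasurableSingletonClass A] [MeasurableSpace Ω]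
  {μ : Measure Ω} [IsProbabilityMeasure μ] {D : Ω → Data S A}

/-- The regret bound with the contribution of the sampling noise kept explicit. -/
theorem measure_regret_le [Nonempty S] [Nonempty A] (hH : 0 < H) (hT : 0 < T) (hδ : 0 < δ)
    (hδ1 : δ < 1) (hβ0 : 0 < β) (hB : ∀ h, ‖G.θ h‖ ≤ B) (hlam : 1 ≤ lam)
    (hβ : 2 * effDim G.φ H T lam + 2 + 4 * Real.log (H / δ) + 2 * lam * (B / H) ^ 2 ≤
      (β / H) ^ 2)
    (hcce : IsCCEFinder findCCE) (hrun : IsRun G (G.algInput findCCE lam β) T μ D) :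
    ENNReal.ofReal (1 - δ) ≤ μ {ω | regret G (G.algInput findCCE lam β) (D ω) T ≤
      4 * √((H : ℝ) ^ 3 * T * Real.log (2 / δ)) + 8 * (β * H * √(T * effDim G.φ H T lam))} := by
  have hH' : (0 : ℝ) < H := Nat.cast_pos.2 hH
  have hH1 : (1 : ℝ) ≤ H := by exact_mod_cast hH
  have hlam0 : 0 < lam := by linarith
  have hΓ := G.effDim_nonneg hH hlam0 T
  have hβH : (H : ℝ) ≤ β := by
    have h1 : 0 ≤ Real.log (H / δ) := Real.log_nonneg (by rw [le_div_iff₀ hδ]; linarith)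
    have h2 : 0 ≤ 2 * lam * (B / H) ^ 2 := by positivity
    have h3 : (1 : ℝ) ^ 2 ≤ (β / H) ^ 2 := by linarith
    have h4 := (pow_le_pow_iff_left₀ (by norm_num) (by positivity) (by norm_num)).1 h3
    rwa [le_div_iff₀ hH', one_mul] at h4
  set I := G.algInput findCCE lam β with hI
  let Vu : Fin H → Data S A → ℕ → S → ℝ := fun h D τ => (I.values D τ (h + 1)).1
  let Vl : Fin H → Data S A → ℕ → S → ℝ := fun h D τ => (I.values D τ (h + 1)).2
  set c : ℝ≥0∞ := ENNReal.ofReal (4 * H / δ) with hc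
  have hc0 : c ≠ 0 := by
    rw [hc, Ne, ENNReal.ofReal_eq_zero, not_le]
    positivity
  let Bad : (Fin H → Data S A → ℕ → S → ℝ) → Fin H → Set Ω := fun V h =>
    {ω | ∃ t ≤ T, c ≤ ENNReal.ofReal (regProcess G lam h (V h) (D ω) t)}
  have hu : ∀ h, μ (Bad Vu h) ≤ c⁻¹ := fun h =>
    measure_exists_regProcess_ge_le hrun hH hlam0 h
      (fun D τ s => I.values_fst_mem_Icc D τ (h + 1) s)
      (fun D D' τ hD => by simp only [I.values_congr τ hD]) hc0 ENNReal.ofReal_ne_top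
  have hl : ∀ h, μ (Bad Vl h) ≤ c⁻¹ := fun h =>
    measure_exists_regProcess_ge_le hrun hH hlam0 h
      (fun D τ s => I.values_snd_mem_Icc D τ (h + 1) s)
      (fun D D' τ hD => by simp only [I.values_congr τ hD]) hc0 ENNReal.ofReal_ne_top
  have hL : 0 ≤ Real.log (2 / δ) := Real.log_nonneg (by rw [le_div_iff₀ hδ]; linarith)
  have hZ := measure_sumNoise_gt_le hrun hH hT hL
  set Z : Set Ω := {ω | 4 * √((H : ℝ) ^ 3 * T * Real.log (2 / δ)) ≤ sumNoise G I (D ω) T 0}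
    with hZdef
  rw [← Real.log_inv, Real.exp_log (by positivity), inv_div] at hZ
  set E : Set Ω := {ω | regret G I (D ω) T ≤
    4 * √((H : ℝ) ^ 3 * T * Real.log (2 / δ)) + 8 * (β * H * √(T * effDim G.φ H T lam))} with hE
  have hcover : Set.univ ⊆ E ∪ (((⋃ h, Bad Vu h) ∪ ⋃ h, Bad Vl h) ∪ Z) := by
    intro ω _
    by_cases hω : ω ∈ ((⋃ h, Bad Vu h) ∪ ⋃ h, Bad Vl h) ∪ Z
    · exact Or.inr hω
    · refine Or.inl ?_
      simp only [Set.mem_union, Set.mem_iUnion, not_or, not_exists] at hω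
      obtain ⟨⟨h1, h2⟩, h3⟩ := hω
      have hgood : ∀ t < T, RegionsContain G I (D ω) t := by
        intro t ht h
        refine ⟨theta_mem_region (V := Vu h) hH hδ hδ1 hβ0 hB hlam hβ h
          (fun D τ s => I.values_fst_mem_Icc D τ (h + 1) s) ht ?_,
          theta_mem_region (V := Vl h) hH hδ hδ1 hβ0 hB hlam hβ h
          (fun D τ s => I.values_snd_mem_Icc D τ (h + 1) s) ht ?_⟩
        · exact lt_of_not_ge fun hge => h1 h ⟨t, ht.le, hge⟩
        · exact lt_of_not_ge fun hge => h2 h ⟨t, ht.le, hge⟩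
      have hreg := regret_le hH hlam0 hβH hcce hgood
      have h4 : sumNoise G I (D ω) T 0 < 4 * √((H : ℝ) ^ 3 * T * Real.log (2 / δ)) :=
        lt_of_not_ge h3
      exact hreg.trans (add_le_add h4.le le_rfl)
  have hunion : ∀ V, (∀ h, μ (Bad V h) ≤ c⁻¹) → μ (⋃ h, Bad V h) ≤ ENNReal.ofReal (δ / 4) := by
    intro V hb
    calc μ (⋃ h, Bad V h) ≤ ∑ h, μ (Bad V h) := measure_iUnion_fintype_le _ _
      _ ≤ ∑ _h : Fin H, c⁻¹ := Finset.sum_le_sum fun h _ => hb h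
      _ = ENNReal.ofReal (δ / 4) := by
        rw [Finset.sum_const, Finset.card_univ, Fintype.card_fin, nsmul_eq_mul, hc,
          ← ENNReal.ofReal_inv_of_pos (by positivity), ← ENNReal.ofReal_natCast,
          ← ENNReal.ofReal_mul hH'.le]
        congr 1
        field_simp
  have htotal : (1 : ℝ≥0∞) ≤ μ E + ENNReal.ofReal δ := by
    calc (1 : ℝ≥0∞) = μ Set.univ := measure_univ.symm
      _ ≤ μ (E ∪ (((⋃ h, Bad Vu h) ∪ ⋃ h, Bad Vl h) ∪ Z)) := measure_mono hcover
      _ ≤ μ E + ((μ (⋃ h, Bad Vu h) + μ (⋃ h, Bad Vl h)) + μ Z) :=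
        (measure_union_le _ _).trans (add_le_add le_rfl ((measure_union_le _ _).trans
          (add_le_add (measure_union_le _ _) le_rfl)))
      _ ≤ μ E + ((ENNReal.ofReal (δ / 4) + ENNReal.ofReal (δ / 4)) + ENNReal.ofReal (δ / 2)) := by
        gcongr
        · exact hunion Vu hu
        · exact hunion Vl hl
      _ = μ E + ENNReal.ofReal δ := by
        rw [← ENNReal.ofReal_add (by positivity) (by positivity),
          ← ENNReal.ofReal_add (by positivity) (by positivity)]
        congr 2
        ring
  rw [ENNReal.ofReal_sub _ hδ.le, ENNReal.ofReal_one]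
  exact tsub_le_iff_right.2 htotal

/-- Absorbing the sampling noise. If the effective dimension is at least `½ log 2`, then the choice
of `β` makes the noise negligible; otherwise `B` is so large that the bound exceeds the trivial
bound `2 H T` on the regret. -/
theorem measure_regret_le_universal (hH : 0 < H) (hT : 0 < T) (hδ : 0 < δ) (hβ0 : 0 < β)
    (hB : ∀ h, ‖G.θ h‖ ≤ B) (hlam : lam = 1 + 1 / (T : ℝ))
    (hβ : 2 * effDim G.φ H T lam + 2 + 4 * Real.log (H / δ) + 2 * lam * (B / H) ^ 2 ≤
      (β / H) ^ 2)
    (hcce : IsCCEFinder findCCE) (hrun : IsRun G (G.algInput findCCE lam β) T μ D) :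
    ENNReal.ofReal (1 - δ) ≤ μ {ω | regret G (G.algInput findCCE lam β) (D ω) T ≤
      16 * (β * H * √(T * effDim G.φ H T lam) + 1)} := by
  rcases le_or_gt 1 δ with hδ1 | hδ1
  · rw [ENNReal.ofReal_of_nonpos (by linarith)]
    exact zero_le
  obtain ⟨ω₀⟩ : Nonempty Ω := μ.nonempty_of_neZero
  have : Nonempty S := ⟨(D ω₀).x 0 0⟩
  have : Nonempty A := ⟨(D ω₀).a 0 0⟩
  have hH' : (0 : ℝ) < H := Nat.cast_pos.2 hH
  have hH1 : (1 : ℝ) ≤ H := by exact_mod_cast hH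
  have hT' : (0 : ℝ) < T := Nat.cast_pos.2 hT
  have hlam1 : 1 ≤ lam := by rw [hlam]; exact le_add_of_nonneg_right (by positivity)
  have hlam0 : 0 < lam := by linarith
  have hB1 := G.one_le_of_norm_theta_le hH hB
  have hΓ := G.effDim_nonneg hH hlam0 T
  have hΓlow := G.log_one_add_le_effDim hH hB hlam0 T
  set Γ := effDim G.φ H T lam with hΓdef
  set x : ℝ := T * (H : ℝ) ^ 2 / (lam * B ^ 2) with hx
  have hx0 : 0 < x := by positivity
  have hlogH : 0 ≤ Real.log (H / δ) := Real.log_nonneg (by rw [le_div_iff₀ hδ]; linarith)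
  have hK : β * H * √(T * Γ) = √(β ^ 2 * H ^ 2 * (T * Γ)) := by
    rw [Real.sqrt_mul (by positivity) (T * Γ), ← mul_pow, Real.sqrt_sq (by positivity)]
  have hβsq : (H : ℝ) ^ 2 * (2 * Γ + 2 + 4 * Real.log (H / δ)) + 2 * lam * B ^ 2 ≤ β ^ 2 := by
    have h1 := mul_le_mul_of_nonneg_left hβ (by positivity : (0 : ℝ) ≤ (H : ℝ) ^ 2)
    have e1 : (H : ℝ) ^ 2 * (β / H) ^ 2 = β ^ 2 := by field_simp
    have e2 : (H : ℝ) ^ 2 * (2 * Γ + 2 + 4 * Real.log (H / δ) + 2 * lam * (B / H) ^ 2) =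
        (H : ℝ) ^ 2 * (2 * Γ + 2 + 4 * Real.log (H / δ)) + 2 * lam * B ^ 2 := by
      field_simp
    rw [e1, e2] at h1
    exact h1
  rcases le_or_gt 1 x with hx1 | hx1
  · refine (measure_regret_le hH hT hδ hδ1 hβ0 hB hlam1 hβ hcce hrun).trans
      (measure_mono fun ω hω => ?_)
    simp only [Set.mem_ofPred_eq] at hω ⊢
    refine hω.trans ?_
    have hΓ2 : Real.log 2 ≤ 2 * Γ :=
      (Real.log_le_log (by norm_num) (by linarith)).trans hΓlow
    have hl2 := Real.log_two_gt_d9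
    have hl2' := Real.log_two_lt_d9
    have hsqrt : √((H : ℝ) ^ 3 * T * Real.log (2 / δ)) ≤ 2 * (β * H * √(T * Γ)) := by
      have h1 : Real.log (2 / δ) ≤ 1 + Real.log (H / δ) := by
        rw [Real.log_div (by norm_num) hδ.ne', Real.log_div hH'.ne' hδ.ne']
        linarith [Real.log_nonneg hH1]
      have h2 : 2 * ((H : ℝ) ^ 2 * Real.log (2 / δ)) ≤ β ^ 2 := by
        refine le_trans ?_ hβsq
        have h3 : (H : ℝ) ^ 2 * (2 * Real.log (2 / δ)) ≤
            (H : ℝ) ^ 2 * (2 * Γ + 2 + 4 * Real.log (H / δ)) := by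
          refine mul_le_mul_of_nonneg_left ?_ (by positivity)
          linarith
        have h4 : 0 ≤ 2 * lam * B ^ 2 := by positivity
        linarith
      have hlog0 : 0 ≤ Real.log (2 / δ) :=
        Real.log_nonneg (by rw [le_div_iff₀ hδ]; linarith)
      rw [hK, show (2 : ℝ) * √(β ^ 2 * H ^ 2 * (T * Γ)) =
        √(2 ^ 2 * (β ^ 2 * H ^ 2 * (T * Γ))) by
          rw [Real.sqrt_mul (by norm_num) (β ^ 2 * H ^ 2 * (T * Γ)),
            Real.sqrt_sq (by norm_num)]]
      refine Real.sqrt_le_sqrt ?_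
      calc (H : ℝ) ^ 3 * T * Real.log (2 / δ)
          ≤ (H : ℝ) ^ 4 * T * Real.log (2 / δ) := by
            gcongr
            norm_num
        _ = ((H : ℝ) ^ 2 * Real.log (2 / δ)) * (H ^ 2 * T) * 1 := by ring
        _ ≤ (β ^ 2 / 2) * (H ^ 2 * T) * (8 * Γ) := by
            gcongr
            · linarith
            · linarith
        _ = 2 ^ 2 * (β ^ 2 * H ^ 2 * (T * Γ)) := by ring
    linarith
  · have huniv : {ω | regret G (G.algInput findCCE lam β) (D ω) T ≤
        16 * (β * H * √(T * Γ) + 1)} = Set.univ := by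
      refine Set.eq_univ_of_forall fun ω => ?_
      refine (regret_le_trivial hH G _ (D ω) T).trans ?_
      have h1 : x / 2 ≤ 2 * Γ := by
        refine le_trans ?_ hΓlow
        refine le_trans ?_ (Real.one_sub_inv_le_log_of_pos (by positivity))
        rw [le_sub_iff_add_le, ← le_sub_iff_add_le']
        rw [inv_le_iff_one_le_mul₀ (by positivity)]
        nlinarith
      have h2 : (T : ℝ) * H ^ 2 ≤ 2 * (β ^ 2 * Γ) := by
        have h3 : 2 * lam * B ^ 2 ≤ β ^ 2 := le_trans (le_add_of_nonneg_left (by positivity)) hβsq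
        have h4 : lam * B ^ 2 * x = T * (H : ℝ) ^ 2 := by rw [hx]; field_simp
        calc (T : ℝ) * H ^ 2 = 2 * lam * B ^ 2 * (x / 2) := by rw [← h4]; ring
          _ ≤ β ^ 2 * (2 * Γ) := by gcongr
          _ = 2 * (β ^ 2 * Γ) := by ring
      have h5 : (T : ℝ) * H ≤ 2 * (β * H * √(T * Γ)) := by
        rw [hK, show (2 : ℝ) * √(β ^ 2 * H ^ 2 * (T * Γ)) =
          √(2 ^ 2 * (β ^ 2 * H ^ 2 * (T * Γ))) by
            rw [Real.sqrt_mul (by norm_num) (β ^ 2 * H ^ 2 * (T * Γ)),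
              Real.sqrt_sq (by norm_num)]]
        refine Real.le_sqrt_of_sq_le ?_
        calc ((T : ℝ) * H) ^ 2 = (T * H ^ 2) * T * 1 := by ring
          _ ≤ (2 * (β ^ 2 * Γ)) * T * (H ^ 2) := by
            gcongr
            exact one_le_pow₀ hH1
          _ ≤ 2 ^ 2 * (β ^ 2 * H ^ 2 * (T * Γ)) := by
            have : 0 ≤ β ^ 2 * H ^ 2 * (T * Γ) := by positivity
            linarith
      have h6 : 0 ≤ β * H * √(T * Γ) := by positivity
      linarith
    rw [huniv, measure_univ]
    exact ENNReal.ofReal_le_one.2 (by linarith)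

/-- For the smallest admissible `β` and bounded `B` the effective dimension is bounded away from
`0`, and the bound is of the order `Γ H² √T √(1 + log (H / δ))`. -/
theorem mul_sqrt_add_one_le {Γ g : ℝ} (hH : 0 < H) (hT : 0 < T) (hδ : 0 < δ) (hδ1 : δ < 1)
    (hlam : lam ≤ 2) (hg : 0 < g) (hgΓ : g ≤ Γ) (hβ0 : 0 < β)
    (hβ : (β / H) ^ 2 = 2 * Γ + 2 + 4 * Real.log (H / δ) + 2 * lam * (B / H) ^ 2) :
    β * H * √(T * Γ) + 1 ≤ (2 + (4 + 4 * B ^ 2) / g + 1 / g) *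
      (Γ * (H : ℝ) ^ 2 * √T * √(1 + Real.log (H / δ))) := by
  have hH' : (0 : ℝ) < H := Nat.cast_pos.2 hH
  have hH1 : (1 : ℝ) ≤ H := by exact_mod_cast hH
  have hT1 : (1 : ℝ) ≤ T := by exact_mod_cast hT
  have hΓ : 0 < Γ := hg.trans_le hgΓ
  have hlogH : 0 ≤ Real.log (H / δ) := Real.log_nonneg (by rw [le_div_iff₀ hδ]; linarith)
  set L := Real.log (H / δ) with hL
  set R : ℝ := Γ * (H : ℝ) ^ 2 * √T * √(1 + L) with hR
  have hR0 : 0 ≤ R := by positivity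
  set k : ℝ := 2 + (4 + 4 * B ^ 2) / g with hk
  have hk1 : 1 ≤ k := by
    have : 0 ≤ (4 + 4 * B ^ 2) / g := by positivity
    linarith
  have hΓg : 1 ≤ Γ / g := (one_le_div hg).2 hgΓ
  have hβle : β ^ 2 ≤ (H : ℝ) ^ 2 * (k * (Γ * (1 + L))) := by
    have e1 : β ^ 2 = (H : ℝ) ^ 2 * (β / H) ^ 2 := by field_simp
    rw [e1, hβ]
    refine mul_le_mul_of_nonneg_left ?_ (by positivity)
    have h1 : (B / H) ^ 2 ≤ B ^ 2 := by
      rw [div_pow]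
      exact div_le_self (sq_nonneg _) (one_le_pow₀ hH1)
    have h2 : 2 * lam * (B / H) ^ 2 ≤ 4 * B ^ 2 := by
      calc 2 * lam * (B / H) ^ 2 ≤ 2 * 2 * (B / H) ^ 2 := by gcongr
        _ ≤ 4 * B ^ 2 := by linarith
    have h3 : (4 + 4 * B ^ 2) * (1 + L) * 1 ≤ (4 + 4 * B ^ 2) * (1 + L) * (Γ / g) := by gcongr
    have h4 : 0 ≤ B ^ 2 * L := by positivity
    have h5 : 0 ≤ Γ * L := by positivity
    calc 2 * Γ + 2 + 4 * L + 2 * lam * (B / H) ^ 2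
        ≤ 2 * (Γ * (1 + L)) + (4 + 4 * B ^ 2) * (1 + L) * 1 := by linarith
      _ ≤ 2 * (Γ * (1 + L)) + (4 + 4 * B ^ 2) * (1 + L) * (Γ / g) := by linarith
      _ = k * (Γ * (1 + L)) := by rw [hk]; ring
  have h1 : β * H * √(T * Γ) ≤ k * R := by
    refine le_of_sq_le_sq ?_ (by positivity)
    have e : (β * H * √(T * Γ)) ^ 2 = β ^ 2 * (H ^ 2 * (T * Γ)) := by
      rw [mul_pow, mul_pow, Real.sq_sqrt (by positivity)]
      ring
    have e' : (k * R) ^ 2 = k ^ 2 * (Γ ^ 2 * H ^ 4 * T * (1 + L)) := by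
      rw [hR, mul_pow, mul_pow, mul_pow, mul_pow, Real.sq_sqrt (by positivity),
        Real.sq_sqrt (by positivity)]
      ring
    rw [e, e']
    calc β ^ 2 * (H ^ 2 * (T * Γ)) ≤ (H : ℝ) ^ 2 * (k * (Γ * (1 + L))) * (H ^ 2 * (T * Γ)) := by
          gcongr
      _ = k * (Γ ^ 2 * H ^ 4 * T * (1 + L)) := by ring
      _ ≤ k ^ 2 * (Γ ^ 2 * H ^ 4 * T * (1 + L)) := by
          gcongr
          nlinarith
  have h2 : 1 ≤ 1 / g * R := by
    have h3 : 1 ≤ √(T : ℝ) := Real.one_le_sqrt.2 hT1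
    have h4 : 1 ≤ √(1 + L) := Real.one_le_sqrt.2 (by linarith)
    have h5 : (1 : ℝ) ≤ (H : ℝ) ^ 2 := one_le_pow₀ hH1
    calc (1 : ℝ) = 1 * 1 * 1 * 1 := by norm_num
      _ ≤ Γ / g * (H : ℝ) ^ 2 * √T * √(1 + L) := by gcongr
      _ = 1 / g * R := by rw [hR]; ring
  rw [add_mul]
  exact add_le_add h1 h2

end Final

theorem mainTheorem1 :
    -- the regret bound, with a universal constant
    (∃ C : ℝ, 0 < C ∧
      ∀ (S A 𝓗 Ω : Type*)
        [Countable S] [MeasurableSpace S] [MeasurableSingletonClass S]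
        [Fintype A] [MeasurableSpace A] [MeasurableSingletonClass A]
        [NormedAddCommGroup 𝓗] [InnerProductSpace ℝ 𝓗] [CompleteSpace 𝓗]
        [MeasurableSpace Ω] (μ : Measure Ω) [IsProbabilityMeasure μ]
        (H T : ℕ) (B lam β δ : ℝ) (G : KernelMixtureGame S A 𝓗 H)
        (findCCE : (S × A × A → ℝ) → (S × A × A → ℝ) → S → PMF (A × A))
        (D : Ω → Data S A),
        0 < H → 0 < T → 0 < δ → 0 < β → (∀ h, ‖G.θ h‖ ≤ B) → lam = 1 + 1 / (T : ℝ) →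
        2 * effDim G.φ H T lam + 2 + 4 * Real.log (H / δ) + 2 * lam * (B / H) ^ 2
          ≤ (β / H) ^ 2 →
        IsCCEFinder findCCE → IsRun G (G.algInput findCCE lam β) T μ D →
        ENNReal.ofReal (1 - δ) ≤
          μ {ω | regret G (G.algInput findCCE lam β) (D ω) T
            ≤ C * (β * H * √(T * effDim G.φ H T lam) + 1)}) ∧
    -- the resulting rate for the smallest admissible bonus, with a constant depending on `B` only
    (∀ B : ℝ, ∃ C : ℝ, 0 < C ∧
      ∀ (S A 𝓗 Ω : Type*)
        [Countable S] [MeasurableSpace S] [MeasurableSingletonClass S]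
        [Fintype A] [MeasurableSpace A] [MeasurableSingletonClass A]
        [NormedAddCommGroup 𝓗] [InnerProductSpace ℝ 𝓗] [CompleteSpace 𝓗]
        [MeasurableSpace Ω] (μ : Measure Ω) [IsProbabilityMeasure μ]
        (H T : ℕ) (lam β δ : ℝ) (G : KernelMixtureGame S A 𝓗 H)
        (findCCE : (S × A × A → ℝ) → (S × A × A → ℝ) → S → PMF (A × A))
        (D : Ω → Data S A),
        0 < H → 0 < T → 0 < δ → δ < 1 → 0 < β → (∀ h, ‖G.θ h‖ ≤ B) →
        lam = 1 + 1 / (T : ℝ) →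
        (β / H) ^ 2
          = 2 * effDim G.φ H T lam + 2 + 4 * Real.log (H / δ) + 2 * lam * (B / H) ^ 2 →
        IsCCEFinder findCCE → IsRun G (G.algInput findCCE lam β) T μ D →
        ENNReal.ofReal (1 - δ) ≤
          μ {ω | regret G (G.algInput findCCE lam β) (D ω) T
            ≤ C * (effDim G.φ H T lam * (H : ℝ) ^ 2 * √T * √(1 + Real.log (H / δ)))}) := by
  refine ⟨⟨16, by norm_num, ?_⟩, fun B => ?_⟩
  · intro S A 𝓗 Ω _ _ _ _ _ _ _ _ _ _ μ _ H T B lam β δ G findCCE D hH hT hδ hβ0 hB hlam hβ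
      hcce hrun
    exact measure_regret_le_universal hH hT hδ hβ0 hB hlam hβ hcce hrun
  · -- A game with `B < 1` does not exist, so that the constant matters for `1 ≤ B` only.
    set b : ℝ := max B 1 with hb
    have hb1 : 1 ≤ b := le_max_right _ _
    set g : ℝ := Real.log (1 + 1 / (2 * b ^ 2)) / 2 with hg
    have hg0 : 0 < g := by
      have : 0 < Real.log (1 + 1 / (2 * b ^ 2)) :=
        Real.log_pos (lt_add_of_pos_right _ (by positivity))
      positivity
    refine ⟨16 * (2 + (4 + 4 * B ^ 2) / g + 1 / g), by positivity, ?_⟩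
    intro S A 𝓗 Ω _ _ _ _ _ _ _ _ _ _ μ _ H T lam β δ G findCCE D hH hT hδ hδ1 hβ0 hB hlam hβ
      hcce hrun
    obtain ⟨ω₀⟩ : Nonempty Ω := μ.nonempty_of_neZero
    have : Nonempty S := ⟨(D ω₀).x 0 0⟩
    have : Nonempty A := ⟨(D ω₀).a 0 0⟩
    have hH1 : (1 : ℝ) ≤ H := by exact_mod_cast hH
    have hT1 : (1 : ℝ) ≤ T := by exact_mod_cast hT
    have hlam0 : 0 < lam := by rw [hlam]; positivity
    have hlam2 : lam ≤ 2 := by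
      have : 1 / (T : ℝ) ≤ 1 := by rw [div_le_one (by positivity)]; exact hT1
      linarith
    have hbB : b = B := max_eq_left (G.one_le_of_norm_theta_le hH hB)
    have hgΓ : g ≤ effDim G.φ H T lam := by
      have h1 := G.log_one_add_le_effDim hH hB hlam0 T
      have h2 : Real.log (1 + 1 / (2 * b ^ 2)) ≤
          Real.log (1 + T * (H : ℝ) ^ 2 / (lam * B ^ 2)) := by
        rw [← hbB]
        refine Real.log_le_log (by positivity) ?_
        gcongr
        exact one_le_mul_of_one_le_of_one_le hT1 (one_le_pow₀ hH1)
      linarith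
    refine (measure_regret_le_universal hH hT hδ hβ0 hB hlam hβ.ge hcce hrun).trans
      (measure_mono fun ω hω => ?_)
    simp only [Set.mem_ofPred_eq] at hω ⊢
    refine hω.trans ?_
    rw [mul_assoc (16 : ℝ)]
    exact mul_le_mul_of_nonneg_left
      (mul_sqrt_add_one_le hH hT hδ hδ1 hlam2 hg0 hgΓ hβ0 hβ)
      (by norm_num : (0 : ℝ) ≤ 16)
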